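/- **Definitions.** Let $\eta=1/(3\cdot 2^{20}\sqrt2)$, $(t)_+=\max\{t,0\}$, and let $\mathbb D$ be the set of continuous even functions $f:\mathbb R\to\mathbb R$ such that $(1+|x|)^{-1/2}f$ is bounded, $f(0)=1$, $(1-x^2)_+\le f(x)\le 1$ for all $x$, $f$ is non-increasing on $[0,\infty)$, $s\mapsto f(\sqrt s)$ is convex on $[0,\infty)$, and the left derivative satisfies $f'_-(1/2)\le-\eta$. For $f\in\mathbb D$ put $f(+\infty)=\lim_{x\to+\infty}f(x)$, $$b(f)=\frac2\pi\int_0^\infty\big(f(y)-f(+\infty)\big)\,dy\in[0,\infty],\qquad c(f)=\frac2\pi\int_0^\infty\frac{f(0)-f(y)}{y^2}\,dy,$$ $$T(f)(x)=\frac1\pi\int_0^\infty f(y)\Big(\frac yx\ln\Big|\frac{x+y}{x-y}\Big|-2\Big)dy\quad(x\neq0),\qquad T(f)(0)=0,$$ $$T_a(f)=\Big(1+\frac{2a\,T(f)}{(1-a/3)\,c(f)}\Big)_+ .$$ For $a\le 1$, $a\ne0$, define $$R_a(f)(x)=T_a(f)(x)^{1/a}\exp\Big(\frac{1-a}{a}\int_0^x\frac{T_a(f)(y)-T_a(f)(0)}{y\,T_a(f)(y)}\,dy\Big),$$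 where $R_a(f)(x)=0$ if $T_a(f)(x)=0$, and define $$R_0(f)(x)=\exp\Big(\frac{2}{c(f)}\Big(T(f)(x)+\int_0^x\frac{T(f)(y)}{y}\,dy\Big)\Big).$$ **Theorem.** Let $a\le1$ and let $f\in\mathbb D$ be a fixed point of $R_a$, i.e. $R_a(f)=f$. Then $b(f)<\infty$, and with $k=b(f)/c(f)$ and $L=\sup\{x: f(x)>0\}$: 1. If $2ak>1-a/3$, then $L<\infty$, $f$ is compactly supported, its closed support is $[-L,L]$, and $f$ is $C^\infty$ on the open interval $(-L,L)$. 2. If $2ak\le 1-a/3$, then $f(x)>0$ for all $x\in\mathbb R$, $f$ is differentiable on $\mathbb R$, and both $f$ and $(xf)'$ belong to the Sobolev space $H^p(\mathbb R)$ for every real $p\ge0$. -/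

import Mathlib

open Set Filter Topology MeasureTheory
open scoped ContDiff ENNReal SchwartzMap

noncomputable section

namespace GCLM

/-- The constant `η = 1 / (3 · 2^20 · √2)`. -/
def eta : ℝ := 1 / (3 * 2 ^ 20 * √2)

/-- The space `𝕍` of continuous even functions `f` for which `(1 + |x|)^(-1/2) f(x)` is bounded. -/
def spaceV : Set (ℝ → ℝ) :=
  {f | Continuous f ∧ (∀ x, f (-x) = f x) ∧
    ∃ C : ℝ, ∀ x, |(1 + |x|) ^ (-(1 / 2) : ℝ) * f x| ≤ C}

/-- The convex set `𝔻 ⊆ 𝕍`. The last condition bounds the left derivative of `f` at `1/2`,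
which exists because `s ↦ f (√s)` is convex. -/
def setD : Set (ℝ → ℝ) :=
  {f | f ∈ spaceV ∧ f 0 = 1 ∧
    (∀ x, max (1 - x ^ 2) 0 ≤ f x ∧ f x ≤ 1) ∧
    AntitoneOn f (Ici 0) ∧
    ConvexOn ℝ (Ici 0) (fun s => f (√s)) ∧
    derivWithin f (Iio (1 / 2)) (1 / 2) ≤ -eta}

/-- The linear map `T(f)(x) = (1/π) ∫_0^∞ f(y) ((y/x) log|(x+y)/(x-y)| - 2) dy`.
At `x = 0` the kernel is understood as its limit, which is `0`. -/
def T (f : ℝ → ℝ) (x : ℝ) : ℝ :=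
  if x = 0 then 0
  else (1 / Real.pi) *
    ∫ y in Ioi (0 : ℝ), f y * (y / x * Real.log |(x + y) / (x - y)| - 2)

/-- `f(+∞)`; the limit exists for every `f ∈ 𝔻`, by monotonicity. -/
def atInfinity (f : ℝ → ℝ) : ℝ := limUnder atTop f

/-- `b(f) = (2/π) ∫_0^∞ (f(y) - f(+∞)) dy`, an element of `[0, ∞]`
(for `f ∈ 𝔻` the integrand is nonnegative). -/
def b (f : ℝ → ℝ) : ℝ≥0∞ :=
  ENNReal.ofReal (2 / Real.pi) * ∫⁻ y in Ioi (0 : ℝ), ENNReal.ofReal (f y - atInfinity f)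

/-- `c(f) = (2/π) ∫_0^∞ (f(0) - f(y)) / y² dy`; finite and positive for every `f ∈ 𝔻`. -/
def c (f : ℝ → ℝ) : ℝ :=
  (2 / Real.pi) * ∫ y in Ioi (0 : ℝ), (f 0 - f y) / y ^ 2

/-- The ratio `k = b(f) / c(f)`, to be used when `b(f)` is finite. -/
def k (f : ℝ → ℝ) : ℝ := (b f).toReal / c f

/-- `T_a(f) = (1 + 2 a T(f) / ((1 - a/3) c(f)))_+`. -/
def Ta (a : ℝ) (f : ℝ → ℝ) (x : ℝ) : ℝ :=
  max (1 + 2 * a * T f x / ((1 - a / 3) * c f)) 0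

/-- The nonlinear map `R_a`, with its own formula at `a = 0`. -/
def R (a : ℝ) (f : ℝ → ℝ) (x : ℝ) : ℝ :=
  if a = 0 then
    Real.exp (2 / c f * (T f x + ∫ y in (0 : ℝ)..x, T f y / y))
  else
    Ta a f x ^ (1 / a) *
      Real.exp ((1 - a) / a * ∫ y in (0 : ℝ)..x, (Ta a f y - Ta a f 0) / (y * Ta a f y))

/-- `u ∈ H^p(ℝ)` for a real-valued function `u` and a real order `p ≥ 0`: `u` is square integrable
and, as a tempered distribution, belongs to the `L²`-based Sobolev space of order `p`. -/
def MemH (p : ℝ) (u : ℝ → ℝ) : Prop :=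
  ∃ h : MemLp (fun x => (u x : ℂ)) 2 (volume : Measure ℝ),
    TemperedDistribution.MemSobolev p 2
      (Lp.toTemperedDistribution (h.toLp (fun x => (u x : ℂ))) : 𝓢'(ℝ, ℂ))

/-- `L = sup {x : f(x) > 0}`, to be used when this set is bounded above. -/
def L (f : ℝ → ℝ) : ℝ := sSup {x | 0 < f x}

end GCLM

end

/-! After the substitution `y = |x| t`, `T f x` is `|x| / π` times the integral of `f (|x| t)`
against `ker t = t log|(1+t)/(1-t)| - 2`. This kernel has mean zero and changes sign once, from
negative to positive. Hence `T f ≤ 0` for `f` non-increasing on `[0, ∞)` (`T_nonpos`), and `f` may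
be replaced by its decaying part `dec f = f - f(∞)`. If `dec f` is integrable, `T f + b` is an
operator with positive kernel applied to `dec f`, and `T f → -b` at infinity; otherwise `T f → -∞`.
A fixed point excludes the second alternative (`IsProfile.fixed_integrable`). Write `C = cst a f`
and `theta = 1 + a C T f`. For `a > 0`, `theta` would become negative and `f` would vanish far out;
for `a ≤ 0` the exponent in `R_a` would force decay faster than `1 / x`.

So `theta` tends to `thetaInf = 1 - a C b`, whose sign is the dichotomy of the theorem. If it is
negative, `f` vanishes far out. Otherwise `T f > -b` keeps `theta` positive, and `f > 0`. The value
`a = 1` is then impossible (`IsProfile.ne_one`), and for `a < 1` the exponent gives power decay, of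
every order when `thetaInf = 0`; in particular `f(∞) = 0`.

For smoothness, the potential `pot f = x (T f + b)` is, up to a constant factor, the convolution of
`x f` with `log |·|`, and the fixed point equation becomes `x f' = f (E - 1)`, or `(x f)' = f E`.
Here `E` is built from `(pot f)'` and `theta`, and `theta` from an average of `(pot f)'` along rays.
Convexity of `f (√s)` makes `x f` Lipschitz, which starts an induction: the logarithmic kernel sends
bounded functions to Hölder functions, and Hölder functions to differentiable ones, so two turns
gain a derivative of `(pot f)'` (`IsProfile.reg_deriv_pot`).

On the whole line all bounds are powers of a weight `V`, equal to `1` if `thetaInf > 0` and to `1 +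
x²` if `thetaInf = 0`. Each derivative of `f` or `(x f)'` is `f` times a function so bounded.
Integrability of `f`, or its rapid decay in the second case, puts all derivatives in `L²`, which
gives every Sobolev order (`memH_of_hasDerivAt`). -/

namespace GCLM

/-! ### Sobolev regularity from square integrable derivatives. -/

section Sobolev

open TemperedDistribution
open scoped LineDeriv Laplacian

lemma laplacian_real_eq (F : 𝓢'(ℝ, ℂ)) :
    Δ F = ∂_{(1 : ℝ)} (∂_{(1 : ℝ)} F) := by
  rw [TemperedDistribution.laplacian_eq_sum (OrthonormalBasis.singleton (Fin 1) ℝ)]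
  simp

/-- Integration by parts identifies the distributional derivative of a classical derivative. -/
lemma lineDeriv_toTemperedDistribution {g g' : ℝ → ℂ} (hg : MemLp g 2 volume)
    (hg' : MemLp g' 2 volume) (hd : ∀ x, HasDerivAt g (g' x) x) :
    ∂_{(1 : ℝ)} (Lp.toTemperedDistribution (hg.toLp g) : 𝓢'(ℝ, ℂ)) =
      Lp.toTemperedDistribution (hg'.toLp g') := by
  ext φ
  rw [lineDerivOp_apply_apply, Lp.toTemperedDistribution_apply, Lp.toTemperedDistribution_apply]
  have h1 : ∫ x, (-∂_{(1 : ℝ)} φ) x • (hg.toLp g) x = ∫ x, (-∂_{(1 : ℝ)} φ) x • g x := by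
    apply integral_congr_ae
    filter_upwards [hg.coeFn_toLp] with x hx
    rw [hx]
  have h2 : ∫ x, φ x • (hg'.toLp g') x = ∫ x, φ x • g' x := by
    apply integral_congr_ae
    filter_upwards [hg'.coeFn_toLp] with x hx
    rw [hx]
  rw [h1, h2]
  have hφ : ∀ x, HasDerivAt φ ((∂_{(1 : ℝ)} φ) x) x := by
    intro x
    rw [SchwartzMap.lineDerivOp_apply]
    have := (φ.differentiable x).hasDerivAt
    rw [(φ.differentiable x).lineDeriv_eq_fderiv, fderiv_eq_smul_deriv, one_smul]
    exact this
  have hint : ∀ (ψ : 𝓢(ℝ, ℂ)) {h : ℝ → ℂ}, MemLp h 2 volume →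
      Integrable (h * (ψ : ℝ → ℂ)) volume := by
    intro ψ h hh
    exact hh.integrable_mul (ψ.memLp 2)
  have := integral_mul_deriv_eq_deriv_mul_of_integrable (u := g) (v := φ)
    (u' := g') (v' := ((∂_{(1 : ℝ)} φ : 𝓢(ℝ, ℂ)) : ℝ → ℂ)) (fun x _ => hd x) (fun x _ => hφ x)
    (hint _ hg) (hint _ hg') (hint _ hg)
  simp only [smul_eq_mul, neg_apply, neg_mul, integral_neg]
  simp only [mul_comm (φ _), mul_comm ((∂_{(1 : ℝ)} φ) _)]
  rw [this, neg_neg]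

/-- The symbol `(1 + |ξ|²)^(2/2)` is a polynomial, so the Bessel potential of order `2` is `1 -
(2π)⁻² Δ`. -/
lemma memSobolev_add_two {F : 𝓢'(ℝ, ℂ)} {s : ℝ} (h0 : MemSobolev s 2 F)
    (h2 : MemSobolev s 2 (Δ F)) : MemSobolev (2 + s) 2 F := by
  rw [← memSobolev_besselPotential_iff]
  have key : besselPotential ℝ ℂ 2 F =
      F - (((2 * Real.pi) ^ 2)⁻¹ : ℂ) • Δ F := by
    rw [besselPotential, laplacian_eq_fourierMultiplierCLM]
    have e : (fun x : ℝ => (((1 + ‖x‖ ^ 2) ^ ((2 : ℝ) / 2) : ℝ) : ℂ)) =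
        fun x : ℝ => (1 : ℂ) + ((‖x‖ ^ 2 : ℝ) : ℂ) := by
      ext x
      norm_num
    rw [e]
    have e2 : fourierMultiplierCLM ℂ (fun x : ℝ => (1 : ℂ) + ((‖x‖ ^ 2 : ℝ) : ℂ)) F =
        F + fourierMultiplierCLM ℂ (fun x : ℝ => ((‖x‖ ^ 2 : ℝ) : ℂ)) F := by
      have := fourierMultiplierCLM_sum (F := ℂ) (E := ℝ) (s := (Finset.univ : Finset (Fin 2)))
        (g := fun i => if i = 0 then (fun _ => (1 : ℂ)) else fun x : ℝ => ((‖x‖ ^ 2 : ℝ) : ℂ))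
        (by
          intro i _
          fin_cases i
          · simp only [Fin.zero_eta, if_true]; fun_prop
          · simp only [Fin.mk_one, one_ne_zero, if_false]; fun_prop)
      simp only [Fin.sum_univ_two, if_true, one_ne_zero, if_false] at this
      rw [this]
      simp
    rw [e2]
    rw [neg_smul, smul_neg, sub_neg_eq_add]
    congr 1
    have hpi : ((2 * Real.pi : ℝ) : ℂ) ≠ 0 := by
      exact_mod_cast (by positivity : (2 * Real.pi : ℝ) ≠ 0)
    rw [← Complex.coe_smul, smul_smul]
    push_cast at hpi ⊢
    rw [inv_mul_cancel₀ (pow_ne_zero 2 hpi), one_smul]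
  rw [key]
  exact h0.sub (h2.smul _)

/-- A function all of whose derivatives are square integrable lies in every Sobolev space. -/
theorem memH_of_hasDerivAt {g : ℕ → ℝ → ℝ} (hd : ∀ n x, HasDerivAt (g n) (g (n + 1) x) x)
    (hL : ∀ n, MemLp (g n) 2 volume) (p : ℝ) : MemH p (g 0) := by
  have hC : ∀ n, MemLp (fun x => (g n x : ℂ)) 2 (volume : Measure ℝ) := fun n => (hL n).ofReal
  have hdC : ∀ n x, HasDerivAt (fun x => (g n x : ℂ)) ((g (n + 1) x : ℂ)) x :=
    fun n x => (hd n x).ofReal_comp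
  have hlap : ∀ n, Δ (Lp.toTemperedDistribution ((hC n).toLp _) : 𝓢'(ℝ, ℂ)) =
      Lp.toTemperedDistribution ((hC (n + 2)).toLp _) := by
    intro n
    rw [laplacian_real_eq, lineDeriv_toTemperedDistribution (hC n) (hC (n + 1)) (hdC n),
      lineDeriv_toTemperedDistribution (hC (n + 1)) (hC (n + 2)) (hdC (n + 1))]
  -- The induction runs over all `n` at once: raising the order for `g n` uses the lower order for
  -- `g (n + 2)`.
  have main : ∀ m n : ℕ, MemSobolev (2 * m : ℝ) 2
      (Lp.toTemperedDistribution ((hC n).toLp _) : 𝓢'(ℝ, ℂ)) := by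
    intro m
    induction m with
    | zero =>
      intro n
      simp only [Nat.cast_zero, mul_zero]
      rw [memSobolev_zero_iff]
      exact ⟨_, rfl⟩
    | succ m ih =>
      intro n
      have := memSobolev_add_two (ih n) (by rw [hlap]; exact ih (n + 2))
      convert this using 1
      push_cast; ring
  refine ⟨hC 0, ?_⟩
  obtain ⟨m, hm⟩ := exists_nat_ge p
  exact (main m 0).mono (by linarith [(Nat.cast_nonneg m : (0 : ℝ) ≤ m)])

end Sobolev

/-! ### Weighted function classes and averages along rays. -/

/-- Weight functions that are slowly varying and monotone along rays. -/
structure IsWeight (V : ℝ → ℝ) : Prop where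
  one_le : ∀ x, 1 ≤ V x
  slow : ∃ K : ℝ, 1 ≤ K ∧ ∀ x y, |x - y| ≤ 1 → V y ≤ K * V x
  ray : ∀ x t, t ∈ Icc (0 : ℝ) 1 → V (t * x) ≤ V x

/-- Continuous functions on `U` bounded by a power of the weight `V`. -/
def Tame (U : Set ℝ) (V : ℝ → ℝ) (g : ℝ → ℝ) : Prop :=
  ContinuousOn g U ∧ ∃ C : ℝ, ∃ m : ℕ, 0 ≤ C ∧ ∀ x ∈ U, |g x| ≤ C * V x ^ m

/-- Tame functions that are Hölder continuous of exponent `1/2` at unit scale. -/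
def TameHolder (U : Set ℝ) (V : ℝ → ℝ) (g : ℝ → ℝ) : Prop :=
  Tame U V g ∧ ∃ C : ℝ, ∃ m : ℕ, 0 ≤ C ∧
    ∀ x ∈ U, ∀ y ∈ U, |x - y| ≤ 1 → |g x - g y| ≤ C * V x ^ m * √|x - y|

/-- `n` times differentiable on `U`, with all derivatives in the class `B`. -/
def Reg (U : Set ℝ) (B : (ℝ → ℝ) → Prop) : ℕ → (ℝ → ℝ) → Prop
  | 0, g => B g
  | n + 1, g => B g ∧ ∃ g' : ℝ → ℝ, (∀ x ∈ U, HasDerivAt g (g' x) x) ∧ Reg U B n g'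

/-- Weighted averages along rays. -/
noncomputable def rayAvg (j : ℕ) (g : ℝ → ℝ) (x : ℝ) : ℝ := ∫ t in (0 : ℝ)..1, t ^ j * g (t * x)

/-- Closure properties of a class of functions needed for the calculus of `Reg`. -/
structure IsAlgebraClass (U : Set ℝ) (V : ℝ → ℝ) (B : (ℝ → ℝ) → Prop) : Prop where
  tame : ∀ g, B g → Tame U V g
  congr : ∀ g h, EqOn g h U → B g → B h
  const : ∀ c : ℝ, B fun _ => c
  add : ∀ g h, B g → B h → B fun x => g x + h x
  mul : ∀ g h, B g → B h → B fun x => g x * h x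
  inv : ∀ h, B h → (∀ x ∈ U, h x ≠ 0) → Tame U V (fun x => (h x)⁻¹) → B fun x => (h x)⁻¹
  avg : ∀ j g, B g → B (rayAvg j g)

/-- Open sets that are star-shaped about the origin. -/
structure IsStarOpen (U : Set ℝ) : Prop where
  isOpen : IsOpen U
  star : ∀ x ∈ U, ∀ t ∈ Icc (0 : ℝ) 1, t * x ∈ U

/-- Local version of `hasDerivAt_of_hasDerivAt_of_ne`. -/
lemma hasDerivAt_of_eventually_ne {f g : ℝ → ℝ} {x : ℝ}
    (hd : ∀ᶠ y in 𝓝 x, y ≠ x → HasDerivAt f (g y) y) (hf : ContinuousAt f x)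
    (hg : ContinuousAt g x) : HasDerivAt f (g x) x := by
  obtain ⟨δ, hδ, hball⟩ := Metric.eventually_nhds_iff_ball.1 hd
  have hne : ∀ y ∈ Ioo x (x + δ), HasDerivAt f (g y) y := fun y hy =>
    hball y (by rw [Metric.mem_ball, Real.dist_eq, abs_lt]; constructor <;> linarith [hy.1, hy.2])
      hy.1.ne'
  have hne' : ∀ y ∈ Ioo (x - δ) x, HasDerivAt f (g y) y := fun y hy =>
    hball y (by rw [Metric.mem_ball, Real.dist_eq, abs_lt]; constructor <;> linarith [hy.1, hy.2])
      hy.2.ne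
  have A : HasDerivWithinAt f (g x) (Ici x) x := by
    apply hasDerivWithinAt_Ici_of_tendsto_deriv (s := Ioo x (x + δ))
      (fun y hy => (hne y hy).differentiableAt.differentiableWithinAt) hf.continuousWithinAt
      (Ioo_mem_nhdsGT (by linarith))
    have : Tendsto g (𝓝[>] x) (𝓝 (g x)) := tendsto_inf_left hg
    apply this.congr' _
    filter_upwards [Ioo_mem_nhdsGT (show x < x + δ by linarith)] with y hy
    exact (hne y hy).deriv.symm
  have B : HasDerivWithinAt f (g x) (Iic x) x := by
    apply hasDerivWithinAt_Iic_of_tendsto_deriv (s := Ioo (x - δ) x)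
      (fun y hy => (hne' y hy).differentiableAt.differentiableWithinAt) hf.continuousWithinAt
      (Ioo_mem_nhdsLT (by linarith))
    have : Tendsto g (𝓝[<] x) (𝓝 (g x)) := tendsto_inf_left hg
    apply this.congr' _
    filter_upwards [Ioo_mem_nhdsLT (show x - δ < x by linarith)] with y hy
    exact (hne' y hy).deriv.symm
  simpa using B.union A

section Tame

variable {U : Set ℝ} {V : ℝ → ℝ} {g h : ℝ → ℝ}

lemma IsWeight.pos (hV : IsWeight V) (x : ℝ) : 0 < V x := lt_of_lt_of_le one_pos (hV.one_le x)

lemma IsWeight.bound_mono (hV : IsWeight V) {C C' : ℝ} {m m' : ℕ} (hC : C ≤ C') (hC' : 0 ≤ C')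
    (hm : m ≤ m') (x : ℝ) : C * V x ^ m ≤ C' * V x ^ m' :=
  mul_le_mul hC (pow_le_pow_right₀ (hV.one_le x) hm) (pow_nonneg (hV.pos x).le _) hC'

lemma Tame.congr (hg : Tame U V g) (he : EqOn g h U) : Tame U V h := by
  obtain ⟨hc, C, m, hC, hb⟩ := hg
  exact ⟨hc.congr he.symm, C, m, hC, fun x hx => by rw [← he hx]; exact hb x hx⟩

lemma Tame.const (U : Set ℝ) (V : ℝ → ℝ) (c : ℝ) : Tame U V fun _ => c :=
  ⟨continuousOn_const, |c|, 0, abs_nonneg _, fun x _ => by simp⟩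

lemma Tame.add (hV : IsWeight V) (hg : Tame U V g) (hh : Tame U V h) :
    Tame U V fun x => g x + h x := by
  obtain ⟨hc, C, m, hC, hb⟩ := hg
  obtain ⟨hc', C', m', hC', hb'⟩ := hh
  refine ⟨hc.add hc', C + C', m + m', by positivity, fun x hx => ?_⟩
  calc |g x + h x| ≤ |g x| + |h x| := abs_add_le _ _
    _ ≤ C * V x ^ m + C' * V x ^ m' := add_le_add (hb x hx) (hb' x hx)
    _ ≤ C * V x ^ (m + m') + C' * V x ^ (m + m') :=
        add_le_add (hV.bound_mono le_rfl hC (by omega) x) (hV.bound_mono le_rfl hC' (by omega) x)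
    _ = _ := by ring

lemma Tame.mul (hg : Tame U V g) (hh : Tame U V h) :
    Tame U V fun x => g x * h x := by
  obtain ⟨hc, C, m, hC, hb⟩ := hg
  obtain ⟨hc', C', m', hC', hb'⟩ := hh
  refine ⟨hc.mul hc', C * C', m + m', by positivity, fun x hx => ?_⟩
  calc |g x * h x| = |g x| * |h x| := abs_mul _ _
    _ ≤ (C * V x ^ m) * (C' * V x ^ m') :=
        mul_le_mul (hb x hx) (hb' x hx) (abs_nonneg _) ((abs_nonneg _).trans (hb x hx))
    _ = _ := by ring

lemma Tame.rayAvg_integrand (hU : IsStarOpen U) (hg : ContinuousOn g U) (j : ℕ) {x : ℝ}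
    (hx : x ∈ U) : ContinuousOn (fun t : ℝ => t ^ j * g (t * x)) (Icc 0 1) := by
  apply (continuous_pow j).continuousOn.mul
  exact hg.comp (by fun_prop) fun t ht => hU.star x hx t ht

lemma rayAvg_bound_sub (hU : IsStarOpen U) (hg : ContinuousOn g U) (j : ℕ)
    {x y M : ℝ} (hx : x ∈ U) (hy : y ∈ U)
    (hb : ∀ t ∈ Icc (0 : ℝ) 1, |g (t * x) - g (t * y)| ≤ M) :
    |rayAvg j g x - rayAvg j g y| ≤ M := by
  unfold rayAvg
  have h1 := Tame.rayAvg_integrand hU hg j hx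
  have h2 := Tame.rayAvg_integrand hU hg j hy
  rw [← intervalIntegral.integral_sub (h1.intervalIntegrable_of_Icc zero_le_one)
    (h2.intervalIntegrable_of_Icc zero_le_one)]
  have := intervalIntegral.norm_integral_le_of_norm_le_const (a := (0 : ℝ)) (b := 1) (C := M)
    (f := fun t => t ^ j * g (t * x) - t ^ j * g (t * y)) (by
      intro t ht
      rw [uIoc_of_le zero_le_one] at ht
      rw [← mul_sub, Real.norm_eq_abs, abs_mul, abs_of_nonneg (pow_nonneg ht.1.le j)]
      calc t ^ j * |g (t * x) - g (t * y)| ≤ 1 * |g (t * x) - g (t * y)| :=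
            mul_le_mul_of_nonneg_right (pow_le_one₀ ht.1.le ht.2) (abs_nonneg _)
        _ ≤ M := by rw [one_mul]; exact hb t ⟨ht.1.le, ht.2⟩)
  simpa using this

lemma rayAvg_bound (g : ℝ → ℝ) (j : ℕ) {x M : ℝ} (hb : ∀ t ∈ Icc (0 : ℝ) 1, |g (t * x)| ≤ M) :
    |rayAvg j g x| ≤ M := by
  have := intervalIntegral.norm_integral_le_of_norm_le_const (a := (0 : ℝ)) (b := 1) (C := M)
    (f := fun t => t ^ j * g (t * x)) (by
      intro t ht
      rw [uIoc_of_le zero_le_one] at ht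
      rw [Real.norm_eq_abs, abs_mul, abs_of_nonneg (pow_nonneg ht.1.le j)]
      calc t ^ j * |g (t * x)| ≤ 1 * |g (t * x)| :=
            mul_le_mul_of_nonneg_right (pow_le_one₀ ht.1.le ht.2) (abs_nonneg _)
        _ ≤ M := by rw [one_mul]; exact hb t ⟨ht.1.le, ht.2⟩)
  simpa [rayAvg] using this

/-- Points near `x ∈ U` stay, together with their rays, in a compact subset of `U`. -/
lemma exists_ray_bound (hU : IsStarOpen U) (hg : ContinuousOn g U) {x : ℝ} (hx : x ∈ U) :
    ∃ δ > 0, Metric.ball x δ ⊆ U ∧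
      ∃ M, ∀ y ∈ Metric.ball x δ, ∀ t ∈ Icc (0 : ℝ) 1, |g (t * y)| ≤ M := by
  obtain ⟨δ, hδ, hball⟩ := Metric.nhds_basis_closedBall.mem_iff.1 (hU.isOpen.mem_nhds hx)
  have hK : IsCompact ((fun p : ℝ × ℝ => p.1 * p.2) '' (Icc (0 : ℝ) 1 ×ˢ Metric.closedBall x δ)) :=
    (isCompact_Icc.prod (isCompact_closedBall x δ)).image (by fun_prop)
  have hsub : (fun p : ℝ × ℝ => p.1 * p.2) '' (Icc (0 : ℝ) 1 ×ˢ Metric.closedBall x δ) ⊆ U := by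
    rintro _ ⟨⟨t, y⟩, ⟨ht, hy⟩, rfl⟩
    exact hU.star y (hball hy) t ht
  obtain ⟨M, hM⟩ := hK.exists_bound_of_continuousOn (hg.mono hsub)
  refine ⟨δ, hδ, Metric.ball_subset_closedBall.trans hball, M, fun y hy t ht => ?_⟩
  exact hM _ ⟨(t, y), ⟨ht, Metric.ball_subset_closedBall hy⟩, rfl⟩

lemma continuousOn_rayAvg (hU : IsStarOpen U) (hg : ContinuousOn g U) (j : ℕ) :
    ContinuousOn (rayAvg j g) U := by
  intro x hx
  apply ContinuousAt.continuousWithinAt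
  obtain ⟨δ, hδ, hball, M, hM⟩ := exists_ray_bound hU hg hx
  apply intervalIntegral.continuousAt_of_dominated_interval (bound := fun _ => M)
  · filter_upwards [Metric.ball_mem_nhds x hδ] with y hy
    rw [uIoc_of_le zero_le_one]
    exact ((Tame.rayAvg_integrand hU hg j (hball hy)).mono Ioc_subset_Icc_self).aestronglyMeasurable
      measurableSet_Ioc
  · filter_upwards [Metric.ball_mem_nhds x hδ] with y hy
    refine ae_of_all _ fun t ht => ?_
    rw [uIoc_of_le zero_le_one] at ht
    rw [Real.norm_eq_abs, abs_mul, abs_of_nonneg (pow_nonneg ht.1.le j)]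
    calc t ^ j * |g (t * y)| ≤ 1 * |g (t * y)| :=
          mul_le_mul_of_nonneg_right (pow_le_one₀ ht.1.le ht.2) (abs_nonneg _)
      _ ≤ M := by rw [one_mul]; exact hM y hy t ⟨ht.1.le, ht.2⟩
  · exact intervalIntegrable_const
  · refine ae_of_all _ fun t ht => ?_
    rw [uIoc_of_le zero_le_one] at ht
    apply continuousAt_const.mul
    have : ContinuousAt g (t * x) :=
      hg.continuousAt (hU.isOpen.mem_nhds (hU.star x hx t ⟨ht.1.le, ht.2⟩))
    exact ContinuousAt.comp (f := fun y => t * y) this (by fun_prop)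

lemma hasDerivAt_rayAvg {g' : ℝ → ℝ} (hU : IsStarOpen U)
    (hd : ∀ x ∈ U, HasDerivAt g (g' x) x) (hg' : ContinuousOn g' U) (j : ℕ) {x : ℝ}
    (hx : x ∈ U) : HasDerivAt (rayAvg j g) (rayAvg (j + 1) g' x) x := by
  have hg : ContinuousOn g U := fun y hy => (hd y hy).continuousAt.continuousWithinAt
  obtain ⟨δ, hδ, hball, M, hM⟩ := exists_ray_bound hU hg' hx
  refine (intervalIntegral.hasDerivAt_integral_of_dominated_loc_of_deriv_le
    (F := fun y t => t ^ j * g (t * y)) (F' := fun y t => t ^ (j + 1) * g' (t * y))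
    (bound := fun _ => M) (Metric.ball_mem_nhds x hδ) ?_ ?_ ?_ ?_ ?_ ?_).2
  · filter_upwards [Metric.ball_mem_nhds x hδ] with y hy
    rw [uIoc_of_le zero_le_one]
    exact ((Tame.rayAvg_integrand hU hg j (hball hy)).mono Ioc_subset_Icc_self).aestronglyMeasurable
      measurableSet_Ioc
  · exact (Tame.rayAvg_integrand hU hg j hx).intervalIntegrable_of_Icc zero_le_one
  · rw [uIoc_of_le zero_le_one]
    exact ((Tame.rayAvg_integrand hU hg' (j + 1) hx).mono
      Ioc_subset_Icc_self).aestronglyMeasurable measurableSet_Ioc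
  · refine ae_of_all _ fun t ht y hy => ?_
    rw [uIoc_of_le zero_le_one] at ht
    rw [Real.norm_eq_abs, abs_mul, abs_of_nonneg (pow_nonneg ht.1.le _)]
    calc t ^ (j + 1) * |g' (t * y)| ≤ 1 * |g' (t * y)| :=
          mul_le_mul_of_nonneg_right (pow_le_one₀ ht.1.le ht.2) (abs_nonneg _)
      _ ≤ M := by rw [one_mul]; exact hM y hy t ⟨ht.1.le, ht.2⟩
  · exact intervalIntegrable_const
  · refine ae_of_all _ fun t ht y hy => ?_
    rw [uIoc_of_le zero_le_one] at ht
    have h1 : HasDerivAt g (g' (t * y)) (t * y) :=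
      hd _ (hU.star y (hball hy) t ⟨ht.1.le, ht.2⟩)
    have h2 : HasDerivAt (fun z => t * z) t y := by simpa using (hasDerivAt_id y).const_mul t
    have h3 := (h1.comp y h2).const_mul (t ^ j)
    exact h3.congr_deriv (by ring)

lemma Tame.rayAvg (hV : IsWeight V) (hU : IsStarOpen U) (hg : Tame U V g) (j : ℕ) :
    Tame U V (rayAvg j g) := by
  obtain ⟨hc, C, m, hC, hb⟩ := hg
  refine ⟨continuousOn_rayAvg hU hc j, C, m, hC, fun x hx => ?_⟩
  apply rayAvg_bound
  intro t ht
  refine (hb _ (hU.star x hx t ht)).trans ?_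
  exact mul_le_mul_of_nonneg_left
    (pow_le_pow_left₀ (hV.pos _).le (hV.ray x t ht) m) hC

theorem isAlgebraClass_tame (hV : IsWeight V) (hU : IsStarOpen U) :
    IsAlgebraClass U V (Tame U V) where
  tame _ h := h
  congr _ _ he h := h.congr he
  const c := Tame.const U V c
  add _ _ h1 h2 := h1.add hV h2
  mul _ _ h1 h2 := h1.mul h2
  inv _ _ _ h := h
  avg j _ h := h.rayAvg hV hU j

/-- A bound at `y` transfers to a bound at the nearby point `x`. -/
lemma IsWeight.exists_transfer (hV : IsWeight V) (m : ℕ) :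
    ∃ K : ℝ, 1 ≤ K ∧ ∀ x y, |x - y| ≤ 1 → V y ^ m ≤ K * V x ^ m := by
  obtain ⟨K, hK, h⟩ := hV.slow
  refine ⟨K ^ m, one_le_pow₀ hK, fun x y hxy => ?_⟩
  rw [← mul_pow]
  exact pow_le_pow_left₀ (hV.pos _).le (h x y hxy) m

/-- Products and reciprocals mix values at `x` and at a nearby `y`; slow variation of `V` moves
every bound to `x`. For averages, `|t x - t y| ≤ |x - y|` and monotonicity of `V` along rays
suffice. -/
theorem isAlgebraClass_tameHolder (hV : IsWeight V) (hU : IsStarOpen U) :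
    IsAlgebraClass U V (TameHolder U V) where
  tame _ h := h.1
  congr g h he := by
    rintro ⟨h1, C, m, hC, hb⟩
    refine ⟨h1.congr he, C, m, hC, fun x hx y hy hxy => ?_⟩
    rw [← he hx, ← he hy]
    exact hb x hx y hy hxy
  const c := ⟨Tame.const U V c, 0, 0, le_rfl, by simp⟩
  add g h := by
    rintro ⟨h1, C, m, hC, hb⟩ ⟨h1', C', m', hC', hb'⟩
    refine ⟨h1.add hV h1', C + C', m + m', by positivity, fun x hx y hy hxy => ?_⟩
    calc |g x + h x - (g y + h y)| = |(g x - g y) + (h x - h y)| := by ring_nf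
      _ ≤ |g x - g y| + |h x - h y| := abs_add_le _ _
      _ ≤ C * V x ^ m * √|x - y| + C' * V x ^ m' * √|x - y| :=
          add_le_add (hb x hx y hy hxy) (hb' x hx y hy hxy)
      _ ≤ C * V x ^ (m + m') * √|x - y| + C' * V x ^ (m + m') * √|x - y| := by
          gcongr
          · exact hV.one_le x
          · omega
          · exact hV.one_le x
          · omega
      _ = _ := by ring
  mul g h := by
    rintro ⟨⟨hc, D, l, hD, hbD⟩, C, m, hC, hb⟩ ⟨⟨hc', D', l', hD', hbD'⟩, C', m', hC', hb'⟩
    obtain ⟨K, hK, hKt⟩ := hV.exists_transfer l'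
    refine ⟨Tame.mul ⟨hc, D, l, hD, hbD⟩ ⟨hc', D', l', hD', hbD'⟩, D * C' + D' * K * C,
      l + l' + m + m', by positivity, fun x hx y hy hxy => ?_⟩
    have hy' : |h y| ≤ D' * K * V x ^ l' :=
      (hbD' y hy).trans (by rw [mul_assoc]; exact mul_le_mul_of_nonneg_left (hKt x y hxy) hD')
    have hVx := hV.one_le x
    have hVp := (hV.pos x).le
    calc |g x * h x - g y * h y| = |g x * (h x - h y) + h y * (g x - g y)| := by ring_nf
      _ ≤ |g x| * |h x - h y| + |h y| * |g x - g y| := by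
          rw [← abs_mul, ← abs_mul]; exact abs_add_le _ _
      _ ≤ (D * V x ^ l) * (C' * V x ^ m' * √|x - y|) +
            (D' * K * V x ^ l') * (C * V x ^ m * √|x - y|) := by
          gcongr
          · exact hbD x hx
          · exact hb' x hx y hy hxy
          · exact hb x hx y hy hxy
      _ = D * C' * V x ^ (l + m') * √|x - y| + D' * K * C * V x ^ (l' + m) * √|x - y| := by ring
      _ ≤ D * C' * V x ^ (l + l' + m + m') * √|x - y| +
            D' * K * C * V x ^ (l + l' + m + m') * √|x - y| := by
          have e1 := pow_le_pow_right₀ hVx (show l + m' ≤ l + l' + m + m' by omega)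
          have e2 := pow_le_pow_right₀ hVx (show l' + m ≤ l + l' + m + m' by omega)
          gcongr ?_ * _ + ?_ * _
          · exact mul_le_mul_of_nonneg_left e1 (by positivity)
          · exact mul_le_mul_of_nonneg_left e2 (by positivity)
      _ = _ := by ring
  inv h := by
    rintro ⟨h1, C, m, hC, hb⟩ h0 ⟨hc, D, l, hD, hbD⟩
    obtain ⟨K, hK, hKt⟩ := hV.exists_transfer l
    refine ⟨⟨hc, D, l, hD, hbD⟩, D * (D * K) * C, l + l + m, by positivity,
      fun x hx y hy hxy => ?_⟩
    have hy' : |(h y)⁻¹| ≤ D * K * V x ^ l :=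
      (hbD y hy).trans (by rw [mul_assoc]; exact mul_le_mul_of_nonneg_left (hKt x y hxy) hD)
    have hVp := (hV.pos x).le
    have e : (h x)⁻¹ - (h y)⁻¹ = -((h x)⁻¹ * (h y)⁻¹ * (h x - h y)) := by
      have := h0 x hx
      have := h0 y hy
      field_simp
      ring
    rw [e, abs_neg, abs_mul, abs_mul]
    calc |(h x)⁻¹| * |(h y)⁻¹| * |h x - h y|
        ≤ (D * V x ^ l) * (D * K * V x ^ l) * (C * V x ^ m * √|x - y|) := by
          gcongr
          · exact hbD x hx
          · exact hb x hx y hy hxy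
      _ = _ := by ring
  avg j g := by
    rintro ⟨h1, C, m, hC, hb⟩
    refine ⟨h1.rayAvg hV hU j, C, m, hC, fun x hx y hy hxy => ?_⟩
    apply rayAvg_bound_sub hU h1.1 j hx hy
    intro t ht
    have e : |t * x - t * y| ≤ |x - y| := by
      rw [← mul_sub, abs_mul, abs_of_nonneg ht.1]
      exact mul_le_of_le_one_left (abs_nonneg _) ht.2
    refine (hb _ (hU.star x hx t ht) _ (hU.star y hy t ht) (e.trans hxy)).trans ?_
    have := hV.pos (t * x)
    have := hV.ray x t ht
    have := (hV.pos x).le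
    gcongr

/-- On convex sets a tame derivative yields the Hölder bound. -/
lemma TameHolder.of_hasDerivAt (hV : IsWeight V) (hconv : Convex ℝ U) {g' : ℝ → ℝ}
    (hg : Tame U V g) (hd : ∀ x ∈ U, HasDerivAt g (g' x) x) (hg' : Tame U V g') :
    TameHolder U V g := by
  obtain ⟨hc, C, m, hC, hb⟩ := hg'
  obtain ⟨K, hK, hKt⟩ := hV.exists_transfer m
  refine ⟨hg, C * K, m, by positivity, fun x hx y hy hxy => ?_⟩
  have hseg : segment ℝ x y ⊆ U := hconv.segment_subset hx hy
  have := (convex_segment x y).norm_image_sub_le_of_norm_hasDerivWithin_le (f := g) (f' := g')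
    (C := C * K * V x ^ m) (fun z hz => (hd z (hseg hz)).hasDerivWithinAt) (by
      intro z hz
      refine (hb z (hseg hz)).trans ?_
      have : |x - z| ≤ 1 := by
        rw [segment_eq_uIcc] at hz
        have := abs_sub_left_of_mem_uIcc hz
        rw [abs_sub_comm x y] at hxy
        rw [abs_sub_comm]
        exact this.trans hxy
      rw [mul_assoc]
      exact mul_le_mul_of_nonneg_left (hKt x z this) hC) (right_mem_segment ℝ x y)
      (left_mem_segment ℝ x y)
  rw [Real.norm_eq_abs, Real.norm_eq_abs] at this
  refine this.trans ?_
  have hVp := (hV.pos x).le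
  apply mul_le_mul_of_nonneg_left _ (by positivity)
  apply Real.le_sqrt_of_sq_le
  have := abs_nonneg (x - y)
  nlinarith

end Tame

/-- The fundamental theorem of calculus on the segment from `0` to `x`: division of `g - g 0` by `x`
costs one derivative and creates no singularity at the origin. -/
lemma sub_eq_mul_rayAvg {U : Set ℝ} {g g' : ℝ → ℝ} {x : ℝ} (hU : IsStarOpen U)
    (hd : ∀ x ∈ U, HasDerivAt g (g' x) x) (hc : ContinuousOn g' U) (hx : x ∈ U) :
    g x - g 0 = x * rayAvg 0 g' x := by
  have hF : ∀ t ∈ uIcc (0 : ℝ) 1, HasDerivAt (fun t => g (t * x)) (x * g' (t * x)) t := by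
    intro t ht
    rw [uIcc_of_le zero_le_one] at ht
    have e1 := hd _ (hU.star x hx t ht)
    have e2 : HasDerivAt (fun t => t * x) x t := by simpa using (hasDerivAt_id t).mul_const x
    have := e1.comp t e2
    rwa [mul_comm] at this
  have hint : IntervalIntegrable (fun t => x * g' (t * x)) volume 0 1 := by
    apply ContinuousOn.intervalIntegrable_of_Icc zero_le_one
    have := Tame.rayAvg_integrand hU hc 0 hx
    simp only [pow_zero, one_mul] at this
    exact continuousOn_const.mul this
  have := intervalIntegral.integral_eq_sub_of_hasDerivAt hF hint
  rw [intervalIntegral.integral_const_mul] at this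
  simp only [one_mul, zero_mul] at this
  rw [← this]
  simp [rayAvg]

/-! ### Calculus of functions with finitely many derivatives in a class. -/

section Reg

variable {U : Set ℝ} {V : ℝ → ℝ} {B : (ℝ → ℝ) → Prop} {g h : ℝ → ℝ} {n : ℕ}

lemma Reg.base (hg : Reg U B n g) : B g := by
  cases n with
  | zero => exact hg
  | succ n => exact hg.1

lemma Reg.of_succ (hg : Reg U B (n + 1) g) : Reg U B n g := by
  induction n generalizing g with
  | zero => exact hg.1
  | succ n ih =>
    obtain ⟨h1, g', hd, h2⟩ := hg
    exact ⟨h1, g', hd, ih h2⟩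

lemma Reg.congr (hB : IsAlgebraClass U V B) (hU : IsOpen U) (hg : Reg U B n g)
    (he : EqOn g h U) : Reg U B n h := by
  cases n with
  | zero => exact hB.congr _ _ he hg
  | succ n =>
    obtain ⟨h1, g', hd, h2⟩ := hg
    refine ⟨hB.congr _ _ he h1, g', fun x hx => ?_, h2⟩
    exact (hd x hx).congr_of_eventuallyEq
      (Filter.eventuallyEq_of_mem (hU.mem_nhds hx) he.symm)

lemma Reg.const (hB : IsAlgebraClass U V B) (c : ℝ) : Reg U B n fun _ => c := by
  induction n generalizing c with
  | zero => exact hB.const c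
  | succ n ih => exact ⟨hB.const c, fun _ => 0, fun x _ => hasDerivAt_const x c, ih 0⟩

lemma Reg.add (hB : IsAlgebraClass U V B) (hg : Reg U B n g) (hh : Reg U B n h) :
    Reg U B n fun x => g x + h x := by
  induction n generalizing g h with
  | zero => exact hB.add _ _ hg hh
  | succ n ih =>
    obtain ⟨h1, g', hd, h2⟩ := hg
    obtain ⟨h1', h', hd', h2'⟩ := hh
    exact ⟨hB.add _ _ h1 h1', _, fun x hx => (hd x hx).add (hd' x hx), ih h2 h2'⟩

lemma Reg.mul (hB : IsAlgebraClass U V B) (hg : Reg U B n g) (hh : Reg U B n h) :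
    Reg U B n fun x => g x * h x := by
  induction n generalizing g h with
  | zero => exact hB.mul _ _ hg hh
  | succ n ih =>
    have hg0 := hg.of_succ
    have hh0 := hh.of_succ
    obtain ⟨h1, g', hd, h2⟩ := hg
    obtain ⟨h1', h', hd', h2'⟩ := hh
    exact ⟨hB.mul _ _ h1 h1', _, fun x hx => (hd x hx).mul (hd' x hx),
      (ih h2 hh0).add hB (ih hg0 h2')⟩

lemma Reg.const_mul (hB : IsAlgebraClass U V B) (c : ℝ) (hg : Reg U B n g) :
    Reg U B n fun x => c * g x :=
  (Reg.const hB c).mul hB hg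

lemma Reg.inv (hB : IsAlgebraClass U V B) (hh : Reg U B n h) (h0 : ∀ x ∈ U, h x ≠ 0)
    (hi : Tame U V fun x => (h x)⁻¹) : Reg U B n fun x => (h x)⁻¹ := by
  induction n with
  | zero => exact hB.inv _ hh h0 hi
  | succ n ih =>
    have hr := ih hh.of_succ
    obtain ⟨h1, h', hd, h2⟩ := hh
    refine ⟨hB.inv _ h1 h0 hi, fun x => (-1) * (h' x * ((h x)⁻¹ * (h x)⁻¹)), fun x hx => ?_,
      (h2.mul hB (hr.mul hB hr)).const_mul hB _⟩
    refine ((hd x hx).inv (h0 x hx)).congr_deriv ?_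
    simp only [div_eq_mul_inv, pow_two, mul_inv]
    ring

lemma Reg.rayAvg (hB : IsAlgebraClass U V B) (hU : IsStarOpen U) (hg : Reg U B n g) (j : ℕ) :
    Reg U B n (rayAvg j g) := by
  induction n generalizing g j with
  | zero => exact hB.avg j _ hg
  | succ n ih =>
    obtain ⟨h1, g', hd, h2⟩ := hg
    exact ⟨hB.avg j _ h1, _, fun x hx =>
      hasDerivAt_rayAvg hU hd (hB.tame _ h2.base).1 j hx, ih h2 (j + 1)⟩

lemma Reg.tameHolder_of_succ (hV : IsWeight V) (hconv : Convex ℝ U)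
    (hg : Reg U (Tame U V) (n + 1) g) : Reg U (TameHolder U V) n g := by
  induction n generalizing g with
  | zero =>
    obtain ⟨h1, g', hd, h2⟩ := hg
    exact TameHolder.of_hasDerivAt hV hconv h1 hd h2
  | succ n ih =>
    obtain ⟨h1, g', hd, h2⟩ := hg
    exact ⟨TameHolder.of_hasDerivAt hV hconv h1 hd h2.base, g', hd, ih h2⟩

lemma Reg.contDiffOn (hU : IsOpen U) (hg : Reg U (Tame U V) n g) : ContDiffOn ℝ n g U := by
  induction n generalizing g with
  | zero => exact contDiffOn_zero.2 hg.1
  | succ n ih =>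
    obtain ⟨h1, g', hd, h2⟩ := hg
    push_cast
    rw [contDiffOn_succ_iff_deriv_of_isOpen hU]
    refine ⟨fun x hx => (hd x hx).differentiableAt.differentiableWithinAt, by simp, ?_⟩
    exact (ih h2).congr fun x hx => (hd x hx).deriv

/-- The logarithmic derivative of a solution of `x f' = f (E - 1)` is an average of `E'`. -/
lemma Reg.exists_logDeriv {f E : ℝ → ℝ} (hB : IsAlgebraClass U V B) (hU : IsStarOpen U)
    (hcf : ContinuousOn f U) (hE : Reg U B (n + 1) E) (hE0 : E 0 = 1)
    (hd : ∀ x ∈ U, x ≠ 0 → HasDerivAt f (f x * (E x - 1) / x) x) :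
    ∃ A, Reg U B n A ∧ ∀ x ∈ U, HasDerivAt f (f x * A x) x := by
  obtain ⟨h1, E', hdE, h2⟩ := hE
  have hcE' : ContinuousOn E' U := (hB.tame _ h2.base).1
  have hA : Reg U B n (GCLM.rayAvg 0 E') := h2.rayAvg hB hU 0
  have hcA := (hB.tame _ hA.base).1
  have hd' : ∀ x ∈ U, x ≠ 0 → HasDerivAt f (f x * GCLM.rayAvg 0 E' x) x := by
    intro x hx hx0
    refine (hd x hx hx0).congr_deriv ?_
    rw [← hE0, sub_eq_mul_rayAvg hU hdE hcE' hx]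
    field_simp
  refine ⟨GCLM.rayAvg 0 E', hA, fun x hx => ?_⟩
  by_cases hx0 : x = 0
  -- The equation says nothing at `0`; the derivative there is the limit of the nearby ones.
  · subst hx0
    have hn : U ∈ 𝓝 (0 : ℝ) := hU.isOpen.mem_nhds hx
    exact hasDerivAt_of_eventually_ne (g := fun x => f x * GCLM.rayAvg 0 E' x)
      (Filter.eventually_of_mem hn hd')
      (hcf.continuousAt hn) ((hcf.continuousAt hn).mul (hcA.continuousAt hn))
  · exact hd' x hx hx0

/-- A solution of `x f' = f (E - 1)` inherits the regularity of `E`. -/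
lemma Reg.of_euler_ode {f E : ℝ → ℝ} (hB : IsAlgebraClass U V B) (hU : IsStarOpen U)
    (hf : B f) (hE : Reg U B n E) (hE0 : E 0 = 1)
    (hd : ∀ x ∈ U, x ≠ 0 → HasDerivAt f (f x * (E x - 1) / x) x) : Reg U B n f := by
  induction n with
  | zero => exact hf
  | succ n ih =>
    -- `f' = f A`, where `A` has `n` derivatives because `E` has `n + 1`, and `f` has `n` by
    -- induction.
    obtain ⟨A, hA, hdA⟩ := hE.exists_logDeriv hB hU (hB.tame _ hf).1 hE0 hd
    exact ⟨hf, fun x => f x * A x, hdA, (ih hE.of_succ).mul hB hA⟩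

end Reg

/-! ### Convolution with compactly supported kernels. -/

/-- `U` and `U'` are open, and `U'` contains the `2ε`-neighbourhood of `U`. -/
structure IsInset (ε : ℝ) (U U' : Set ℝ) : Prop where
  pos : 0 < ε
  le : ε ≤ 1 / 4
  isOpen : IsOpen U
  isOpen' : IsOpen U'
  sub_mem : ∀ x ∈ U, ∀ r, |r| ≤ 2 * ε → x - r ∈ U'

/-- Convolution of a kernel with a function that may be badly behaved far away. -/
noncomputable def conv (K F : ℝ → ℝ) (x : ℝ) : ℝ := ∫ r, K r * F (x - r)

/-- Integrable kernels vanishing outside `[-ε, ε]`. -/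
structure IsKernel (ε : ℝ) (K : ℝ → ℝ) : Prop where
  integrable : Integrable K volume
  supp : ∀ r, ε < |r| → K r = 0

section Conv

variable {U U' : Set ℝ} {V F F' K K' : ℝ → ℝ} {ε x : ℝ}

lemma Tame.local_bound (hV : IsWeight V) (hF : Tame U' V F) :
    ∃ C : ℝ, ∃ m : ℕ, 0 ≤ C ∧ ∀ x z, z ∈ U' → |x - z| ≤ 1 → |F z| ≤ C * V x ^ m := by
  obtain ⟨hc, C, m, hC, hb⟩ := hF
  obtain ⟨K, hK, hKt⟩ := hV.exists_transfer m
  refine ⟨C * K, m, by positivity, fun x z hz hxz => (hb z hz).trans ?_⟩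
  rw [mul_assoc]
  exact mul_le_mul_of_nonneg_left (hKt x z hxz) hC

lemma IsInset.mem' (h : IsInset ε U U') (hx : x ∈ U) {r : ℝ} (hr : |r| ≤ ε) : x - r ∈ U' :=
  h.sub_mem x hx r (by linarith [h.pos])

lemma IsKernel.mono {ε' : ℝ} (hK : IsKernel ε K) (h : ε ≤ ε') : IsKernel ε' K :=
  ⟨hK.integrable, fun r hr => hK.supp r (lt_of_le_of_lt h hr)⟩

lemma IsKernel.integrable_mul (hK : IsKernel ε K)
    (hF : ContinuousOn F U') (hx : ∀ r, |r| ≤ ε → x - r ∈ U') :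
    Integrable (fun r => K r * F (x - r)) volume := by
  have h1 : IntegrableOn (fun r => K r * F (x - r)) (Icc (-ε) ε) := by
    apply IntegrableOn.mul_continuousOn hK.integrable.integrableOn _ isCompact_Icc
    exact hF.comp (by fun_prop) fun r hr => hx r (abs_le.2 hr)
  rwa [integrableOn_iff_integrable_of_support_subset] at h1
  intro r hr
  by_contra hcon
  apply hr
  have : K r = 0 := hK.supp r (by rw [mem_Icc, ← abs_le] at hcon; exact not_le.1 hcon)
  simp [this]

lemma IsKernel.abs_mul_le (hK : IsKernel ε K) {M : ℝ} (hx : ∀ r, |r| ≤ ε → |F (x - r)| ≤ M)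
    (r : ℝ) : |K r * F (x - r)| ≤ M * |K r| := by
  by_cases hr : |r| ≤ ε
  · rw [abs_mul, mul_comm]
    exact mul_le_mul_of_nonneg_right (hx r hr) (abs_nonneg _)
  · simp [hK.supp r (not_le.1 hr)]

lemma IsKernel.abs_conv_le (hK : IsKernel ε K) {M : ℝ}
    (hx : ∀ r, |r| ≤ ε → |F (x - r)| ≤ M) : |conv K F x| ≤ M * ∫ r, |K r| := by
  rw [conv, ← integral_const_mul]
  exact norm_integral_le_of_norm_le (f := fun r => K r * F (x - r))
    (hK.integrable.abs.const_mul M) (ae_of_all _ fun r => hK.abs_mul_le hx r)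

/-- For tame `F` the values `F (y - r)` are bounded uniformly for `y` near `x`. -/
lemma Tame.exists_near_bound (hV : IsWeight V) (hi : IsInset ε U U') (hF : Tame U' V F)
    (hx : x ∈ U) : ∃ M, ∃ s ∈ 𝓝 x, s ⊆ U ∧ IsOpen s ∧
      ∀ y ∈ s, ∀ r, |r| ≤ 2 * ε → |F (y - r)| ≤ M := by
  obtain ⟨C, m, hC, hb⟩ := hF.local_bound hV
  refine ⟨C * V x ^ m, U ∩ Metric.ball x (1 / 2),
    inter_mem (hi.isOpen.mem_nhds hx) (Metric.ball_mem_nhds _ (by norm_num)),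
    inter_subset_left, hi.isOpen.inter Metric.isOpen_ball, ?_⟩
  rintro y ⟨hyU, hyb⟩ r hr
  apply hb x _ (hi.sub_mem y hyU r hr)
  rw [Metric.mem_ball, Real.dist_eq] at hyb
  have := hi.le
  calc |x - (y - r)| = |(x - y) + r| := by ring_nf
    _ ≤ |x - y| + |r| := abs_add_le _ _
    _ ≤ 1 := by rw [abs_sub_comm]; linarith

lemma continuousOn_conv (hV : IsWeight V) (hi : IsInset ε U U') (hK : IsKernel ε K)
    (hF : Tame U' V F) : ContinuousOn (conv K F) U := by
  intro x hx
  apply ContinuousAt.continuousWithinAt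
  obtain ⟨M, s, hs, hsU, -, hM⟩ := hF.exists_near_bound hV hi hx
  have hε := hi.pos
  apply continuousAt_of_dominated (bound := fun r => M * |K r|)
  · filter_upwards [hs] with y hy
    exact (hK.integrable_mul hF.1 fun r hr => hi.mem' (hsU hy) hr).aestronglyMeasurable
  · filter_upwards [hs] with y hy
    exact ae_of_all _ (hK.abs_mul_le fun r hr => hM y hy r (by linarith))
  · exact hK.integrable.abs.const_mul M
  · refine ae_of_all _ fun r => ?_
    by_cases hr : |r| ≤ ε
    · apply continuousAt_const.mul
      have : ContinuousAt F (x - r) := hF.1.continuousAt (hi.isOpen'.mem_nhds (hi.mem' hx hr))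
      exact ContinuousAt.comp (f := fun y => y - r) this (by fun_prop)
    · simp only [hK.supp r (not_le.1 hr), zero_mul]
      exact continuousAt_const

lemma Tame.conv (hV : IsWeight V) (hi : IsInset ε U U') (hK : IsKernel ε K)
    (hF : Tame U' V F) : Tame U V (conv K F) := by
  refine ⟨continuousOn_conv hV hi hK hF, ?_⟩
  obtain ⟨C, m, hC, hb⟩ := hF.local_bound hV
  refine ⟨C * ∫ r, |K r|, m, mul_nonneg hC (integral_nonneg fun _ => abs_nonneg _), ?_⟩
  intro x hx
  have := hK.abs_conv_le (F := F) (x := x) (M := C * V x ^ m) (fun r hr => by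
    apply hb x _ (hi.mem' hx hr)
    have := hi.le
    simp only [sub_sub_cancel]
    linarith)
  calc _ ≤ _ := this
    _ = _ := by ring

lemma hasDerivAt_conv (hV : IsWeight V) (hi : IsInset ε U U') (hK : IsKernel ε K)
    (hF : ContinuousOn F U') (hd : ∀ z ∈ U', HasDerivAt F (F' z) z) (hF' : Tame U' V F')
    (hx : x ∈ U) : HasDerivAt (GCLM.conv K F) (GCLM.conv K F' x) x := by
  obtain ⟨M, s, hs, hsU, -, hM⟩ := hF'.exists_near_bound hV hi hx
  have hε := hi.pos
  refine (hasDerivAt_integral_of_dominated_loc_of_deriv_le (F := fun y r => K r * F (y - r))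
    (F' := fun y r => K r * F' (y - r)) (bound := fun r => M * |K r|) hs ?_ ?_ ?_ ?_ ?_ ?_).2
  · filter_upwards [hs] with y hy
    exact (hK.integrable_mul hF fun r hr => hi.mem' (hsU hy) hr).aestronglyMeasurable
  · exact hK.integrable_mul hF fun r hr => hi.mem' hx hr
  · exact (hK.integrable_mul hF'.1 fun r hr => hi.mem' hx hr).aestronglyMeasurable
  · exact ae_of_all _ fun r y hy => hK.abs_mul_le (fun r hr => hM y hy r (by linarith)) r
  · exact hK.integrable.abs.const_mul M
  · refine ae_of_all _ fun r y hy => ?_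
    by_cases hr : |r| ≤ ε
    · have h1 := hd _ (hi.mem' (hsU hy) hr)
      have h2 : HasDerivAt (fun z => z - r) 1 y := (hasDerivAt_id y).sub_const r
      exact (h1.comp y h2).const_mul (K r) |>.congr_deriv (by ring)
    · simp only [hK.supp r (not_le.1 hr), zero_mul]
      exact hasDerivAt_const _ _

lemma conv_eq_integral_sub (K F : ℝ → ℝ) (x : ℝ) :
    conv K F x = ∫ z, K (x - z) * F z := by
  rw [conv, ← integral_sub_left_eq_self (fun z => K (x - z) * F z) volume x]
  simp

/-- Differentiating a convolution through a smooth kernel. -/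
lemma hasDerivAt_conv_kernel (hi : IsInset ε U U')
    (hd : ∀ r, HasDerivAt K (K' r) r) (hK' : Continuous K')
    (hs : ∀ r, ε ≤ |r| → K r = 0) (hs' : ∀ r, ε ≤ |r| → K' r = 0)
    (hF : Tame U' V F) (hx : x ∈ U) :
    HasDerivAt (conv K F) (conv K' F x) x := by
  have hε := hi.pos
  have hKc : Continuous K := continuous_iff_continuousAt.2 fun r => (hd r).continuousAt
  have hFc : ContinuousOn F (Icc (x - 2 * ε) (x + 2 * ε)) := by
    apply hF.1.mono
    intro z hz
    have := hi.sub_mem x hx (x - z) (by rw [abs_le]; constructor <;> linarith [hz.1, hz.2])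
    simpa using this
  -- For `y` near `x` the integrand vanishes off a fixed compact interval on which `F` is
  -- continuous; nothing is known of `F` farther away.
  have hloc : ∀ (k : ℝ → ℝ), (∀ r, ε ≤ |r| → k r = 0) → ∀ y ∈ Metric.ball x ε,
      conv k F y = ∫ z in Icc (x - 2 * ε) (x + 2 * ε), k (y - z) * F z := by
    intro k hk y hy
    rw [conv_eq_integral_sub, setIntegral_eq_integral_of_forall_compl_eq_zero]
    intro z hz
    rw [hk, zero_mul]
    rw [Metric.mem_ball, Real.dist_eq, abs_lt] at hy
    by_contra hcon
    rw [not_le, abs_lt] at hcon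
    exact hz ⟨by linarith, by linarith⟩
  obtain ⟨M, hM⟩ := (isCompact_Icc (a := x - 2 * ε) (b := x + 2 * ε)).exists_bound_of_continuousOn hFc
  obtain ⟨M', hM'⟩ := (isCompact_Icc (a := -ε) (b := ε)).exists_bound_of_continuousOn
    hK'.continuousOn
  have hM'0 : 0 ≤ M' := (norm_nonneg _).trans (hM' 0 ⟨by linarith, by linarith⟩)
  have hM'all : ∀ r, ‖K' r‖ ≤ M' := by
    intro r
    by_cases hr : ε ≤ |r|
    · rw [hs' r hr]; simpa using hM'0
    · exact hM' r (abs_le.1 (not_le.1 hr).le)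
  rw [hloc K' hs' x (Metric.mem_ball_self hε)]
  have main := (hasDerivAt_integral_of_dominated_loc_of_deriv_le
    (μ := volume.restrict (Icc (x - 2 * ε) (x + 2 * ε)))
    (F := fun y z => K (y - z) * F z) (F' := fun y z => K' (y - z) * F z)
    (bound := fun _ => M' * M) (x₀ := x) (Metric.ball_mem_nhds x hε) ?_ ?_ ?_ ?_ ?_ ?_).2
  · exact main.congr_of_eventuallyEq
      (Filter.eventuallyEq_of_mem (Metric.ball_mem_nhds x hε) (hloc K hs))
  · refine Eventually.of_forall fun y => ?_
    exact ((by fun_prop : Continuous fun z => K (y - z)).continuousOn.mul hFc).aestronglyMeasurable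
      measurableSet_Icc
  · exact ((by fun_prop : Continuous fun z => K (x - z)).continuousOn.mul hFc).integrableOn_compact
      isCompact_Icc
  · exact ((by fun_prop : Continuous fun z => K' (x - z)).continuousOn.mul hFc).aestronglyMeasurable
      measurableSet_Icc
  · filter_upwards [ae_restrict_mem measurableSet_Icc] with z hz y hy
    rw [norm_mul]
    exact mul_le_mul (hM'all _) (hM z hz) (norm_nonneg _) hM'0
  · exact integrable_const _
  · refine ae_of_all _ fun z y hy => ?_
    have h2 : HasDerivAt (fun w => w - z) 1 y := (hasDerivAt_id y).sub_const z
    exact (((hd (y - z)).comp y h2).mul_const (F z)).congr_deriv (by ring)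

end Conv

/-! ### Cutoff functions and square-root estimates for the logarithm. -/

/-- Even smooth cutoff functions supported in `(-ε, ε)` and equal to `1` on `[-ε/2, ε/2]`. -/
structure IsCutoff (ε : ℝ) (φ : ℝ → ℝ) : Prop where
  smooth : ContDiff ℝ ∞ φ
  even : ∀ r, φ (-r) = φ r
  zero : ∀ r, 3 / 4 * ε ≤ |r| → φ r = 0
  one : ∀ r, |r| ≤ ε / 2 → φ r = 1
  bdd : ∀ r, |φ r| ≤ 1

lemma exists_isCutoff {ε : ℝ} (hε : 0 < ε) : ∃ φ, IsCutoff ε φ := by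
  -- The outer radius is below `ε`, so that the derivative also vanishes at `|r| = ε`.
  let b : ContDiffBump (0 : ℝ) := ⟨ε / 2, 3 / 4 * ε, by linarith, by linarith⟩
  refine ⟨b, b.contDiff, fun r => b.neg r, fun r hr => b.zero_of_le_dist (by simpa using hr),
    fun r hr => b.one_of_mem_closedBall (by simpa using hr), fun r => ?_⟩
  rw [abs_of_nonneg b.nonneg]
  exact b.le_one

section Log

variable {ε : ℝ} {φ : ℝ → ℝ}

lemma IsCutoff.hasDerivAt (hφ : IsCutoff ε φ) (r : ℝ) : HasDerivAt φ (deriv φ r) r :=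
  (hφ.smooth.differentiable (by simp) r).hasDerivAt

lemma IsCutoff.continuous_deriv (hφ : IsCutoff ε φ) : Continuous (deriv φ) :=
  hφ.smooth.continuous_deriv (by simp)

lemma IsCutoff.deriv_zero (hφ : IsCutoff ε φ) (hε : 0 < ε) {r : ℝ} (hr : ε ≤ |r|) :
    deriv φ r = 0 := by
  have : φ =ᶠ[𝓝 r] fun _ => 0 := by
    filter_upwards [continuous_abs.continuousAt.eventually (lt_mem_nhds
      (show 3 / 4 * ε < |r| by linarith))] with s hs
    exact hφ.zero s hs.le
  rw [this.deriv_eq, deriv_const]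

lemma IsCutoff.deriv_neg (hφ : IsCutoff ε φ) (r : ℝ) : deriv φ (-r) = -deriv φ r := by
  have h : (fun s => φ (-s)) = φ := funext hφ.even
  have h1 := deriv_comp_neg φ r
  rw [h] at h1
  linarith

lemma IsCutoff.exists_deriv_bound (hφ : IsCutoff ε φ) (hε : 0 < ε) :
    ∃ L, 0 ≤ L ∧ ∀ r, |deriv φ r| ≤ L := by
  obtain ⟨L, hL⟩ := (isCompact_Icc (a := -ε) (b := ε)).exists_bound_of_continuousOn
    hφ.continuous_deriv.continuousOn
  have h0 : 0 ≤ L := (norm_nonneg _).trans (hL 0 ⟨by linarith, by linarith⟩)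
  refine ⟨L, h0, fun r => ?_⟩
  by_cases hr : ε ≤ |r|
  · rw [hφ.deriv_zero hε hr]; simpa using h0
  · exact hL r (abs_le.1 (not_le.1 hr).le)

/-- The localised logarithmic kernel. -/
noncomputable def logKer (φ : ℝ → ℝ) (r : ℝ) : ℝ := φ r * Real.log r

lemma integrable_of_abs_le_one_of_zero {g : ℝ → ℝ} (hg : IntervalIntegrable g volume (-1) 1)
    (h0 : ∀ r, 1 < |r| → g r = 0) : Integrable g := by
  rw [intervalIntegrable_iff_integrableOn_Icc_of_le (by norm_num)] at hg
  rwa [integrableOn_iff_integrable_of_support_subset] at hg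
  intro r hr
  by_contra hcon
  rw [mem_Icc, ← abs_le] at hcon
  exact hr (h0 r (not_le.1 hcon))

lemma isKernel_logKer (hφ : IsCutoff ε φ) (hε : 0 < ε) (hε' : ε ≤ 1) :
    IsKernel ε (logKer φ) := by
  have h0 : ∀ r, ε < |r| → logKer φ r = 0 := fun r hr => by
    rw [logKer, hφ.zero r (by linarith), zero_mul]
  refine ⟨integrable_of_abs_le_one_of_zero ?_ fun r hr => h0 r (by linarith), h0⟩
  exact intervalIntegral.intervalIntegrable_log'.continuousOn_mul
    hφ.smooth.continuous.continuousOn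

/-- Combine `1 + t ≤ (1 + √t)²` with `log (1 + u) ≤ u`. This is the origin of the Hölder exponent
`1/2`. -/
lemma log_add_le (t : ℝ) (ht : 0 ≤ t) : Real.log (1 + t) ≤ 2 * √t := by
  have h1 : (1 + t) ≤ (1 + √t) ^ 2 := by
    nlinarith [Real.sq_sqrt ht, Real.sqrt_nonneg t]
  calc Real.log (1 + t) ≤ Real.log ((1 + √t) ^ 2) := Real.log_le_log (by linarith) h1
    _ = 2 * Real.log (1 + √t) := by rw [Real.log_pow]; norm_num
    _ ≤ 2 * √t := by
      have := Real.log_le_sub_one_of_pos (show 0 < 1 + √t by positivity)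
      linarith

lemma log_sub_log_le {s t : ℝ} (hs : 0 < s) (hst : s ≤ t) :
    Real.log t - Real.log s ≤ 2 * √(t - s) * (√s)⁻¹ := by
  rw [← Real.log_div (by linarith) hs.ne']
  have : t / s = 1 + (t - s) / s := by field_simp; ring
  rw [this]
  refine (log_add_le _ (div_nonneg (by linarith) hs.le)).trans (le_of_eq ?_)
  rw [Real.sqrt_div (by linarith)]
  ring

/-- The increment `√|s - t|` is paid for by inverse square roots, which are locally integrable;
integrating in `s` thus yields an `L¹` modulus of continuity. -/
lemma abs_log_sub_log_le {s t : ℝ} (hs : s ≠ 0) (ht : t ≠ 0) :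
    |Real.log s - Real.log t| ≤ 2 * √|s - t| * ((√|s|)⁻¹ + (√|t|)⁻¹) := by
  rw [← Real.log_abs s, ← Real.log_abs t]
  have h1 : ∀ {a b : ℝ}, a ≠ 0 → b ≠ 0 → |a| ≤ |b| →
      abs (Real.log |a| - Real.log |b|) ≤ 2 * √|a - b| * ((√|a|)⁻¹ + (√|b|)⁻¹) := by
    intro a b ha hb hab
    rw [abs_sub_comm, abs_of_nonneg (sub_nonneg.2 (Real.log_le_log (abs_pos.2 ha) hab))]
    refine (log_sub_log_le (abs_pos.2 ha) hab).trans ?_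
    have h2 : √(|b| - |a|) ≤ √|a - b| := by
      apply Real.sqrt_le_sqrt
      rw [abs_sub_comm]
      exact abs_sub_abs_le_abs_sub b a
    have h3 : (√|a|)⁻¹ ≤ (√|a|)⁻¹ + (√|b|)⁻¹ := by
      have : 0 ≤ (√|b|)⁻¹ := by positivity
      linarith
    gcongr
  rcases le_total |s| |t| with h | h
  · exact h1 hs ht h
  · rw [abs_sub_comm, abs_sub_comm s t, add_comm]
    exact h1 ht hs h

lemma abs_log_le_inv_sqrt {s : ℝ} (hs : s ≠ 0) (hs1 : |s| ≤ 1) :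
    |Real.log s| ≤ 2 * (√|s|)⁻¹ := by
  rw [← Real.log_abs s]
  have h := log_sub_log_le (abs_pos.2 hs) hs1
  rw [Real.log_one, zero_sub] at h
  rw [abs_of_nonpos (Real.log_nonpos (abs_nonneg _) hs1)]
  refine h.trans ?_
  have : √(1 - |s|) ≤ 1 := by
    rw [Real.sqrt_le_one]
    linarith [abs_nonneg s]
  have h0 : 0 ≤ (√|s|)⁻¹ := by positivity
  nlinarith

lemma intervalIntegrable_inv_sqrt_abs :
    IntervalIntegrable (fun s : ℝ => (√|s|)⁻¹) volume (-1) 1 := by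
  have h1 : IntervalIntegrable (fun s : ℝ => (√|s|)⁻¹) volume 0 1 := by
    have := intervalIntegral.intervalIntegrable_rpow' (a := 0) (b := 1)
      (show (-1 : ℝ) < -(1 / 2) by norm_num)
    refine this.congr ?_
    intro s hs
    rw [uIoc_of_le zero_le_one] at hs
    simp only
    rw [Real.rpow_neg hs.1.le, abs_of_pos hs.1, Real.sqrt_eq_rpow]
  have h2 : IntervalIntegrable (fun s : ℝ => (√|s|)⁻¹) volume (-1) 0 := by
    have := (IntervalIntegrable.iff_comp_neg (f := fun s : ℝ => (√|s|)⁻¹)).1 h1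
    simpa using this.symm
  exact h2.trans h1

end Log

/-! ### The two smoothing effects of the localised logarithmic kernel. -/

section Holder

variable {U U' : Set ℝ} {V F F' φ : ℝ → ℝ} {ε x : ℝ}

lemma conv_sub_kernel (K F : ℝ → ℝ) (x y : ℝ) :
    conv K F y = conv (fun r => K (r - (x - y))) F x := by
  rw [conv, conv, ← integral_sub_right_eq_self _ (x - y)]
  congr 1
  ext r
  congr 2
  ring

lemma isKernel_shift_sub {K : ℝ → ℝ} (hK : IsKernel ε K) {h : ℝ} (hh : |h| ≤ ε) :
    IsKernel (2 * ε) (fun r => K r - K (r - h)) := by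
  refine ⟨hK.integrable.sub (hK.integrable.comp_sub_right h), fun r hr => ?_⟩
  have h0 : 0 ≤ ε := (abs_nonneg h).trans hh
  have h1 : |r| ≤ |r - h| + |h| := by
    calc |r| = |(r - h) + h| := by ring_nf
      _ ≤ _ := abs_add_le _ _
  rw [hK.supp r (by linarith), hK.supp (r - h) (by linarith), sub_zero]

/-- The `L¹` modulus of continuity of the localised logarithm is of order `√h`. -/
lemma exists_logKer_shift_bound (hφ : IsCutoff ε φ) (hε : 0 < ε) (hε' : ε ≤ 1 / 4) :
    ∃ D, 0 ≤ D ∧ ∀ h, |h| ≤ ε →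
      ∫ r, |logKer φ r - logKer φ (r - h)| ≤ D * √|h| := by
  obtain ⟨L, hL0, hL⟩ := hφ.exists_deriv_bound hε
  -- An integrable majorant. As `|h| ≤ ε ≤ 1/4`, both `r` and `r - h` lie in `[-1, 1]` when `|r| ≤ 2
  -- ε`.
  set σ : ℝ → ℝ := indicator (Icc (-1) 1) (fun s => (√|s|)⁻¹) with hσ
  have hσi : Integrable σ := by
    rw [hσ, integrable_indicator_iff measurableSet_Icc,
      ← intervalIntegrable_iff_integrableOn_Icc_of_le (by norm_num)]
    exact intervalIntegrable_inv_sqrt_abs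
  have hσ0 : ∀ s, 0 ≤ σ s := fun s => indicator_nonneg (fun _ _ => by positivity) s
  have hσe : ∀ s, |s| ≤ 1 → σ s = (√|s|)⁻¹ := fun s hs => indicator_of_mem (mem_Icc.2 (abs_le.1 hs)) _
  refine ⟨(2 + 2 * L) * (2 * ∫ s, σ s),
    mul_nonneg (by positivity) (mul_nonneg two_pos.le (integral_nonneg hσ0)), fun h hh => ?_⟩
  have hK := isKernel_logKer hφ hε (by linarith)
  have hKh := isKernel_shift_sub hK hh
  have hb : ∀ᵐ r, |logKer φ r - logKer φ (r - h)| ≤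
      (2 + 2 * L) * √|h| * (σ r + σ (r - h)) := by
    have n0 : ∀ᵐ r : ℝ, r ≠ 0 := by simp [ae_iff, measure_singleton]
    have nh : ∀ᵐ r : ℝ, r ≠ h := by simp [ae_iff, measure_singleton]
    filter_upwards [n0, nh] with r hr0 hrh
    by_cases hr : |r| ≤ 2 * ε
    · have hr1 : |r| ≤ 1 := by linarith
      have hrh1 : |r - h| ≤ 1 := (abs_sub r h).trans (by linarith)
      rw [hσe r hr1, hσe _ hrh1]
      have hsub : r - h ≠ 0 := sub_ne_zero.2 hrh
      -- The increment of the logarithm uses its square-root modulus; the increment of the cutoff is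
      -- Lipschitz, and `|h| ≤ √|h|`.
      have e : logKer φ r - logKer φ (r - h) =
          φ r * (Real.log r - Real.log (r - h)) + (φ r - φ (r - h)) * Real.log (r - h) := by
        rw [logKer, logKer]; ring
      have b1 := abs_log_sub_log_le hr0 hsub
      rw [sub_sub_cancel] at b1
      have b2 := abs_log_le_inv_sqrt hsub hrh1
      have b3 : |φ r - φ (r - h)| ≤ L * |h| := by
        have := convex_univ.norm_image_sub_le_of_norm_hasDerivWithin_le (f := φ) (C := L)
          (fun z _ => (hφ.hasDerivAt z).hasDerivWithinAt) (fun z _ => hL z) (mem_univ (r - h))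
          (mem_univ r)
        simpa using this
      have b4 : |h| ≤ √|h| := by
        apply Real.le_sqrt_of_sq_le
        have := abs_nonneg h
        nlinarith
      have p1 : 0 ≤ (√|r|)⁻¹ := by positivity
      have p2 : 0 ≤ (√|r - h|)⁻¹ := by positivity
      calc |logKer φ r - logKer φ (r - h)|
          ≤ |φ r| * |Real.log r - Real.log (r - h)| +
              |φ r - φ (r - h)| * |Real.log (r - h)| := by
            rw [e, ← abs_mul, ← abs_mul]; exact abs_add_le _ _
        _ ≤ 1 * (2 * √|h| * ((√|r|)⁻¹ + (√|r - h|)⁻¹)) +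
              (L * √|h|) * (2 * ((√|r|)⁻¹ + (√|r - h|)⁻¹)) := by
            gcongr
            · exact hφ.bdd r
            · exact b3.trans (mul_le_mul_of_nonneg_left b4 hL0)
            · linarith
        _ = _ := by ring
    · rw [hKh.supp r (not_le.1 hr), abs_zero]
      have := hσ0 r
      have := hσ0 (r - h)
      positivity
  calc ∫ r, |logKer φ r - logKer φ (r - h)|
      ≤ ∫ r, (2 + 2 * L) * √|h| * (σ r + σ (r - h)) :=
        integral_mono_ae hKh.integrable.abs
          ((hσi.add (hσi.comp_sub_right h)).const_mul _) hb
    _ = (2 + 2 * L) * √|h| * ((∫ s, σ s) + ∫ s, σ s) := by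
        rw [integral_const_mul, integral_add hσi (hσi.comp_sub_right h),
          integral_sub_right_eq_self σ h]
    _ = _ := by ring

/-- The shift is moved from `F` to the kernel, so a bound on `F` is enough. For `|x - y| > ε` the
two values are estimated separately, using `1 ≤ √|x - y| / √ε`. -/
lemma Tame.conv_logKer (hV : IsWeight V) (hi : IsInset ε U U') (hφ : IsCutoff ε φ)
    (hF : Tame U' V F) : TameHolder U V (GCLM.conv (logKer φ) F) := by
  have hε := hi.pos
  have hε' := hi.le
  have hK := isKernel_logKer hφ hε (by linarith)
  refine ⟨hF.conv hV hi hK, ?_⟩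
  obtain ⟨D, hD, hDb⟩ := exists_logKer_shift_bound hφ hε hε'
  obtain ⟨C, m, hC, hb⟩ := hF.local_bound hV
  obtain ⟨C', m', hC', hb'⟩ := (hF.conv hV hi hK).local_bound hV
  refine ⟨C * D + 2 * C' / √ε, m + m', by positivity, fun x hx y hy hxy => ?_⟩
  have hV1 := hV.one_le x
  have hVp := (hV.pos x).le
  have e1 := pow_le_pow_right₀ hV1 (show m ≤ m + m' by omega)
  have e2 := pow_le_pow_right₀ hV1 (show m' ≤ m + m' by omega)
  by_cases hh : |x - y| ≤ ε
  · have hKh := isKernel_shift_sub hK hh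
    have hxr : ∀ r, |r| ≤ 2 * ε → x - r ∈ U' := hi.sub_mem x hx
    have hsh : IsKernel (2 * ε) (fun r => logKer φ (r - (x - y))) := by
      refine ⟨hK.integrable.comp_sub_right _, fun r hr => ?_⟩
      have := hKh.supp r hr
      rw [hK.supp r (by linarith), zero_sub, neg_eq_zero] at this
      exact this
    have e : GCLM.conv (logKer φ) F x - GCLM.conv (logKer φ) F y =
        GCLM.conv (fun r => logKer φ r - logKer φ (r - (x - y))) F x := by
      rw [conv_sub_kernel (logKer φ) F x y, GCLM.conv, GCLM.conv, GCLM.conv,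
        ← integral_sub ((hK.mono (by linarith)).integrable_mul hF.1 hxr)
          (hsh.integrable_mul hF.1 hxr)]
      simp only [sub_mul]
    rw [e]
    calc _ ≤ (C * V x ^ m) * ∫ r, |logKer φ r - logKer φ (r - (x - y))| := by
          apply hKh.abs_conv_le
          intro r hr
          apply hb x _ (hxr r hr)
          rw [sub_sub_cancel]
          linarith
      _ ≤ (C * V x ^ (m + m')) * (D * √|x - y|) := by
          apply mul_le_mul (mul_le_mul_of_nonneg_left e1 hC) (hDb _ hh)
            (integral_nonneg fun _ => abs_nonneg _) (by positivity)
      _ ≤ (C * D + 2 * C' / √ε) * V x ^ (m + m') * √|x - y| := by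
          have : 0 ≤ 2 * C' / √ε * V x ^ (m + m') * √|x - y| := by positivity
          nlinarith
  · have h1 := hb' x x hx (by simp)
    have h2 := hb' x y hy hxy
    have hs : 1 ≤ √|x - y| / √ε := by
      rw [one_le_div (Real.sqrt_pos.2 hε)]
      exact Real.sqrt_le_sqrt (not_le.1 hh).le
    calc _ ≤ |GCLM.conv (logKer φ) F x| + |GCLM.conv (logKer φ) F y| := abs_sub _ _
      _ ≤ 2 * C' * V x ^ (m + m') * 1 := by
          have := mul_le_mul_of_nonneg_left e2 hC'
          linarith
      _ ≤ 2 * C' * V x ^ (m + m') * (√|x - y| / √ε) := by gcongr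
      _ = (2 * C' / √ε) * V x ^ (m + m') * √|x - y| := by ring
      _ ≤ _ := by
          have : 0 ≤ C * D * (V x ^ (m + m') * √|x - y|) := by positivity
          nlinarith

theorem Reg.conv_logKer (hV : IsWeight V) (hi : IsInset ε U U') (hφ : IsCutoff ε φ) {n : ℕ}
    (hF : Reg U' (Tame U' V) n F) : Reg U (TameHolder U V) n (GCLM.conv (logKer φ) F) := by
  have hε := hi.pos
  have hε' := hi.le
  have hK := isKernel_logKer hφ hε (by linarith)
  induction n generalizing F with
  | zero => exact Tame.conv_logKer hV hi hφ hF
  | succ n ih =>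
    obtain ⟨h1, F', hd, h2⟩ := hF
    exact ⟨Tame.conv_logKer hV hi hφ h1, GCLM.conv (logKer φ) F',
      fun x hx => hasDerivAt_conv hV hi hK h1.1 hd h2.base hx, ih h2⟩

/-- Regularisation of the localised logarithm. -/
noncomputable def regKer (φ : ℝ → ℝ) (δ r : ℝ) : ℝ := φ r * (1 / 2 * Real.log (r ^ 2 + δ ^ 2))

/-- The derivative of the regularised kernel; at `δ = 0` this is the singular kernel. -/
noncomputable def regKer' (φ : ℝ → ℝ) (δ r : ℝ) : ℝ :=
  deriv φ r * (1 / 2 * Real.log (r ^ 2 + δ ^ 2)) + φ r * (r / (r ^ 2 + δ ^ 2))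

lemma regKer_zero (φ : ℝ → ℝ) : regKer φ 0 = logKer φ := by
  ext r
  rw [regKer, logKer, zero_pow two_ne_zero, add_zero, Real.log_pow]
  push_cast
  ring

lemma hasDerivAt_regKer (hφ : IsCutoff ε φ) {δ : ℝ} (hδ : 0 < δ) (r : ℝ) :
    HasDerivAt (regKer φ δ) (regKer' φ δ r) r := by
  have hp : r ^ 2 + δ ^ 2 ≠ 0 := by positivity
  have h1 : HasDerivAt (fun r : ℝ => r ^ 2 + δ ^ 2) (2 * r) r := by
    simpa using (hasDerivAt_pow 2 r).add_const (δ ^ 2)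
  have h2 := (h1.log hp).const_mul (1 / 2)
  refine ((hφ.hasDerivAt r).mul h2).congr_deriv ?_
  rw [regKer']
  ring

lemma continuous_regKer' (hφ : IsCutoff ε φ) {δ : ℝ} (hδ : 0 < δ) : Continuous (regKer' φ δ) := by
  have hp : ∀ r : ℝ, r ^ 2 + δ ^ 2 ≠ 0 := fun r => by positivity
  have h1 := hφ.continuous_deriv
  have h2 := hφ.smooth.continuous
  unfold regKer'
  exact (h1.mul (continuous_const.mul ((by fun_prop : Continuous fun r : ℝ => r ^ 2 + δ ^ 2).log hp))).add
    (h2.mul (continuous_id.div (by fun_prop) hp))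

lemma regKer'_zero_of_le (hφ : IsCutoff ε φ) (hε : 0 < ε) (δ : ℝ) {r : ℝ} (hr : ε ≤ |r|) :
    regKer' φ δ r = 0 := by
  rw [regKer', hφ.deriv_zero hε hr, hφ.zero r (by linarith)]
  ring

lemma regKer'_neg (hφ : IsCutoff ε φ) (δ r : ℝ) : regKer' φ δ (-r) = -regKer' φ δ r := by
  rw [regKer', regKer', hφ.deriv_neg, hφ.even]
  simp only [neg_sq]
  ring

/-- As `r² ≤ r² + δ² ≤ 1`, regularisation moves the logarithm towards zero. This dominates the
regularised kernels uniformly in `δ`. -/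
lemma abs_half_log_le {δ r : ℝ} (hδ0 : 0 ≤ δ) (hδ : δ ≤ 1 / 2) (hr0 : r ≠ 0) (hr : |r| ≤ 1 / 2) :
    |1 / 2 * Real.log (r ^ 2 + δ ^ 2)| ≤ |Real.log r| := by
  have h1 : r ^ 2 = |r| ^ 2 := (sq_abs r).symm
  have hp : 0 < r ^ 2 := by positivity
  have hle : r ^ 2 + δ ^ 2 ≤ 1 := by rw [h1]; nlinarith [abs_nonneg r]
  have h2 : Real.log (r ^ 2 + δ ^ 2) ≤ 0 := Real.log_nonpos (by positivity) hle
  have h3 : Real.log r ≤ 0 := by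
    rw [← Real.log_abs]; exact Real.log_nonpos (abs_nonneg _) (by linarith)
  have h4 : Real.log (r ^ 2) ≤ Real.log (r ^ 2 + δ ^ 2) :=
    Real.log_le_log hp (by nlinarith [sq_nonneg δ])
  rw [Real.log_pow] at h4
  push_cast at h4
  rw [abs_of_nonpos (by linarith), abs_of_nonpos h3]
  linarith

/-- The factor `√|r|` will come from a Hölder increment. It reduces the singularity `1 / r` to
`|r|^(-1/2)`, with a constant independent of `δ`, including `δ = 0`. -/
lemma exists_regKer'_bound (hφ : IsCutoff ε φ) (hε : 0 < ε) (hε' : ε ≤ 1 / 4) :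
    ∃ L, 0 ≤ L ∧ ∀ δ, 0 ≤ δ → δ ≤ 1 / 2 → ∀ r, |regKer' φ δ r| * √|r| ≤
      L * indicator (Icc (-1) 1) (fun s => (√|s|)⁻¹) r := by
  obtain ⟨L, hL0, hL⟩ := hφ.exists_deriv_bound hε
  refine ⟨2 * L + 1, by positivity, fun δ hδ0 hδ r => ?_⟩
  have hi0 : 0 ≤ indicator (Icc (-1) 1) (fun s : ℝ => (√|s|)⁻¹) r :=
    indicator_nonneg (fun _ _ => by positivity) r
  by_cases hr : ε ≤ |r|
  · rw [regKer'_zero_of_le hφ hε δ hr, abs_zero, zero_mul]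
    positivity
  rw [not_le] at hr
  by_cases hr0 : r = 0
  · subst hr0
    rw [abs_zero, Real.sqrt_zero, mul_zero]
    positivity
  have hr1 : |r| ≤ 1 := by linarith
  rw [indicator_of_mem (mem_Icc.2 (abs_le.1 hr1))]
  have hsq : 0 < √|r| := Real.sqrt_pos.2 (abs_pos.2 hr0)
  have hsq1 : √|r| ≤ 1 := Real.sqrt_le_one.2 hr1
  have b1 := (abs_half_log_le hδ0 hδ hr0 (by linarith)).trans (abs_log_le_inv_sqrt hr0 hr1)
  have b2 : |r / (r ^ 2 + δ ^ 2)| ≤ (√|r|)⁻¹ * (√|r|)⁻¹ := by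
    have hp : 0 < r ^ 2 + δ ^ 2 := by positivity
    rw [← mul_inv, Real.mul_self_sqrt (abs_nonneg r), abs_div, abs_of_pos hp,
      div_le_iff₀ hp, ← sq_abs r]
    have h1 : 0 < |r| := abs_pos.2 hr0
    have h2 : |r|⁻¹ * (|r| ^ 2 + δ ^ 2) = |r| + |r|⁻¹ * δ ^ 2 := by field_simp
    rw [h2]
    have : 0 ≤ |r|⁻¹ * δ ^ 2 := by positivity
    linarith
  have hi1 : 0 ≤ (√|r|)⁻¹ := by positivity
  calc |regKer' φ δ r| * √|r| ≤ (L * (2 * (√|r|)⁻¹) + 1 * ((√|r|)⁻¹ * (√|r|)⁻¹)) * √|r| := by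
        apply mul_le_mul_of_nonneg_right _ hsq.le
        rw [regKer']
        refine (abs_add_le _ _).trans ?_
        rw [abs_mul, abs_mul (φ r)]
        gcongr
        · exact hL r
        · exact hφ.bdd r
    _ = 2 * L * ((√|r|)⁻¹ * √|r|) + (√|r|)⁻¹ * ((√|r|)⁻¹ * √|r|) := by ring
    _ = 2 * L * 1 + (√|r|)⁻¹ := by rw [inv_mul_cancel₀ hsq.ne', mul_one, mul_one]
    _ ≤ (2 * L + 1) * (√|r|)⁻¹ := by
        have : 1 ≤ (√|r|)⁻¹ := (one_le_inv₀ hsq).2 hsq1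
        nlinarith


lemma tendsto_regKer' (φ : ℝ → ℝ) {r : ℝ} (hr : r ≠ 0) {δ : ℕ → ℝ}
    (hδ : Tendsto δ atTop (𝓝 0)) :
    Tendsto (fun n => regKer' φ (δ n) r) atTop (𝓝 (regKer' φ 0 r)) := by
  have : ContinuousAt (fun d => regKer' φ d r) 0 := by
    have hp : r ^ 2 + (0 : ℝ) ^ 2 ≠ 0 := by positivity
    unfold regKer'
    have h1 : ContinuousAt (fun d : ℝ => r ^ 2 + d ^ 2) 0 := by fun_prop
    exact (continuousAt_const.mul (continuousAt_const.mul (h1.log hp))).add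
      (continuousAt_const.mul (continuousAt_const.div h1 hp))
  exact this.tendsto.comp hδ

lemma tendsto_regKer (φ : ℝ → ℝ) {r : ℝ} (hr : r ≠ 0) {δ : ℕ → ℝ}
    (hδ : Tendsto δ atTop (𝓝 0)) :
    Tendsto (fun n => regKer φ (δ n) r) atTop (𝓝 (logKer φ r)) := by
  rw [← regKer_zero φ]
  have : ContinuousAt (fun d => regKer φ d r) 0 := by
    have hp : r ^ 2 + (0 : ℝ) ^ 2 ≠ 0 := by positivity
    unfold regKer
    have h1 : ContinuousAt (fun d : ℝ => r ^ 2 + d ^ 2) 0 := by fun_prop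
    exact continuousAt_const.mul (continuousAt_const.mul (h1.log hp))
  exact this.tendsto.comp hδ

lemma measurable_regKer' (hφ : IsCutoff ε φ) (δ : ℝ) : Measurable (regKer' φ δ) := by
  have h1 := hφ.continuous_deriv.measurable
  have h2 := hφ.smooth.continuous.measurable
  unfold regKer'
  fun_prop

/-- The differentiated kernel is odd, hence of integral zero, so `F x` can be subtracted for free.
-/
lemma conv_regKer'_eq (hi : IsInset ε U U') (hφ : IsCutoff ε φ) {δ : ℝ}
    (hδ : 0 < δ) (hF : Tame U' V F) (hx : x ∈ U) :
    Integrable (fun r => regKer' φ δ r * (F (x - r) - F x)) ∧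
    conv (regKer' φ δ) F x = ∫ r, regKer' φ δ r * (F (x - r) - F x) := by
  have hε := hi.pos
  have hc := continuous_regKer' hφ hδ
  have hcs : HasCompactSupport (regKer' φ δ) := by
    apply HasCompactSupport.intro (isCompact_Icc (a := -ε) (b := ε))
    intro r hr
    apply regKer'_zero_of_le hφ hε
    rw [mem_Icc, ← abs_le] at hr
    exact (not_le.1 hr).le
  have hint : Integrable (regKer' φ δ) := hc.integrable_of_hasCompactSupport hcs
  have hK : IsKernel ε (regKer' φ δ) := ⟨hint, fun r hr => regKer'_zero_of_le hφ hε δ hr.le⟩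
  have h0 : ∫ r, regKer' φ δ r = 0 := by
    have h1 := integral_neg_eq_self (regKer' φ δ) volume
    simp only [regKer'_neg hφ, integral_neg] at h1
    linarith
  have h1 := hK.integrable_mul hF.1 fun r hr => hi.mem' hx hr
  simp only [mul_sub]
  refine ⟨h1.sub (hint.mul_const _), ?_⟩
  rw [integral_sub h1 (hint.mul_const _), integral_mul_const, h0, zero_mul, sub_zero, conv]

/-- The smooth kernels `regKer φ δ` can be differentiated under the integral. Their derivatives
converge locally uniformly to the principal value integral `Q`, which converges absolutely once `F
x` is subtracted and the Hölder bound is used; the limit theorem for derivatives then applies. -/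
theorem TameHolder.exists_deriv_conv_logKer (hV : IsWeight V) (hi : IsInset ε U U')
    (hφ : IsCutoff ε φ) (hF : TameHolder U' V F) :
    ∃ Q, (∀ x ∈ U, HasDerivAt (GCLM.conv (logKer φ) F) (Q x) x) ∧ Tame U V Q := by
  have hε := hi.pos
  have hε' := hi.le
  obtain ⟨L, hL0, hL⟩ := exists_regKer'_bound hφ hε hε'
  obtain ⟨hFt, C, m, hC, hb⟩ := id hF
  have hxU : ∀ x ∈ U, x ∈ U' := fun x hx => by simpa using hi.mem' hx (r := 0) (by simpa using hε.le)
  set σ : ℝ → ℝ := indicator (Icc (-1) 1) (fun s => (√|s|)⁻¹) with hσ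
  have hσi : Integrable σ := by
    rw [hσ, integrable_indicator_iff measurableSet_Icc,
      ← intervalIntegrable_iff_integrableOn_Icc_of_le (by norm_num)]
    exact intervalIntegrable_inv_sqrt_abs
  set Q : ℝ → ℝ := fun x => ∫ r, regKer' φ 0 r * (F (x - r) - F x) with hQ
  set δ : ℕ → ℝ := fun n => 1 / (n + 2 : ℝ) with hδdef
  have hδ0 : ∀ n, 0 < δ n := fun n => by positivity
  have hδ1 : ∀ n, δ n ≤ 1 / 2 := fun n => by
    rw [hδdef]
    apply one_div_le_one_div_of_le two_pos
    have : (0 : ℝ) ≤ n := Nat.cast_nonneg n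
    linarith
  have hδt : Tendsto δ atTop (𝓝 0) := by
    have := (tendsto_one_div_add_atTop_nhds_zero_nat (𝕜 := ℝ)).comp (tendsto_add_atTop_nat 1)
    refine this.congr fun n => ?_
    simp only [Function.comp, hδdef]
    push_cast
    ring
  have hmk : ∀ d, Measurable fun r => |regKer' φ d r| * √|r| := fun d =>
    ((measurable_regKer' hφ d).abs).mul (by fun_prop)
  have hki : ∀ d, 0 ≤ d → d ≤ 1 / 2 → Integrable fun r => |regKer' φ d r| * √|r| := by
    intro d hd0 hd
    refine (hσi.const_mul L).mono' (hmk d).aestronglyMeasurable (ae_of_all _ fun r => ?_)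
    rw [Real.norm_eq_abs, abs_of_nonneg (by positivity)]
    exact hL d hd0 hd r
  have hdiff : ∀ x ∈ U, ∀ w r, (ε ≤ |r| → w = 0) → |w * (F (x - r) - F x)| ≤
      (C * V x ^ m) * (|w| * √|r|) := by
    intro x hx w r hw
    by_cases hr : ε ≤ |r|
    · simp [hw hr]
    · have hr' := (not_le.1 hr).le
      have := hb x (hxU x hx) (x - r) (hi.mem' hx hr') (by rw [sub_sub_cancel]; linarith)
      rw [sub_sub_cancel, abs_sub_comm] at this
      rw [abs_mul]
      calc _ ≤ |w| * (C * V x ^ m * √|r|) := by gcongr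
        _ = _ := by ring
  have hk0 : ∀ d r, ε ≤ |r| → regKer' φ d r = 0 := fun d r => regKer'_zero_of_le hφ hε d
  have hne : ∀ᵐ r : ℝ, r ≠ 0 := by simp [ae_iff, measure_singleton]
  have hlim : ∀ᵐ r, Tendsto (fun n => regKer' φ (δ n) r) atTop (𝓝 (regKer' φ 0 r)) := by
    filter_upwards [hne] with r hr
    exact tendsto_regKer' φ hr hδt
  have hQi : ∀ x ∈ U, Integrable fun r => regKer' φ 0 r * (F (x - r) - F x) := by
    intro x hx
    refine ((hki 0 le_rfl (by norm_num)).const_mul (C * V x ^ m)).mono' ?_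
      (ae_of_all _ fun r => hdiff x hx _ r (hk0 0 r))
    apply aestronglyMeasurable_of_tendsto_ae atTop
      (f := fun n r => regKer' φ (δ n) r * (F (x - r) - F x))
    · exact fun n => (conv_regKer'_eq hi hφ (hδ0 n) hFt hx).1.aestronglyMeasurable
    · filter_upwards [hlim] with r hr
      exact hr.mul_const _
  -- `η n` does not involve `x`, so its convergence to `0` makes the convergence to `Q` locally
  -- uniform.
  set η : ℕ → ℝ := fun n => ∫ r, |regKer' φ (δ n) r - regKer' φ 0 r| * √|r| with hη
  have hηb : ∀ n r, |regKer' φ (δ n) r - regKer' φ 0 r| * √|r| ≤ 2 * (L * σ r) := by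
    intro n r
    have h1 := hL (δ n) (hδ0 n).le (hδ1 n) r
    have h2 := hL 0 le_rfl (by norm_num) r
    calc _ ≤ (|regKer' φ (δ n) r| + |regKer' φ 0 r|) * √|r| := by gcongr; exact abs_sub _ _
      _ ≤ _ := by rw [add_mul]; linarith
  have hηm : ∀ n, AEStronglyMeasurable
      (fun r => |regKer' φ (δ n) r - regKer' φ 0 r| * √|r|) volume := fun n =>
    ((((measurable_regKer' hφ _).sub (measurable_regKer' hφ _)).abs).mul
      (by fun_prop)).aestronglyMeasurable
  have hηi : ∀ n, Integrable fun r => |regKer' φ (δ n) r - regKer' φ 0 r| * √|r| := fun n =>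
    ((hσi.const_mul L).const_mul 2).mono' (hηm n) (ae_of_all _ fun r => by
      rw [Real.norm_eq_abs, abs_of_nonneg (by positivity)]; exact hηb n r)
  have hηt : Tendsto η atTop (𝓝 0) := by
    have := tendsto_integral_of_dominated_convergence (fun r => 2 * (L * σ r)) hηm
      ((hσi.const_mul L).const_mul 2) (fun n => ae_of_all _ fun r => by
        rw [Real.norm_eq_abs, abs_of_nonneg (by positivity)]; exact hηb n r)
      (f := fun _ => 0) (by
        filter_upwards [hlim] with r hr
        have := ((hr.sub_const (regKer' φ 0 r)).abs).mul_const (√|r|)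
        simpa using this)
    simpa using this
  have hclose : ∀ n, ∀ x ∈ U, |Q x - GCLM.conv (regKer' φ (δ n)) F x| ≤
      (C * V x ^ m) * η n := by
    intro n x hx
    obtain ⟨h1, h2⟩ := conv_regKer'_eq hi hφ (hδ0 n) hFt hx
    rw [h2, hQ, abs_sub_comm]
    simp only
    rw [← integral_sub h1 (hQi x hx), hη]
    simp only
    rw [← integral_const_mul]
    refine norm_integral_le_of_norm_le (f := fun r => regKer' φ (δ n) r * (F (x - r) - F x) -
      regKer' φ 0 r * (F (x - r) - F x)) ((hηi n).const_mul _) (ae_of_all _ fun r => ?_)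
    rw [← sub_mul]
    exact hdiff x hx _ r fun hr => by rw [hk0 _ r hr, hk0 _ r hr, sub_zero]
  have hunif : TendstoLocallyUniformlyOn (fun n => GCLM.conv (regKer' φ (δ n)) F) Q atTop U := by
    rw [Metric.tendstoLocallyUniformlyOn_iff]
    intro e he x hx
    obtain ⟨K, hK1, hK⟩ := hV.exists_transfer m
    refine ⟨U ∩ Metric.ball x 1, inter_mem self_mem_nhdsWithin
      (mem_nhdsWithin_of_mem_nhds (Metric.ball_mem_nhds x one_pos)), ?_⟩
    have hpos : 0 ≤ C * (K * V x ^ m) := by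
      have := hV.pos x
      positivity
    have hη0 : ∀ n, 0 ≤ η n := fun n => integral_nonneg fun r => by positivity
    have ht : Tendsto (fun n => C * (K * V x ^ m) * η n) atTop (𝓝 0) := by
      simpa using hηt.const_mul (C * (K * V x ^ m))
    filter_upwards [ht.eventually (gt_mem_nhds he)] with n hn y hy
    rw [Real.dist_eq]
    refine (hclose n y hy.1).trans_lt (lt_of_le_of_lt ?_ hn)
    apply mul_le_mul_of_nonneg_right _ (hη0 n)
    apply mul_le_mul_of_nonneg_left _ hC
    apply hK x y
    have := hy.2
    rw [Metric.mem_ball, Real.dist_eq, abs_sub_comm] at this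
    exact this.le
  have hcont : ∀ n, ContinuousOn (GCLM.conv (regKer' φ (δ n)) F) U := by
    intro n
    apply continuousOn_conv hV hi _ hFt
    refine ⟨(continuous_regKer' hφ (hδ0 n)).integrable_of_hasCompactSupport ?_,
      fun r hr => hk0 _ r hr.le⟩
    apply HasCompactSupport.intro (isCompact_Icc (a := -ε) (b := ε))
    intro r hr
    apply hk0
    rw [mem_Icc, ← abs_le] at hr
    exact (not_le.1 hr).le
  refine ⟨Q, fun x hx => ?_, hunif.continuousOn (Frequently.of_forall hcont),
    C * (L * ∫ r, σ r), m, ?_, ?_⟩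
  · refine hasDerivAt_of_tendstoLocallyUniformlyOn hi.isOpen hunif (Eventually.of_forall fun n y hy =>
      hasDerivAt_conv_kernel (K := regKer φ (δ n)) hi (hasDerivAt_regKer hφ (hδ0 n))
        (continuous_regKer' hφ (hδ0 n)) (fun r hr => ?_) (hk0 _) hFt hy) (fun y hy => ?_) hx
    · rw [regKer, hφ.zero r (by linarith), zero_mul]
    · have hKl := isKernel_logKer hφ hε (by linarith)
      obtain ⟨M, s, hs, -, -, hM⟩ := hFt.exists_near_bound hV hi hy
      have hMy := hM y (mem_of_mem_nhds hs)
      have hM0 : 0 ≤ M := (abs_nonneg _).trans (hMy 0 (by simpa using hε.le))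
      apply tendsto_integral_of_dominated_convergence (fun r => M * |logKer φ r|)
      · intro n
        have hKn : IsKernel ε (regKer φ (δ n)) := by
          refine ⟨?_, fun r hr => by rw [regKer, hφ.zero r (by linarith), zero_mul]⟩
          apply Continuous.integrable_of_hasCompactSupport
          · exact continuous_iff_continuousAt.2 fun r =>
              (hasDerivAt_regKer hφ (hδ0 n) r).continuousAt
          · apply HasCompactSupport.intro (isCompact_Icc (a := -ε) (b := ε))
            intro r hr
            rw [mem_Icc, ← abs_le, not_le] at hr
            rw [regKer, hφ.zero r (by linarith), zero_mul]
        exact (hKn.integrable_mul hFt.1 fun r hr => hi.mem' hy hr).aestronglyMeasurable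
      · exact hKl.integrable.abs.const_mul M
      · intro n
        filter_upwards [hne] with r hr0
        by_cases hr : |r| ≤ ε
        · rw [Real.norm_eq_abs, abs_mul, mul_comm]
          apply mul_le_mul (hMy r (by linarith)) _ (abs_nonneg _) hM0
          rw [regKer, logKer, abs_mul (φ r), abs_mul (φ r)]
          exact mul_le_mul_of_nonneg_left
            (abs_half_log_le (hδ0 n).le (hδ1 n) hr0 (by linarith)) (abs_nonneg _)
        · rw [regKer, hφ.zero r (by linarith [not_le.1 hr]), zero_mul, zero_mul, norm_zero]
          positivity
      · filter_upwards [hne] with r hr0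
        exact (tendsto_regKer φ hr0 hδt).mul_const _
  · have : 0 ≤ ∫ r, σ r := integral_nonneg fun r => indicator_nonneg (fun _ _ => by positivity) r
    positivity
  · intro x hx
    have : |Q x| ≤ ∫ r, (C * V x ^ m) * (L * σ r) := by
      refine norm_integral_le_of_norm_le (f := fun r => regKer' φ 0 r * (F (x - r) - F x))
        ((hσi.const_mul L).const_mul _) (ae_of_all _ fun r => ?_)
      refine (hdiff x hx _ r (hk0 0 r)).trans ?_
      have := hV.pos x
      exact mul_le_mul_of_nonneg_left (hL 0 le_rfl (by norm_num) r) (by positivity)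
    rw [integral_const_mul, integral_const_mul] at this
    calc _ ≤ _ := this
      _ = _ := by ring

/-- All `n` derivatives are put on `F`, and the last one is taken through the singular kernel. -/
theorem Reg.conv_logKer_succ (hV : IsWeight V) (hi : IsInset ε U U') (hφ : IsCutoff ε φ) {n : ℕ}
    (hF : Reg U' (TameHolder U' V) n F) :
    Reg U (Tame U V) (n + 1) (GCLM.conv (logKer φ) F) := by
  have hε := hi.pos
  have hε' := hi.le
  have hK := isKernel_logKer hφ hε (by linarith)
  induction n generalizing F with
  | zero => exact ⟨Tame.conv hV hi hK hF.1, TameHolder.exists_deriv_conv_logKer hV hi hφ hF⟩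
  | succ n ih =>
    obtain ⟨h1, F', hd, h2⟩ := hF
    exact ⟨Tame.conv hV hi hK h1.1, GCLM.conv (logKer φ) F',
      fun x hx => hasDerivAt_conv hV hi hK h1.1.1 hd h2.base.1 hx, ih h2⟩

end Holder

/-! ### The kernel of `T`: primitive, mean zero and sign. -/

/-- The logarithmic kernel in the ratio variable. -/
noncomputable def ell (t : ℝ) : ℝ := Real.log |(1 + t) / (1 - t)|

/-- The kernel of `T` in the ratio variable. -/
noncomputable def ker (t : ℝ) : ℝ := t * ell t - 2

/-- A continuous primitive of `ker` on `(-1, ∞)`. -/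
noncomputable def kerPrim (t : ℝ) : ℝ :=
  (t + 1) / 2 * ((t - 1) * Real.log (1 + t) - (t - 1) * Real.log (t - 1)) - t

lemma ell_eq {t : ℝ} (h0 : 0 ≤ t) (h1 : t ≠ 1) :
    ell t = Real.log (1 + t) - Real.log (t - 1) := by
  rw [ell, Real.log_abs, Real.log_div (by linarith) (sub_ne_zero.2 h1.symm),
    ← Real.log_neg_eq_log (1 - t), neg_sub]

lemma kerPrim_eq {t : ℝ} (h0 : 0 ≤ t) (h1 : t ≠ 1) :
    kerPrim t = (t ^ 2 - 1) / 2 * ell t - t := by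
  rw [ell_eq h0 h1, kerPrim]; ring

lemma hasDerivAt_kerPrim {t : ℝ} (h0 : 0 ≤ t) (h1 : t ≠ 1) : HasDerivAt kerPrim (ker t) t := by
  have hp : (1 + t) ≠ 0 := by linarith
  have hm : t - 1 ≠ 0 := sub_ne_zero.2 h1
  have i1 : HasDerivAt (fun t : ℝ => 1 + t) 1 t := (hasDerivAt_id t).const_add 1
  have i2 : HasDerivAt (fun t : ℝ => t - 1) 1 t := (hasDerivAt_id t).sub_const 1
  have i3 : HasDerivAt (fun t : ℝ => (t + 1) / 2) (1 / 2) t :=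
    ((hasDerivAt_id t).add_const 1).div_const 2
  have := (i3.mul ((i2.mul (i1.log hp)).sub (i2.mul (i2.log hm)))).sub (hasDerivAt_id t)
  refine this.congr_deriv ?_
  rw [ker, ell_eq h0 h1]
  simp only [Pi.sub_apply, Pi.mul_apply]
  field_simp
  ring

lemma continuousOn_kerPrim : ContinuousOn kerPrim (Ici 0) := by
  have h1 : ContinuousOn (fun t : ℝ => Real.log (1 + t)) (Ici 0) :=
    ContinuousOn.log (by fun_prop) fun t ht => by
      have : (0 : ℝ) ≤ t := ht
      linarith
  -- `u log |u|` is continuous with value `0` at `u = 0`, so the primitive passes through the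
  -- singularity at `t = 1`.
  have h2 : Continuous (fun t : ℝ => (t - 1) * Real.log (t - 1)) :=
    Real.continuous_mul_log.comp (by fun_prop)
  have h3 : ContinuousOn (fun t : ℝ => (t - 1) * Real.log (1 + t) -
      (t - 1) * Real.log (t - 1)) (Ici 0) :=
    ((by fun_prop : ContinuousOn (fun t : ℝ => t - 1) (Ici 0)).mul h1).sub h2.continuousOn
  exact ((by fun_prop : ContinuousOn (fun t : ℝ => (t + 1) / 2) (Ici 0)).mul h3).sub
    continuousOn_id

lemma two_mul_le_log {s : ℝ} (h0 : 0 ≤ s) (h1 : s < 1) :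
    2 * s ≤ Real.log ((1 + s) / (1 - s)) := by
  have hp : 0 < 1 - s := by linarith
  -- The bound `2 u / (u + 2) ≤ log (1 + u)` at `u = 2 s / (1 - s)`, where the left side is exactly
  -- `2 s`.
  have := Real.le_log_one_add_of_nonneg (x := 2 * s / (1 - s)) (by positivity)
  have e1 : 1 + 2 * s / (1 - s) = (1 + s) / (1 - s) := by field_simp; ring
  have e2 : 2 * (2 * s / (1 - s)) / (2 * s / (1 - s) + 2) = 2 * s := by
    have : 2 * s / (1 - s) + 2 = 2 / (1 - s) := by field_simp; ring
    rw [this]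
    field_simp
  rwa [e1, e2] at this

/-- This is `u ≤ sinh u` at `u = log ((1 + s) / (1 - s))`, whose hyperbolic sine is `2 s / (1 -
s²)`. -/
lemma log_le_two_mul {s : ℝ} (h0 : 0 ≤ s) (h1 : s < 1) :
    Real.log ((1 + s) / (1 - s)) ≤ 2 * s / (1 - s ^ 2) := by
  have hp : 0 < 1 - s := by linarith
  have hy : 1 ≤ (1 + s) / (1 - s) := by rw [le_div_iff₀ hp]; linarith
  have h := Real.self_le_sinh_iff.2 (Real.log_nonneg hy)
  rw [Real.sinh_log (by linarith)] at h
  refine h.trans (le_of_eq ?_)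
  have : 1 - s ^ 2 ≠ 0 := by nlinarith
  have : 1 + s ≠ 0 := by linarith
  have e : 1 - s ^ 2 = (1 - s) * (1 + s) := by ring
  rw [e]
  field_simp
  ring

lemma ell_eq_log (t : ℝ) : ell t = Real.log ((1 + t) / (1 - t)) := by
  rw [ell, Real.log_abs]

/-- Replacing `t` by `t⁻¹` only changes the sign of the quotient, so estimates on `(0, 1)` carry
over to `(1, ∞)`. -/
lemma ell_of_one_lt {t : ℝ} (h1 : 1 < t) :
    ell t = Real.log ((1 + t⁻¹) / (1 - t⁻¹)) := by
  have h : (1 + t⁻¹) / (1 - t⁻¹) = -((1 + t) / (1 - t)) := by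
    have : t - 1 ≠ 0 := by linarith
    have : 1 - t ≠ 0 := by linarith
    field_simp
    ring
  rw [ell, Real.log_abs, h, Real.log_neg_eq_log]

lemma ell_nonneg {t : ℝ} (h0 : 0 ≤ t) : 0 ≤ ell t := by
  rcases lt_trichotomy t 1 with h | h | h
  · rw [ell_eq_log]; linarith [two_mul_le_log h0 h]
  · subst h; simp [ell]
  · rw [ell_of_one_lt h]
    have hi : 0 ≤ t⁻¹ := by positivity
    linarith [two_mul_le_log hi (inv_lt_one_of_one_lt₀ h)]

lemma two_mul_sq_le {t : ℝ} (h0 : 0 ≤ t) (h1 : t < 1) : 2 * t ^ 2 ≤ t * ell t := by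
  rw [ell_eq_log]
  nlinarith [two_mul_le_log h0 h1]

lemma two_le_mul_ell {t : ℝ} (h1 : 1 < t) : 2 ≤ t * ell t := by
  rw [ell_of_one_lt h1]
  have hi : 0 ≤ t⁻¹ := by positivity
  have h := two_mul_le_log hi (inv_lt_one_of_one_lt₀ h1)
  calc (2 : ℝ) = t * (2 * t⁻¹) := by field_simp
    _ ≤ _ := mul_le_mul_of_nonneg_left h (by linarith)

lemma ell_mono {s t : ℝ} (h0 : 0 ≤ s) (hst : s ≤ t) (h1 : t < 1) : ell s ≤ ell t := by
  rw [ell_eq_log s, ell_eq_log t]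
  have : 0 < 1 - t := by linarith
  have : 0 < 1 - s := by linarith
  apply Real.log_le_log (by positivity)
  rw [div_le_div_iff₀ (by linarith) (by linarith)]
  nlinarith

lemma ker_mono {s t : ℝ} (h0 : 0 ≤ s) (hst : s ≤ t) (h1 : t < 1) : ker s ≤ ker t := by
  have := mul_le_mul hst (ell_mono h0 hst h1) (ell_nonneg h0) (by linarith)
  rw [ker, ker]; linarith

lemma ell_le_two {t : ℝ} (h0 : 0 ≤ t) (h1 : t ≤ 1 / 2) : ell t ≤ 2 := by
  refine (ell_mono h0 h1 (by norm_num)).trans ?_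
  rw [ell_eq_log]
  have := Real.log_le_sub_one_of_pos (show (0 : ℝ) < (1 + 1 / 2) / (1 - 1 / 2) by norm_num)
  linarith [show ((1 : ℝ) + 1 / 2) / (1 - 1 / 2) - 1 = 2 by norm_num]

lemma ker_le_of_le_half {t : ℝ} (h0 : 0 ≤ t) (h1 : t ≤ 1 / 2) : ker t ≤ -(2 - 2 * t) := by
  have := mul_le_mul_of_nonneg_left (ell_le_two h0 h1) h0
  rw [ker]; linarith

lemma kerPrim_tendsto : Tendsto kerPrim atTop (𝓝 0) := by
  have h1 : Tendsto (fun t : ℝ => -t⁻¹) atTop (𝓝 0) := by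
    simpa using (tendsto_inv_atTop_zero (𝕜 := ℝ)).neg
  apply tendsto_of_tendsto_of_tendsto_of_le_of_le' h1 tendsto_const_nhds
  · filter_upwards [eventually_gt_atTop 1] with t ht
    rw [kerPrim_eq (by linarith) ht.ne']
    have h2 := two_le_mul_ell ht
    have h3 : 2 * t⁻¹ ≤ ell t := by
      rw [← div_eq_mul_inv, div_le_iff₀ (by linarith)]; linarith
    have h4 : 0 ≤ (t ^ 2 - 1) / 2 := by nlinarith
    have h5 := mul_le_mul_of_nonneg_left h3 h4
    have h6 : (t ^ 2 - 1) / 2 * (2 * t⁻¹) = t - t⁻¹ := by field_simp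
    linarith
  · filter_upwards [eventually_gt_atTop 1] with t ht
    rw [kerPrim_eq (by linarith) ht.ne', ell_of_one_lt ht]
    have hi : 0 ≤ t⁻¹ := by positivity
    have h2 := log_le_two_mul hi (inv_lt_one_of_one_lt₀ ht)
    have h4 : 0 ≤ (t ^ 2 - 1) / 2 := by nlinarith
    have h5 := mul_le_mul_of_nonneg_left h2 h4
    have h6 : (t ^ 2 - 1) / 2 * (2 * t⁻¹ / (1 - t⁻¹ ^ 2)) = t := by
      have : t ^ 2 - 1 ≠ 0 := by nlinarith
      field_simp
    linarith

/-- The primitive is `0` at `0`, `-1` at `1`, and tends to `0` at infinity. Since `ker + 2 ≥ 0` on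
`(0, 1)` and `ker ≥ 0` on `(1, ∞)`, integrability follows from the existence of these boundary
values. -/
lemma ker_integrable_aux :
    IntegrableOn ker (Ioi 0) ∧ ∫ t in Ioi (0 : ℝ), ker t = 0 := by
  have hc1 : ContinuousOn kerPrim (Icc 0 1) := continuousOn_kerPrim.mono Icc_subset_Ici_self
  have h1d : ∀ t ∈ Ioo (0 : ℝ) 1, HasDerivAt (fun t => kerPrim t + 2 * t) (ker t + 2) t := by
    intro t ht
    exact ((hasDerivAt_kerPrim ht.1.le ht.2.ne).add ((hasDerivAt_id t).const_mul 2)).congr_deriv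
      (by ring)
  have h1n : ∀ t ∈ Ioo (0 : ℝ) 1, 0 ≤ ker t + 2 := fun t ht => by
    rw [ker]
    have := mul_nonneg ht.1.le (ell_nonneg ht.1.le)
    linarith
  have h1i : IntegrableOn (fun t => ker t + 2) (Ioc 0 1) :=
    intervalIntegral.integrableOn_deriv_of_nonneg (g := fun t => kerPrim t + 2 * t)
      (hc1.add (by fun_prop)) h1d h1n
  have h1k : IntegrableOn ker (Ioc 0 1) := by
    have := h1i.sub (integrableOn_const (C := (2 : ℝ)) (μ := volume) (s := Ioc (0 : ℝ) 1) (by simp))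
    refine this.congr (ae_of_all _ fun t => ?_)
    simp
  have h1v : ∫ t in Ioc (0 : ℝ) 1, ker t = -1 := by
    rw [← intervalIntegral.integral_of_le zero_le_one,
      intervalIntegral.integral_eq_sub_of_hasDerivAt_of_le zero_le_one hc1
        (fun t ht => hasDerivAt_kerPrim ht.1.le ht.2.ne)
        ((intervalIntegrable_iff_integrableOn_Ioc_of_le zero_le_one).2 h1k)]
    norm_num [kerPrim]
  have h2n : ∀ t ∈ Ioi (1 : ℝ), 0 ≤ ker t := fun t ht => by
    have := two_le_mul_ell ht
    rw [ker]; linarith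
  have h2d : ∀ t ∈ Ioi (1 : ℝ), HasDerivAt kerPrim (ker t) t := fun t ht =>
    hasDerivAt_kerPrim (zero_le_one.trans (le_of_lt ht)) (ne_of_gt ht)
  have hcw : ContinuousWithinAt kerPrim (Ici 1) 1 :=
    (continuousOn_kerPrim 1 (by norm_num)).mono (Ici_subset_Ici.2 zero_le_one)
  have h2k : IntegrableOn ker (Ioi 1) :=
    integrableOn_Ioi_deriv_of_nonneg hcw h2d h2n kerPrim_tendsto
  have h2v : ∫ t in Ioi (1 : ℝ), ker t = 1 := by
    rw [integral_Ioi_of_hasDerivAt_of_nonneg hcw h2d h2n kerPrim_tendsto]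
    norm_num [kerPrim]
  have hu : Ioc (0 : ℝ) 1 ∪ Ioi 1 = Ioi 0 := Ioc_union_Ioi_eq_Ioi zero_le_one
  refine ⟨hu ▸ h1k.union h2k, ?_⟩
  rw [← hu, setIntegral_union (Ioc_disjoint_Ioi le_rfl) measurableSet_Ioi h1k h2k, h1v, h2v]
  norm_num

lemma integrableOn_ker : IntegrableOn ker (Ioi 0) := ker_integrable_aux.1

lemma integral_ker : ∫ t in Ioi (0 : ℝ), ker t = 0 := ker_integrable_aux.2

/-- The kernel changes sign exactly once, from negative to positive. -/
lemma exists_ker_sign : ∃ τ : ℝ, 1 / 2 ≤ τ ∧ τ < 1 ∧ (∀ t, 0 ≤ t → t ≤ τ → ker t ≤ 0) ∧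
    ∀ t, τ ≤ t → t ≠ 1 → 0 ≤ ker t := by
  -- With `t₁ = (e⁴ - 1) / (e⁴ + 1)` one has `ell t₁ = 4`, so `ker t₁ = 4 t₁ - 2 ≥ 0`, while `ker
  -- (1/2) ≤ -1`.
  set E := Real.exp 4 with hE
  have hE3 : 3 ≤ E := by have := Real.add_one_le_exp (4 : ℝ); linarith
  set t₁ := (E - 1) / (E + 1) with ht₁
  have h1 : 1 / 2 ≤ t₁ := by rw [ht₁, div_le_div_iff₀ (by norm_num) (by linarith)]; linarith
  have h2 : t₁ < 1 := by rw [ht₁, div_lt_one (by linarith)]; linarith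
  have h3 : ell t₁ = 4 := by
    rw [ell_eq_log]
    have : (1 + t₁) / (1 - t₁) = E := by
      have h5 : 1 - t₁ = 2 / (E + 1) := by rw [ht₁]; field_simp; ring
      have h6 : 1 + t₁ = 2 * E / (E + 1) := by rw [ht₁]; field_simp; ring
      rw [h5, h6]; field_simp
    rw [this, hE, Real.log_exp]
  have h4 : 0 ≤ ker t₁ := by rw [ker, h3]; linarith
  have hc : ContinuousOn ker (Icc (1 / 2) t₁) := by
    have : ContinuousOn ell (Icc (1 / 2) t₁) := by
      apply ContinuousOn.congr (f := fun t => Real.log ((1 + t) / (1 - t)))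
      · apply ContinuousOn.log
        · apply ContinuousOn.div (by fun_prop) (by fun_prop)
          intro t ht; linarith [ht.2]
        · intro t ht
          have a1 : 0 < 1 + t := by linarith [ht.1]
          have a2 : 0 < 1 - t := by linarith [ht.2]
          positivity
      · intro t ht
        exact ell_eq_log t
    unfold ker
    fun_prop
  have h5 := ker_le_of_le_half (t := 1 / 2) (by norm_num) le_rfl
  obtain ⟨τ, hτ, hτ0⟩ := intermediate_value_Icc h1 hc (show (0 : ℝ) ∈ Icc _ _ from
    ⟨by linarith, h4⟩)
  have hτ1 : τ < 1 := lt_of_le_of_lt hτ.2 h2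
  -- The point `t = 1` is excluded since division by zero and `log 0 = 0` give `ker 1 = -2`.
  refine ⟨τ, hτ.1, hτ1, fun t ht0 ht => ?_, fun t ht htne => ?_⟩
  · rw [← hτ0]; exact ker_mono ht0 ht hτ1
  · rcases lt_or_gt_of_ne htne with h | h
    · rw [← hτ0]; exact ker_mono (by linarith [hτ.1]) ht h
    · have := two_le_mul_ell h
      rw [ker]; linarith

/-! ### The transform `T`: continuity, sign and quantitative bounds. -/

section Transform

variable {g : ℝ → ℝ} {M x : ℝ}

lemma T_eq_of_pos (g : ℝ → ℝ) (hx : 0 < x) :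
    T g x = x / Real.pi * ∫ t in Ioi (0 : ℝ), g (x * t) * ker t := by
  rw [T, if_neg hx.ne']
  have h := integral_comp_mul_left_Ioi
    (fun y => g y * (y / x * Real.log |(x + y) / (x - y)| - 2)) 0 hx
  rw [mul_zero, smul_eq_mul] at h
  have h2 : ∀ t : ℝ, g (x * t) * (x * t / x * Real.log |(x + x * t) / (x - x * t)| - 2) =
      g (x * t) * ker t := by
    intro t
    have e1 : x * t / x = t := by field_simp
    have e2 : (x + x * t) / (x - x * t) = (1 + t) / (1 - t) := by
      rw [← mul_div_mul_left (1 + t) (1 - t) hx.ne']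
      ring_nf
    rw [e1, e2, ker, ell]
  simp only [h2] at h
  rw [h]
  field_simp

lemma T_neg (g : ℝ → ℝ) (x : ℝ) : T g (-x) = T g x := by
  unfold T
  by_cases hx : x = 0
  · simp [hx]
  rw [if_neg hx, if_neg (neg_ne_zero.2 hx)]
  congr 2
  ext y
  have e : (-x + y) / (-x - y) = ((x + y) / (x - y))⁻¹ := by
    rw [inv_div, ← neg_div_neg_eq]
    ring_nf
  rw [e, abs_inv, Real.log_inv, div_neg]
  ring

/-- The scale-invariant form of `T`. -/
lemma T_eq (g : ℝ → ℝ) (x : ℝ) :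
    T g x = |x| / Real.pi * ∫ t in Ioi (0 : ℝ), g (|x| * t) * ker t := by
  rcases lt_trichotomy x 0 with h | h | h
  · rw [abs_of_neg h, ← T_neg]
    exact T_eq_of_pos g (neg_pos.2 h)
  · simp [h, T]
  · rw [abs_of_pos h]
    exact T_eq_of_pos g h

lemma integrableOn_mul_ker (hg : Continuous g) (hM : ∀ y, |g y| ≤ M) (x : ℝ) :
    IntegrableOn (fun t => g (x * t) * ker t) (Ioi 0) :=
  integrableOn_ker.bdd_mul (c := M) (by fun_prop) (ae_of_all _ fun t => hM _)

lemma continuous_integral_mul_ker (hg : Continuous g) (hM : ∀ y, |g y| ≤ M) :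
    Continuous fun x => ∫ t in Ioi (0 : ℝ), g (x * t) * ker t := by
  apply continuous_of_dominated (bound := fun t => M * |ker t|)
  · intro x
    exact (integrableOn_mul_ker hg hM x).aestronglyMeasurable
  · intro x
    refine ae_of_all _ fun t => ?_
    rw [Real.norm_eq_abs, abs_mul]
    exact mul_le_mul_of_nonneg_right (hM _) (abs_nonneg _)
  · exact integrableOn_ker.abs.const_mul M
  · refine ae_of_all _ fun t => ?_
    fun_prop

lemma continuous_T (hg : Continuous g) (hM : ∀ y, |g y| ≤ M) : Continuous (T g) := by
  rw [show T g = fun x => |x| / Real.pi * ∫ t in Ioi (0 : ℝ), g (|x| * t) * ker t from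
    funext (T_eq g)]
  exact (continuous_abs.div_const _).mul ((continuous_integral_mul_ker hg hM).comp continuous_abs)

/-- Constants are annihilated because `ker` has integral zero. -/
lemma T_sub_const (hg : Continuous g) (hM : ∀ y, |g y| ≤ M) (C x : ℝ) :
    T (fun y => g y - C) x = T g x := by
  rw [T_eq, T_eq]
  simp only [sub_mul]
  rw [integral_sub (integrableOn_mul_ker hg hM _) (integrableOn_ker.const_mul C),
    integral_const_mul, integral_ker, mul_zero, sub_zero]

/-- `T(g)(x) / x` is bounded near the origin. -/
lemma abs_T_le (hM : ∀ y, |g y| ≤ M) (x : ℝ) :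
    |T g x| ≤ |x| * (M / Real.pi * ∫ t in Ioi (0 : ℝ), |ker t|) := by
  rw [T_eq, abs_mul, abs_div, abs_abs, abs_of_pos Real.pi_pos]
  have : |∫ t in Ioi (0 : ℝ), g (|x| * t) * ker t| ≤ ∫ t in Ioi (0 : ℝ), M * |ker t| := by
    refine norm_integral_le_of_norm_le (f := fun t => g (|x| * t) * ker t)
      (integrableOn_ker.abs.const_mul M) (ae_of_all _ fun t => ?_)
    rw [Real.norm_eq_abs, abs_mul]
    exact mul_le_mul_of_nonneg_right (hM _) (abs_nonneg _)
  rw [integral_const_mul] at this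
  have hpi := Real.pi_pos
  calc |x| / Real.pi * |∫ t in Ioi (0 : ℝ), g (|x| * t) * ker t|
      ≤ |x| / Real.pi * (M * ∫ t in Ioi (0 : ℝ), |ker t|) := by gcongr
    _ = _ := by ring

/-- Quantitative negativity of `T` on functions that are non-increasing on `[0, ∞)`. -/
theorem exists_T_upper : ∃ τ : ℝ, 0 < τ ∧ ∀ g : ℝ → ℝ, ∀ M : ℝ, Continuous g →
    (∀ y, |g y| ≤ M) → AntitoneOn g (Ici 0) → ∀ X x, 0 ≤ X → 0 < x → 2 * X ≤ x →
      T g x ≤ -(1 / Real.pi * ((2 - 2 * (X / x)) *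
        ((∫ y in (0 : ℝ)..X, g y) - X * g (τ * x)))) := by
  obtain ⟨τ, hτ, hτ1, hneg, hpos⟩ := exists_ker_sign
  refine ⟨τ, by linarith, fun g M hg hM ha X x hX hx hXx => ?_⟩
  have hgi := integrableOn_mul_ker hg hM x
  -- Subtracting the value of `g` at the sign change of `ker` does not alter the integral and makes
  -- the integrand nonpositive almost everywhere, so the part beyond `X / x` can be dropped.
  set G : ℝ → ℝ := fun t => g (x * t) - g (τ * x) with hG
  have hGi : IntegrableOn (fun t => G t * ker t) (Ioi 0) := by
    simp only [hG, sub_mul]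
    exact hgi.sub (integrableOn_ker.const_mul _)
  have e1 : ∫ t in Ioi (0 : ℝ), g (x * t) * ker t = ∫ t in Ioi (0 : ℝ), G t * ker t := by
    simp only [hG, sub_mul]
    rw [integral_sub hgi (integrableOn_ker.const_mul _), integral_const_mul, integral_ker,
      mul_zero, sub_zero]
  have hXx' : X / x ≤ 1 / 2 := by rw [div_le_iff₀ hx]; linarith
  have hXx0 : 0 ≤ X / x := by positivity
  have hsplit : Ioc (0 : ℝ) (X / x) ∪ Ioi (X / x) = Ioi 0 := Ioc_union_Ioi_eq_Ioi hXx0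
  have hG1 : ∀ t, 0 < t → t ≤ τ → 0 ≤ G t := by
    intro t ht0 ht
    have : x * t ≤ τ * x := by nlinarith
    exact sub_nonneg.2 (ha (mem_Ici.2 (by positivity)) (mem_Ici.2 (by nlinarith)) this)
  have hG2 : ∀ t, 0 < t → τ ≤ t → G t ≤ 0 := by
    intro t ht0 ht
    have : τ * x ≤ x * t := by nlinarith
    exact sub_nonpos.2 (ha (mem_Ici.2 (by nlinarith)) (mem_Ici.2 (by positivity)) this)
  have hle : ∀ t, 0 < t → t ≠ 1 → G t * ker t ≤ 0 := by
    intro t ht0 ht1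
    rcases le_total t τ with h | h
    · exact mul_nonpos_of_nonneg_of_nonpos (hG1 t ht0 h) (hneg t ht0.le h)
    · exact mul_nonpos_of_nonpos_of_nonneg (hG2 t ht0 h) (hpos t h ht1)
  have hi1 : IntegrableOn (fun t => G t * ker t) (Ioc 0 (X / x)) :=
    hGi.mono_set Ioc_subset_Ioi_self
  have hi2 : IntegrableOn (fun t => G t * ker t) (Ioi (X / x)) :=
    hGi.mono_set (Ioi_subset_Ioi hXx0)
  have e2 : ∫ t in Ioi (X / x), G t * ker t ≤ 0 := by
    apply setIntegral_nonpos_of_ae_restrict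
    have : ∀ᵐ t : ℝ, t ≠ 1 := by simp [ae_iff, measure_singleton]
    filter_upwards [ae_restrict_of_ae this, ae_restrict_mem measurableSet_Ioi] with t h1 h2
    exact hle t (lt_of_le_of_lt hXx0 h2) h1
  have hGc : Continuous G := by fun_prop
  have e3 : ∫ t in Ioc 0 (X / x), G t * ker t ≤
      ∫ t in Ioc 0 (X / x), -(2 - 2 * (X / x)) * G t := by
    apply setIntegral_mono_on hi1
      ((hGc.const_mul _).continuousOn.integrableOn_Icc.mono_set Ioc_subset_Icc_self)
      measurableSet_Ioc
    intro t ht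
    have h1 := ker_le_of_le_half ht.1.le (ht.2.trans hXx')
    have h2 := hG1 t ht.1 (by linarith [ht.2])
    have h3 : ker t ≤ -(2 - 2 * (X / x)) := by linarith [ht.2]
    rw [mul_comm]
    exact mul_le_mul_of_nonneg_right h3 h2
  have e4 : x * ∫ t in Ioc 0 (X / x), G t = (∫ y in (0 : ℝ)..X, g y) - X * g (τ * x) := by
    rw [← intervalIntegral.integral_of_le hXx0]
    simp only [hG]
    rw [intervalIntegral.integral_sub ((by fun_prop : Continuous fun t => g (x * t)).intervalIntegrable _ _)
      intervalIntegrable_const, mul_sub, ← smul_eq_mul x, intervalIntegral.smul_integral_comp_mul_left]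
    rw [intervalIntegral.integral_const, mul_zero, smul_eq_mul, sub_zero]
    field_simp
  rw [integral_const_mul] at e3
  rw [T_eq_of_pos g hx, e1, ← hsplit, setIntegral_union (Ioc_disjoint_Ioi le_rfl)
    measurableSet_Ioi hi1 hi2]
  have hpi := Real.pi_pos
  have : x / Real.pi * ((∫ t in Ioc 0 (X / x), G t * ker t) + ∫ t in Ioi (X / x), G t * ker t) ≤
      x / Real.pi * (-(2 - 2 * (X / x)) * ∫ t in Ioc 0 (X / x), G t) := by
    gcongr
    linarith
  refine this.trans (le_of_eq ?_)
  rw [← e4]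
  ring

lemma T_nonpos (hg : Continuous g) (hM : ∀ y, |g y| ≤ M) (ha : AntitoneOn g (Ici 0)) (x : ℝ) :
    T g x ≤ 0 := by
  obtain ⟨τ, -, h⟩ := exists_T_upper
  have key : ∀ x, 0 < x → T g x ≤ 0 := fun x hx => by
    simpa using h g M hg hM ha 0 x le_rfl hx (by simpa using hx.le)
  rcases lt_trichotomy x 0 with hx | hx | hx
  · rw [← T_neg]; exact key _ (neg_pos.2 hx)
  · simp [hx, T]
  · exact key x hx

lemma integrableOn_comp_mul (hi : IntegrableOn g (Ioi 0)) (hx : 0 < x) :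
    IntegrableOn (fun t => g (x * t)) (Ioi 0) := by
  have := (integrableOn_Ioi_comp_mul_left_iff g 0 hx).2 (by simpa using hi)
  exact this

lemma integrableOn_mul_ell (hg : Continuous g) (hM : ∀ y, |g y| ≤ M)
    (hi : IntegrableOn g (Ioi 0)) (hx : 0 < x) :
    IntegrableOn (fun t => g (x * t) * (t * ell t)) (Ioi 0) := by
  have := (integrableOn_mul_ker hg hM x).add ((integrableOn_comp_mul hi hx).mul_const 2)
  refine this.congr (ae_of_all _ fun t => ?_)
  simp only [Pi.add_apply, ker]
  ring

/-- For integrable `g`, `T` differs by a constant from an operator with positive kernel. -/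
lemma T_add_eq (hg : Continuous g) (hM : ∀ y, |g y| ≤ M)
    (hi : IntegrableOn g (Ioi 0)) (hx : 0 < x) :
    T g x + 2 / Real.pi * ∫ y in Ioi (0 : ℝ), g y =
      x / Real.pi * ∫ t in Ioi (0 : ℝ), g (x * t) * (t * ell t) := by
  have h1 : ∫ y in Ioi (0 : ℝ), g y = x * ∫ t in Ioi (0 : ℝ), g (x * t) := by
    have := integral_comp_mul_left_Ioi g 0 hx
    rw [mul_zero, smul_eq_mul] at this
    rw [this]
    field_simp
  have h2 : ∫ t in Ioi (0 : ℝ), g (x * t) * (t * ell t) =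
      (∫ t in Ioi (0 : ℝ), g (x * t) * ker t) + (∫ t in Ioi (0 : ℝ), g (x * t)) * 2 := by
    rw [← integral_mul_const, ← integral_add (integrableOn_mul_ker hg hM x)
      ((integrableOn_comp_mul hi hx).mul_const 2)]
    congr 1
    ext t
    rw [ker]; ring
  rw [T_eq_of_pos g hx, h1, h2]
  ring

/-- Lower bound for the positive operator. -/
lemma T_add_lower (hg : Continuous g) (hM : ∀ y, |g y| ≤ M) (h0 : ∀ y, 0 ≤ g y)
    (hi : IntegrableOn g (Ioi 0)) (hx : 0 < x) {X : ℝ} (hX0 : 0 ≤ X) (hX : X ≤ max x 1) :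
    2 / (Real.pi * (1 + x ^ 2)) * ∫ y in (0 : ℝ)..X, g y * y ^ 2 ≤
      T g x + 2 / Real.pi * ∫ y in Ioi (0 : ℝ), g y := by
  rw [T_add_eq hg hM hi hx]
  have hXx : 0 ≤ X / x := by positivity
  have hii := integrableOn_mul_ell hg hM hi hx
  have hc : Continuous fun t => g (x * t) * (x * t) ^ 2 := by fun_prop
  have h1 : x * ∫ t in Ioc 0 (X / x), g (x * t) * (x * t) ^ 2 = ∫ y in (0 : ℝ)..X, g y * y ^ 2 := by
    rw [← intervalIntegral.integral_of_le hXx, ← smul_eq_mul x,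
      intervalIntegral.smul_integral_comp_mul_left (fun y => g y * y ^ 2), mul_zero]
    congr 1
    field_simp
  have h2 : ∫ t in Ioc 0 (X / x), 2 / (1 + x ^ 2) * (g (x * t) * (x * t) ^ 2) ≤
      ∫ t in Ioi (0 : ℝ), g (x * t) * (t * ell t) := by
    have hnn : ∀ t ∈ Ioi (0 : ℝ), 0 ≤ g (x * t) * (t * ell t) := fun t ht =>
      mul_nonneg (h0 _) (mul_nonneg (le_of_lt ht) (ell_nonneg (le_of_lt ht)))
    have hsub : Ioc 0 (X / x) ⊆ Ioi (0 : ℝ) := Ioc_subset_Ioi_self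
    refine le_trans ?_ (setIntegral_mono_set hii
      ((ae_restrict_iff' measurableSet_Ioi).2 (ae_of_all _ hnn))
      hsub.eventuallyLE)
    apply setIntegral_mono_ae_restrict
      ((hc.const_mul _).continuousOn.integrableOn_Icc.mono_set Ioc_subset_Icc_self)
      (hii.mono_set Ioc_subset_Ioi_self)
    have hne : ∀ᵐ t : ℝ, t ≠ 1 := by simp [ae_iff, measure_singleton]
    filter_upwards [ae_restrict_of_ae hne, ae_restrict_mem measurableSet_Ioc] with t ht1 ht
    have hxt : x * t ≤ X := by
      have := ht.2
      rw [le_div_iff₀ hx] at this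
      linarith
    have hgt := h0 (x * t)
    -- For `t < 1` use `t ell t ≥ 2 t²`. For `t > 1` use `t ell t ≥ 2`; then `x t ≤ X ≤ max x 1`
    -- forces `X ≤ 1`, so the left side is at most `2`.
    have key : 2 / (1 + x ^ 2) * (x * t) ^ 2 ≤ t * ell t := by
      rw [div_mul_eq_mul_div, div_le_iff₀ (by positivity)]
      rcases lt_or_gt_of_ne ht1 with h | h
      · have := two_mul_sq_le ht.1.le h
        nlinarith [sq_nonneg x, sq_nonneg t]
      · have h3 := two_le_mul_ell h
        have h4 : X ≤ 1 := by
          rcases le_max_iff.1 hX with h5 | h5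
          · nlinarith
          · exact h5
        have h5 : x * t ≤ 1 := hxt.trans h4
        have h6 : 0 ≤ x * t := by nlinarith [ht.1]
        have h7 : (x * t) ^ 2 ≤ 1 := by nlinarith
        nlinarith [sq_nonneg x]
    calc 2 / (1 + x ^ 2) * (g (x * t) * (x * t) ^ 2)
        = g (x * t) * (2 / (1 + x ^ 2) * (x * t) ^ 2) := by ring
      _ ≤ _ := mul_le_mul_of_nonneg_left key hgt
  rw [integral_const_mul] at h2
  have hpi := Real.pi_pos
  calc 2 / (Real.pi * (1 + x ^ 2)) * ∫ y in (0 : ℝ)..X, g y * y ^ 2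
      = x / Real.pi * (2 / (1 + x ^ 2) * ∫ t in Ioc 0 (X / x), g (x * t) * (x * t) ^ 2) := by
        rw [← h1]; field_simp
    _ ≤ _ := by gcongr

end Transform

/-! ### Profiles and the behaviour of `T f` at infinity. -/

/-- The properties of elements of `setD` that are used below. -/
structure IsProfile (f : ℝ → ℝ) : Prop where
  cont : Continuous f
  even : ∀ x, f (-x) = f x
  zero : f 0 = 1
  lower : ∀ x, 1 - x ^ 2 ≤ f x
  nonneg : ∀ x, 0 ≤ f x
  le_one : ∀ x, f x ≤ 1
  anti : AntitoneOn f (Ici 0)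
  cvx : ConvexOn ℝ (Ici 0) fun s => f (√s)
  nonconst : ∃ x, 0 < x ∧ f x < 1

/-- Only `nonconst` needs an argument: were `f` equal to `1` on `(0, ∞)`, its left derivative at
`1/2` would be `0`, not at most `-eta`. -/
lemma isProfile_of_mem {f : ℝ → ℝ} (hf : f ∈ setD) : IsProfile f := by
  obtain ⟨⟨hc, he, -⟩, h0, hb, ha, hcv, hd⟩ := hf
  refine ⟨hc, he, h0, fun x => (le_max_left _ _).trans (hb x).1,
    fun x => (le_max_right _ _).trans (hb x).1, fun x => (hb x).2, ha, hcv, ?_⟩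
  by_contra hcon
  push Not at hcon
  have h1 : ∀ x, 0 < x → f x = 1 := fun x hx => le_antisymm (hb x).2 (hcon x hx)
  have h2 : f =ᶠ[𝓝 (1 / 2)] fun _ => 1 := by
    filter_upwards [lt_mem_nhds (show (0 : ℝ) < 1 / 2 by norm_num)] with x hx
    exact h1 x hx
  have h3 : HasDerivAt f 0 (1 / 2) := (hasDerivAt_const _ _).congr_of_eventuallyEq h2
  have h4 : derivWithin f (Iio (1 / 2)) (1 / 2) = 0 := by
    by_cases hu : UniqueDiffWithinAt ℝ (Iio (1 / 2 : ℝ)) (1 / 2)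
    · exact h3.hasDerivWithinAt.derivWithin hu
    · exact derivWithin_zero_of_not_uniqueDiffWithinAt hu
  rw [h4] at hd
  have : 0 < eta := by unfold eta; positivity
  linarith

section Profile

variable {f : ℝ → ℝ}

lemma IsProfile.abs_le (hf : IsProfile f) (x : ℝ) : |f x| ≤ 1 := by
  rw [abs_of_nonneg (hf.nonneg x)]; exact hf.le_one x

lemma IsProfile.abs_arg (hf : IsProfile f) (x : ℝ) : f |x| = f x := by
  rcases abs_choice x with h | h
  · rw [h]
  · rw [h, hf.even]

lemma IsProfile.tendsto (hf : IsProfile f) : Tendsto f atTop (𝓝 (atInfinity f)) := by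
  have h1 : Antitone fun x => f (max x 0) := fun x y hxy =>
    hf.anti (mem_Ici.2 (le_max_right _ _)) (mem_Ici.2 (le_max_right _ _)) (max_le_max_right 0 hxy)
  have h2 := tendsto_atTop_ciInf h1 ⟨0, by rintro _ ⟨x, rfl⟩; exact hf.nonneg _⟩
  have h3 : Tendsto f atTop (𝓝 (⨅ x, f (max x 0))) := by
    refine h2.congr' ?_
    filter_upwards [eventually_ge_atTop 0] with x hx
    rw [max_eq_left hx]
  rw [atInfinity, h3.limUnder_eq]
  exact h3

lemma IsProfile.atInfinity_le (hf : IsProfile f) (x : ℝ) : atInfinity f ≤ f x := by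
  rw [← hf.abs_arg]
  apply le_of_tendsto hf.tendsto
  filter_upwards [eventually_ge_atTop |x|] with y hy
  exact hf.anti (abs_nonneg x) ((abs_nonneg x).trans hy) hy

lemma IsProfile.atInfinity_nonneg (hf : IsProfile f) : 0 ≤ atInfinity f :=
  ge_of_tendsto' hf.tendsto hf.nonneg

lemma IsProfile.atInfinity_lt_one (hf : IsProfile f) : atInfinity f < 1 := by
  obtain ⟨x, -, hx⟩ := hf.nonconst
  exact (hf.atInfinity_le x).trans_lt hx

lemma IsProfile.c_pos (hf : IsProfile f) : 0 < c f := by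
  have hnn : ∀ y, 0 ≤ (f 0 - f y) / y ^ 2 := fun y => by
    rw [hf.zero]
    exact div_nonneg (by linarith [hf.le_one y]) (sq_nonneg y)
  have hm : Measurable fun y => (f 0 - f y) / y ^ 2 := by
    have := hf.cont.measurable
    fun_prop
  have hi : IntegrableOn (fun y => (f 0 - f y) / y ^ 2) (Ioi 0) := by
    rw [← Ioc_union_Ioi_eq_Ioi zero_le_one]
    apply IntegrableOn.union
    -- Near `0` the bound `1 - y² ≤ f y` keeps the quotient at most `1`; beyond `1` it is at most
    -- `y⁻²`.
    · apply Measure.integrableOn_of_bounded (M := 1) (by simp) hm.aestronglyMeasurable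
      refine ae_of_all _ fun y => ?_
      rw [Real.norm_eq_abs, abs_of_nonneg (hnn y), hf.zero]
      apply div_le_one_of_le₀ _ (sq_nonneg y)
      linarith [hf.lower y]
    · have h2 := integrableOn_Ioi_rpow_of_lt (show (-2 : ℝ) < -1 by norm_num) one_pos
      refine Integrable.mono' h2 hm.aestronglyMeasurable ?_
      filter_upwards [ae_restrict_mem measurableSet_Ioi] with y hy
      have hy0 : (0 : ℝ) < y := zero_lt_one.trans hy
      rw [Real.norm_eq_abs, abs_of_nonneg (hnn y), hf.zero, Real.rpow_neg hy0.le, div_eq_mul_inv]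
      norm_cast
      have : 0 ≤ (y ^ 2)⁻¹ := by positivity
      have := hf.nonneg y
      nlinarith
  rw [c]
  have hpi := Real.pi_pos
  apply mul_pos (by positivity)
  rw [setIntegral_pos_iff_support_of_nonneg_ae (ae_of_all _ hnn) hi]
  obtain ⟨x, hx0, hx⟩ := hf.nonconst
  have hsub : Ioi x ⊆ Function.support (fun y => (f 0 - f y) / y ^ 2) ∩ Ioi 0 := by
    intro y hy
    have hy' : x < y := hy
    have hy0 : 0 < y := hx0.trans hy'
    have := hf.anti hx0.le hy0.le hy'.le
    refine ⟨?_, hy0⟩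
    rw [Function.mem_support, hf.zero]
    have : 0 < 1 - f y := by linarith
    positivity
  exact lt_of_lt_of_le (by simp) (measure_mono hsub)

/-- The decaying part of a profile. -/
noncomputable def dec (f : ℝ → ℝ) (x : ℝ) : ℝ := f x - atInfinity f

lemma IsProfile.dec_cont (hf : IsProfile f) : Continuous (dec f) :=
  hf.cont.sub continuous_const

lemma IsProfile.dec_nonneg (hf : IsProfile f) (x : ℝ) : 0 ≤ dec f x :=
  sub_nonneg.2 (hf.atInfinity_le x)

lemma IsProfile.dec_abs_le (hf : IsProfile f) (x : ℝ) : |dec f x| ≤ 1 := by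
  rw [abs_of_nonneg (hf.dec_nonneg x), dec]
  linarith [hf.le_one x, hf.atInfinity_nonneg]

lemma IsProfile.T_dec (hf : IsProfile f) (x : ℝ) : T (dec f) x = T f x :=
  T_sub_const hf.cont hf.abs_le _ x

lemma IsProfile.b_ne_top (hf : IsProfile f) (hi : IntegrableOn (dec f) (Ioi 0)) : b f ≠ ⊤ := by
  rw [b]
  apply ENNReal.mul_ne_top ENNReal.ofReal_ne_top
  have := hi.2
  rw [hasFiniteIntegral_iff_ofReal (ae_of_all _ hf.dec_nonneg)] at this
  exact this.ne

lemma IsProfile.b_toReal (hf : IsProfile f) :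
    (b f).toReal = 2 / Real.pi * ∫ y in Ioi (0 : ℝ), dec f y := by
  have hpi := Real.pi_pos
  rw [b, ENNReal.toReal_mul, ENNReal.toReal_ofReal (by positivity),
    integral_eq_lintegral_of_nonneg_ae (ae_of_all _ hf.dec_nonneg)
      hf.dec_cont.aestronglyMeasurable]
  rfl

lemma IsProfile.integral_dec_pos (hf : IsProfile f) {X : ℝ} (hX : 0 < X) :
    0 < ∫ y in (0 : ℝ)..X, dec f y * y ^ 2 := by
  have hd0 : 0 < dec f 0 := by rw [dec, hf.zero]; linarith [hf.atInfinity_lt_one]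
  obtain ⟨δ, hδ, hball⟩ := Metric.eventually_nhds_iff_ball.1
    (hf.dec_cont.continuousAt.eventually (lt_mem_nhds hd0))
  have hc : Continuous fun y => dec f y * y ^ 2 := hf.dec_cont.mul (by fun_prop)
  apply intervalIntegral.integral_pos hX hc.continuousOn
  · exact fun y _ => mul_nonneg (hf.dec_nonneg y) (sq_nonneg y)
  · refine ⟨min X (δ / 2), ⟨by positivity, min_le_left _ _⟩, ?_⟩
    apply mul_pos _ (by positivity)
    apply hball
    rw [Metric.mem_ball, Real.dist_eq, sub_zero, abs_of_nonneg (by positivity)]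
    exact (min_le_right _ _).trans_lt (by linarith)

/-- Asymptotic upper bound for `T f`. -/
lemma IsProfile.eventually_T_le (hf : IsProfile f) {X A : ℝ} (hX : 0 ≤ X)
    (hA : A < 2 / Real.pi * ∫ y in (0 : ℝ)..X, dec f y) : ∀ᶠ x in atTop, T f x ≤ -A := by
  obtain ⟨τ, hτ, h⟩ := exists_T_upper
  have h1 : Tendsto (fun x => 1 / Real.pi * ((2 - 2 * (X / x)) *
      ((∫ y in (0 : ℝ)..X, f y) - X * f (τ * x)))) atTop
      (𝓝 (1 / Real.pi * ((2 - 2 * 0) * ((∫ y in (0 : ℝ)..X, f y) - X * atInfinity f)))) := by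
    have e1 : Tendsto (fun x : ℝ => X / x) atTop (𝓝 0) := tendsto_const_nhds.div_atTop tendsto_id
    have e2 : Tendsto (fun x => f (τ * x)) atTop (𝓝 (atInfinity f)) :=
      hf.tendsto.comp (tendsto_id.const_mul_atTop hτ)
    exact ((tendsto_const_nhds.sub (e1.const_mul 2)).mul
      (tendsto_const_nhds.sub (e2.const_mul X))).const_mul _
  have h2 : 2 / Real.pi * ∫ y in (0 : ℝ)..X, dec f y =
      1 / Real.pi * ((2 - 2 * 0) * ((∫ y in (0 : ℝ)..X, f y) - X * atInfinity f)) := by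
    simp only [dec]
    rw [intervalIntegral.integral_sub (hf.cont.intervalIntegrable _ _) intervalIntegrable_const,
      intervalIntegral.integral_const, smul_eq_mul]
    ring
  rw [h2] at hA
  filter_upwards [h1.eventually (lt_mem_nhds hA), eventually_gt_atTop 0,
    eventually_ge_atTop (2 * X)] with x hx hx0 hxX
  have := h f 1 hf.cont hf.abs_le hf.anti X x hX hx0 hxX
  linarith

/-- If `T f ≤ -A` fails at arbitrarily large points, then by `IsProfile.eventually_T_le` the
truncated integrals of `dec f` are bounded, and `dec f` is integrable. -/
lemma IsProfile.eventually_T_le_of_not_integrable (hf : IsProfile f)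
    (hi : ¬ IntegrableOn (dec f) (Ioi 0)) (A : ℝ) : ∀ᶠ x in atTop, T f x ≤ -A := by
  by_contra hcon
  apply hi
  have hb : ∀ X, 0 ≤ X → ∫ y in (0 : ℝ)..X, ‖dec f y‖ ≤ Real.pi / 2 * A := by
    intro X hX
    by_contra h
    apply hcon
    apply hf.eventually_T_le hX
    rw [not_le] at h
    have hpi := Real.pi_pos
    have e : ∀ y, ‖dec f y‖ = dec f y := fun y => by
      rw [Real.norm_eq_abs, abs_of_nonneg (hf.dec_nonneg y)]
    simp only [e] at h
    calc A = 2 / Real.pi * (Real.pi / 2 * A) := by field_simp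
      _ < _ := by gcongr
  exact integrableOn_Ioi_of_intervalIntegral_norm_bounded (Real.pi / 2 * A) 0
    (fun X => (hf.dec_cont.continuousOn.integrableOn_Icc (a := 0) (b := X)).mono_set
      Ioc_subset_Icc_self) tendsto_id ((eventually_ge_atTop 0).mono hb)

lemma IsProfile.T_add_b_lower (hf : IsProfile f) (hi : IntegrableOn (dec f) (Ioi 0)) (x : ℝ) :
    2 / (Real.pi * (1 + x ^ 2)) * (∫ y in (0 : ℝ)..1, dec f y * y ^ 2) ≤ T f x + (b f).toReal := by
  have key : ∀ x, 0 < x → 2 / (Real.pi * (1 + x ^ 2)) * (∫ y in (0 : ℝ)..1, dec f y * y ^ 2) ≤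
      T f x + (b f).toReal := by
    intro x hx
    rw [hf.b_toReal, ← hf.T_dec]
    exact T_add_lower hf.dec_cont hf.dec_abs_le hf.dec_nonneg hi hx zero_le_one (le_max_right _ _)
  rcases lt_trichotomy x 0 with h | h | h
  · rw [← T_neg, ← neg_sq x]; exact key _ (neg_pos.2 h)
  · subst h
    have hc : Continuous fun x : ℝ =>
        2 / (Real.pi * (1 + x ^ 2)) * (∫ y in (0 : ℝ)..1, dec f y * y ^ 2) := by
      apply Continuous.mul _ continuous_const
      apply Continuous.div continuous_const (by fun_prop)
      intro x
      have := Real.pi_pos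
      positivity
    have hT := (continuous_T hf.cont hf.abs_le).add_const (b f).toReal
    refine le_of_tendsto_of_tendsto (b := 𝓝[>] (0 : ℝ)) (hc.continuousAt.tendsto.mono_left inf_le_left)
      (hT.continuousAt.tendsto.mono_left inf_le_left) ?_
    filter_upwards [self_mem_nhdsWithin] with x hx
    exact key x hx
  · exact key x h

lemma IsProfile.T_add_b_pos (hf : IsProfile f) (hi : IntegrableOn (dec f) (Ioi 0)) (x : ℝ) :
    0 < T f x + (b f).toReal := by
  refine lt_of_lt_of_le ?_ (hf.T_add_b_lower hi x)
  have := Real.pi_pos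
  have := hf.integral_dec_pos one_pos
  positivity

lemma IsProfile.b_pos (hf : IsProfile f) (hi : IntegrableOn (dec f) (Ioi 0)) :
    0 < (b f).toReal := by
  have := hf.T_add_b_pos hi 0
  simpa [T] using this

/-- The lower bound `T f > -b` holds everywhere. The upper bound is `IsProfile.eventually_T_le` with
`X` so large that the truncated integral is close to `b`. -/
lemma IsProfile.tendsto_T (hf : IsProfile f) (hi : IntegrableOn (dec f) (Ioi 0)) :
    Tendsto (T f) atTop (𝓝 (-(b f).toReal)) := by
  rw [tendsto_order]
  constructor
  · intro A hA
    refine Eventually.of_forall fun x => ?_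
    linarith [hf.T_add_b_pos hi x]
  · intro A hA
    obtain ⟨A', hA1, hA2⟩ := exists_between hA
    have h1 : Tendsto (fun X => 2 / Real.pi * ∫ y in (0 : ℝ)..X, dec f y) atTop
        (𝓝 (b f).toReal) := by
      rw [hf.b_toReal]
      exact (intervalIntegral_tendsto_integral_Ioi 0 hi tendsto_id).const_mul _
    obtain ⟨X, hX, hX0⟩ := ((h1.eventually (lt_mem_nhds (show -A' < (b f).toReal by linarith))).and
      (eventually_ge_atTop 0)).exists
    filter_upwards [hf.eventually_T_le hX0 hX] with x hx
    linarith

end Profile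

/-! ### The fixed point equation and finiteness of `b`. -/

/-- The normalising constant in `T_a`. -/
noncomputable def cst (a : ℝ) (f : ℝ → ℝ) : ℝ := 2 / ((1 - a / 3) * c f)

/-- `T_a(f)` before taking the positive part. -/
noncomputable def theta (a : ℝ) (f : ℝ → ℝ) (x : ℝ) : ℝ := 1 + a * cst a f * T f x

/-- The integrand in the exponent of `R_a(f)` where `theta` is positive. -/
noncomputable def expo (a : ℝ) (f : ℝ → ℝ) (y : ℝ) : ℝ :=
  (1 - a) * cst a f * (T f y / y) / theta a f y

/-- The prefactor in `R_a(f)` where `theta` is positive. -/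
noncomputable def pref (a : ℝ) (f : ℝ → ℝ) (x : ℝ) : ℝ :=
  if a = 0 then Real.exp (cst a f * T f x) else theta a f x ^ (1 / a)

section Fixed

variable {f : ℝ → ℝ} {a x : ℝ}

lemma IsProfile.cst_pos (hf : IsProfile f) (ha : a ≤ 1) : 0 < cst a f := by
  have := hf.c_pos
  have : 0 < 1 - a / 3 := by linarith
  unfold cst; positivity

lemma Ta_eq (a : ℝ) (f : ℝ → ℝ) (x : ℝ) : Ta a f x = max (theta a f x) 0 := by
  rw [Ta, theta, cst]
  congr 2
  ring

lemma IsProfile.continuous_theta (hf : IsProfile f) : Continuous (theta a f) := by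
  have := continuous_T hf.cont hf.abs_le
  unfold theta
  fun_prop

lemma theta_at_zero (a : ℝ) (f : ℝ → ℝ) : theta a f 0 = 1 := by
  simp [theta, T]

/-- The fixed point equation where `theta` is positive. -/
lemma fixed_formula (hfix : R a f = f) (hpos : ∀ y ∈ uIcc 0 x, 0 < theta a f y) :
    f x = pref a f x * Real.exp (∫ y in (0 : ℝ)..x, expo a f y) := by
  conv_lhs => rw [← hfix]
  rw [R]
  by_cases ha : a = 0
  · subst ha
    rw [if_pos rfl, pref, if_pos rfl, ← Real.exp_add, cst]
    congr 1
    rw [mul_add]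
    congr 1
    · simp
    · rw [← intervalIntegral.integral_const_mul]
      apply intervalIntegral.integral_congr
      intro y _
      simp [expo, theta, cst]
  · rw [if_neg ha, pref, if_neg ha]
    have hT : ∀ y ∈ uIcc 0 x, Ta a f y = theta a f y := fun y hy => by
      rw [Ta_eq, max_eq_left (hpos y hy).le]
    rw [hT x right_mem_uIcc, ← intervalIntegral.integral_const_mul]
    congr 2
    apply intervalIntegral.integral_congr
    intro y hy
    have h1 := (hpos y hy).ne'
    simp only
    rw [hT y hy, hT 0 left_mem_uIcc, theta_at_zero, expo]
    have h2 : theta a f y - 1 = a * cst a f * T f y := by rw [theta]; ring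
    rw [h2]
    by_cases hy0 : y = 0
    · simp [hy0]
    · field_simp

/-- `abs_T_le` bounds `T f y / y` up to the origin, and `theta` is bounded away from zero on the
compact interval. -/
lemma IsProfile.expo_intervalIntegrable (hf : IsProfile f) 
    (hpos : ∀ y ∈ uIcc 0 x, 0 < theta a f y) : IntervalIntegrable (expo a f) volume 0 x := by
  have hTc := continuous_T hf.cont hf.abs_le
  have hθc := hf.continuous_theta (a := a)
  obtain ⟨B, hB⟩ := (isCompact_uIcc (a := (0 : ℝ)) (b := x)).exists_bound_of_continuousOn
    (f := fun y => (theta a f y)⁻¹) (hθc.continuousOn.inv₀ fun y hy => (hpos y hy).ne')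
  set K := 1 / Real.pi * ∫ t in Ioi (0 : ℝ), |ker t| with hK
  have hTK : ∀ y, |T f y / y| ≤ K := by
    intro y
    have := abs_T_le hf.abs_le y
    rw [abs_div]
    by_cases hy : y = 0
    · subst hy
      rw [abs_zero, div_zero]
      have : 0 ≤ ∫ t in Ioi (0 : ℝ), |ker t| := integral_nonneg fun _ => abs_nonneg _
      have := Real.pi_pos
      positivity
    · rw [div_le_iff₀ (abs_pos.2 hy), mul_comm]
      exact this
  rw [intervalIntegrable_iff]
  apply Measure.integrableOn_of_bounded (M := |(1 - a) * cst a f| * K * B) (by simp)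
  · have := hTc.measurable
    have := hθc.measurable
    have : Measurable (expo a f) := by unfold expo; fun_prop
    exact this.aestronglyMeasurable
  · filter_upwards [ae_restrict_mem measurableSet_uIoc] with y hy
    have h1 := hB y (uIoc_subset_uIcc hy)
    rw [expo, Real.norm_eq_abs, div_eq_mul_inv, abs_mul, abs_mul]
    rw [Real.norm_eq_abs] at h1
    have hK0 : 0 ≤ K := (abs_nonneg _).trans (hTK y)
    gcongr
    exact hTK y

/-- Since `T f ≤ 0`, the base `theta` is at least `1` when `1 / a` is negative and at most `1` when
it is positive. -/
lemma IsProfile.pref_le_one (hf : IsProfile f) (ha : a ≤ 1) (hx : 0 < theta a f x) :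
    pref a f x ≤ 1 := by
  have hT := T_nonpos hf.cont hf.abs_le hf.anti x
  have hC := hf.cst_pos ha
  have hCT : cst a f * T f x ≤ 0 := mul_nonpos_of_nonneg_of_nonpos hC.le hT
  rw [pref]
  split_ifs with h
  · exact Real.exp_le_one_iff.2 hCT
  · rcases lt_or_gt_of_ne h with h0 | h0
    · apply Real.rpow_le_one_of_one_le_of_nonpos
      · rw [theta]; nlinarith
      · exact (one_div_neg.2 h0).le
    · apply Real.rpow_le_one hx.le
      · rw [theta]; nlinarith
      · positivity

lemma pref_pos (hx : 0 < theta a f x) : 0 < pref a f x := by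
  rw [pref]
  split_ifs
  · exact Real.exp_pos _
  · exact Real.rpow_pos_of_pos hx _

lemma fixed_pos (hfix : R a f = f) (hpos : ∀ y ∈ uIcc 0 x, 0 < theta a f y) : 0 < f x := by
  rw [fixed_formula hfix hpos]
  exact mul_pos (pref_pos (hpos x right_mem_uIcc)) (Real.exp_pos _)

lemma IsProfile.expo_nonpos (hf : IsProfile f) (ha : a ≤ 1) (hx : 0 ≤ x)
    (hpos : 0 < theta a f x) : expo a f x ≤ 0 := by
  have hT := T_nonpos hf.cont hf.abs_le hf.anti x
  have hC := hf.cst_pos ha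
  rw [expo]
  apply div_nonpos_of_nonpos_of_nonneg _ hpos.le
  apply mul_nonpos_of_nonneg_of_nonpos (mul_nonneg (by linarith) hC.le)
  exact div_nonpos_of_nonpos_of_nonneg hT hx

/-- A logarithmic bound on the exponent gives algebraic decay. -/
lemma IsProfile.fixed_le_rpow (hf : IsProfile f) (ha : a ≤ 1) (hfix : R a f = f)
    (hpos : ∀ y, 0 < theta a f y) {ν X₀ : ℝ} (hX₀ : 0 < X₀)
    (hν : ∀ y, X₀ ≤ y → expo a f y ≤ -ν * y⁻¹) {x : ℝ} (hx : X₀ ≤ x) :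
    f x ≤ X₀ ^ ν * x ^ (-ν) := by
  have hx0 : 0 < x := hX₀.trans_le hx
  have hi : ∀ z, IntervalIntegrable (expo a f) volume 0 z := fun z =>
    hf.expo_intervalIntegrable fun y _ => hpos y
  have h1 : ∫ y in (0 : ℝ)..x, expo a f y ≤ -ν * Real.log (x / X₀) := by
    rw [← intervalIntegral.integral_add_adjacent_intervals (hi X₀) ((hi X₀).symm.trans (hi x))]
    have e1 : ∫ y in (0 : ℝ)..X₀, expo a f y ≤ 0 := by
      have := intervalIntegral.integral_mono_on hX₀.le (hi X₀)
        (intervalIntegrable_const (c := (0 : ℝ))) fun y hy => hf.expo_nonpos ha hy.1 (hpos y)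
      simpa using this
    have e2 : ∫ y in X₀..x, expo a f y ≤ ∫ y in X₀..x, -ν * y⁻¹ := by
      apply intervalIntegral.integral_mono_on hx ((hi X₀).symm.trans (hi x))
      · apply ContinuousOn.intervalIntegrable_of_Icc hx
        apply continuousOn_const.mul
        exact continuousOn_inv₀.mono fun y hy => (hX₀.trans_le hy.1).ne'
      · exact fun y hy => hν y hy.1
    rw [intervalIntegral.integral_const_mul, integral_inv_of_pos hX₀ hx0] at e2
    linarith
  rw [fixed_formula hfix fun y _ => hpos y]
  calc pref a f x * Real.exp (∫ y in (0 : ℝ)..x, expo a f y)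
      ≤ 1 * Real.exp (-ν * Real.log (x / X₀)) :=
        mul_le_mul (hf.pref_le_one ha (hpos x)) (Real.exp_le_exp.2 h1) (Real.exp_pos _).le one_pos.le
    _ = (x / X₀) ^ (-ν) := by
        rw [one_mul, Real.rpow_def_of_pos (by positivity), mul_comm]
    _ = X₀ ^ ν * x ^ (-ν) := by
        rw [Real.div_rpow hx0.le hX₀.le, Real.rpow_neg hX₀.le, div_inv_eq_mul, mul_comm]

/-- For `a ≠ 0` the power `0 ^ (1 / a)` is `0` whatever the sign of `a`, so `f` vanishes wherever
the positive part cuts off `theta`. -/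
lemma fixed_zero (hfix : R a f = f) (ha : a ≠ 0) (hx : theta a f x ≤ 0) : f x = 0 := by
  rw [← hfix, R, if_neg ha, Ta_eq, max_eq_right hx, Real.zero_rpow (one_div_ne_zero ha), zero_mul]

lemma IsProfile.vanish_of_ge (hf : IsProfile f) (hx : 0 ≤ x) (h0 : f x = 0) {y : ℝ} (hy : x ≤ y) :
    f y = 0 :=
  le_antisymm (h0 ▸ hf.anti hx (hx.trans hy) hy) (hf.nonneg y)

lemma IsProfile.integrable_of_vanish (hf : IsProfile f) (hx : 0 ≤ x) (h0 : f x = 0) :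
    atInfinity f = 0 ∧ IntegrableOn (dec f) (Ioi 0) := by
  have h1 : atInfinity f = 0 := le_antisymm (h0 ▸ hf.atInfinity_le x) hf.atInfinity_nonneg
  refine ⟨h1, ?_⟩
  rw [← Ioc_union_Ioi_eq_Ioi hx]
  apply IntegrableOn.union
  · exact hf.dec_cont.continuousOn.integrableOn_Icc.mono_set Ioc_subset_Icc_self
  · refine IntegrableOn.congr_fun (f := fun _ => (0 : ℝ)) (by simp) (fun y hy => ?_)
      measurableSet_Ioi
    have hy' : x < y := hy
    simp [dec, h1, hf.vanish_of_ge hx h0 hy'.le]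

lemma IsProfile.theta_ge_one (hf : IsProfile f) (ha : a ≤ 0) (x : ℝ) : 1 ≤ theta a f x := by
  have hT := T_nonpos hf.cont hf.abs_le hf.anti x
  have hC := hf.cst_pos (a := a) (by linarith)
  have : cst a f * T f x ≤ 0 := mul_nonpos_of_nonneg_of_nonpos hC.le hT
  rw [theta]; nlinarith

lemma IsProfile.atInfinity_of_le_rpow (hf : IsProfile f) {K ν X₀ : ℝ} (hν : 0 < ν)
    (h : ∀ x, X₀ ≤ x → f x ≤ K * x ^ (-ν)) : atInfinity f = 0 := by
  refine le_antisymm ?_ hf.atInfinity_nonneg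
  have h1 : Tendsto (fun x : ℝ => K * x ^ (-ν)) atTop (𝓝 (K * 0)) :=
    (tendsto_rpow_neg_atTop hν).const_mul K
  rw [mul_zero] at h1
  exact le_of_tendsto_of_tendsto hf.tendsto h1 ((eventually_ge_atTop X₀).mono h)

/-- For a fixed point the integral defining `b` converges. -/
theorem IsProfile.fixed_integrable (hf : IsProfile f) (ha : a ≤ 1) (hfix : R a f = f) :
    IntegrableOn (dec f) (Ioi 0) := by
  by_contra hi
  have hT := hf.eventually_T_le_of_not_integrable hi
  have hC := hf.cst_pos ha
  rcases le_or_gt a 0 with ha0 | ha0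
  -- With `u = C T f`, the wanted bound `(1 - a) u ≤ -s₀ (1 + a u)` reads `(1 - a + s₀ a) u ≤ -s₀`.
  -- The choice of `s₀ > 1` keeps the coefficient at least `1/2`, so `u ≤ -2 s₀` suffices, and `x ^
  -- (-s₀)` is integrable at infinity.
  · set s₀ : ℝ := 1 + 1 / (2 * (1 - a)) with hs₀
    have h1a : 0 < 1 - a := by linarith
    have hs1 : 1 < s₀ := by rw [hs₀]; have : 0 < 1 / (2 * (1 - a)) := by positivity
                            linarith
    have hs2 : 1 - a + s₀ * a ≥ 1 / 2 := by
      have e : 1 - a + s₀ * a = 1 + a / (2 * (1 - a)) := by rw [hs₀]; ring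
      have : -(1 / 2) ≤ a / (2 * (1 - a)) := by
        rw [le_div_iff₀ (by positivity)]; linarith
      rw [e]; linarith
    have hpos : ∀ y, 0 < theta a f y := fun y => one_pos.trans_le (hf.theta_ge_one ha0 y)
    obtain ⟨X₀, hX⟩ := ((hT (2 * s₀ / cst a f)).and
      (eventually_gt_atTop 0)).exists_forall_of_atTop
    have hX₀ := fun y hy => (hX y hy).1
    have hX1 : 0 < X₀ := (hX X₀ le_rfl).2
    have hexp : ∀ y, X₀ ≤ y → expo a f y ≤ -s₀ * y⁻¹ := by
      intro y hy
      have hy0 : 0 < y := hX1.trans_le hy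
      have h2 := hX₀ y hy
      have h3 : cst a f * T f y ≤ -(2 * s₀) := by
        have := mul_le_mul_of_nonneg_left h2 hC.le
        have e : cst a f * -(2 * s₀ / cst a f) = -(2 * s₀) := by field_simp
        linarith
      have h4 : (1 - a) * (cst a f * T f y) ≤ -s₀ * theta a f y := by
        rw [theta]
        nlinarith
      rw [expo]
      have e : (1 - a) * cst a f * (T f y / y) / theta a f y =
          ((1 - a) * (cst a f * T f y)) / theta a f y * y⁻¹ := by
        field_simp
      rw [e]
      apply mul_le_mul_of_nonneg_right _ (inv_nonneg.2 hy0.le)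
      rw [div_le_iff₀ (hpos y)]
      exact h4
    have hdecay := fun x (hx : X₀ ≤ x) => hf.fixed_le_rpow ha hfix hpos hX1 hexp hx
    have hinf := hf.atInfinity_of_le_rpow (by linarith : 0 < s₀) hdecay
    apply hi
    rw [← Ioc_union_Ioi_eq_Ioi hX1.le]
    apply IntegrableOn.union
    · exact hf.dec_cont.continuousOn.integrableOn_Icc.mono_set Ioc_subset_Icc_self
    · have h5 := (integrableOn_Ioi_rpow_of_lt (show -s₀ < -1 by linarith) hX1).const_mul (X₀ ^ s₀)
      refine Integrable.mono' h5 hf.dec_cont.aestronglyMeasurable ?_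
      filter_upwards [ae_restrict_mem measurableSet_Ioi] with y hy
      have hy' : X₀ < y := hy
      rw [Real.norm_eq_abs, abs_of_nonneg (hf.dec_nonneg y), dec, hinf, sub_zero]
      exact hdecay y hy'.le
  -- For `a > 0` the divergence of `T f` makes `theta` nonpositive somewhere, and `f` vanishes from
  -- there on.
  · obtain ⟨x, hx, hx0⟩ := ((hT (1 / (a * cst a f))).and (eventually_ge_atTop 0)).exists
    apply hi
    refine (hf.integrable_of_vanish hx0 (fixed_zero hfix ha0.ne' ?_)).2
    have := mul_le_mul_of_nonneg_left hx (mul_pos ha0 hC).le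
    have e : a * cst a f * -(1 / (a * cst a f)) = -1 := by field_simp
    rw [theta]
    linarith

end Fixed

/-! ### The dichotomy on the limit of `theta`; decay and support. -/

section Cases

variable {f : ℝ → ℝ} {a x : ℝ}

/-- The limit of `theta` at infinity. -/
noncomputable def thetaInf (a : ℝ) (f : ℝ → ℝ) : ℝ := 1 - a * cst a f * (b f).toReal

lemma theta_eq_thetaInf_add (a : ℝ) (f : ℝ → ℝ) (x : ℝ) :
    theta a f x = thetaInf a f + a * cst a f * (T f x + (b f).toReal) := by
  rw [theta, thetaInf]; ring

/-- Unfolding the constants, `thetaInf = (1 - a/3 - 2 a k) / (1 - a/3)` with a positive denominator.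
-/
lemma IsProfile.k_le_iff (hf : IsProfile f) (ha : a ≤ 1) :
    2 * a * k f ≤ 1 - a / 3 ↔ 0 ≤ thetaInf a f := by
  have hc := hf.c_pos
  have h1 : 0 < 1 - a / 3 := by linarith
  have e : thetaInf a f = (1 - a / 3 - 2 * a * k f) / (1 - a / 3) := by
    rw [thetaInf, cst, k]
    have h3 : 3 - a ≠ 0 := by linarith
    field_simp
  rw [e, le_div_iff₀ h1, zero_mul, sub_nonneg]

lemma IsProfile.theta_ge_thetaInf (hf : IsProfile f) (ha : a ≤ 1)
    (hi : IntegrableOn (dec f) (Ioi 0)) (ha0 : 0 ≤ a) (x : ℝ) : thetaInf a f ≤ theta a f x := by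
  rw [theta_eq_thetaInf_add]
  have := hf.cst_pos ha
  have := hf.T_add_b_pos hi x
  have : 0 ≤ a * cst a f * (T f x + (b f).toReal) := by positivity
  linarith

lemma IsProfile.theta_pos (hf : IsProfile f) (ha : a ≤ 1)
    (hi : IntegrableOn (dec f) (Ioi 0)) (h : 0 ≤ thetaInf a f) (x : ℝ) : 0 < theta a f x := by
  rcases le_or_gt a 0 with ha0 | ha0
  · exact one_pos.trans_le (hf.theta_ge_one ha0 x)
  · rw [theta_eq_thetaInf_add]
    have := hf.cst_pos ha
    have := hf.T_add_b_pos hi x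
    positivity

lemma IsProfile.theta_lower (hf : IsProfile f) (ha : a ≤ 1)
    (hi : IntegrableOn (dec f) (Ioi 0)) (h : 0 < thetaInf a f) :
    ∃ δ > 0, ∀ x, δ ≤ theta a f x := by
  rcases le_or_gt a 0 with ha0 | ha0
  · exact ⟨1, one_pos, hf.theta_ge_one ha0⟩
  · exact ⟨_, h, hf.theta_ge_thetaInf ha hi ha0.le⟩

/-- Here `theta = a C (T f + b)`, and the positive operator decays at most like `1 / (1 + x²)`.
Moreover `a > 0`, since `thetaInf ≥ 1` for `a ≤ 0`. -/
lemma IsProfile.theta_lower_critical (hf : IsProfile f) (ha : a ≤ 1)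
    (hi : IntegrableOn (dec f) (Ioi 0)) (h : thetaInf a f = 0) :
    ∃ δ > 0, ∀ x, δ / (1 + x ^ 2) ≤ theta a f x := by
  have ha0 : 0 < a := by
    by_contra hcon
    have h1 : 0 ≤ cst a f * (b f).toReal :=
      mul_nonneg (hf.cst_pos ha).le ENNReal.toReal_nonneg
    rw [thetaInf] at h
    nlinarith
  have hC := hf.cst_pos ha
  have hp := hf.integral_dec_pos one_pos
  have hpi := Real.pi_pos
  refine ⟨a * cst a f * (2 / Real.pi * ∫ y in (0 : ℝ)..1, dec f y * y ^ 2), by positivity,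
    fun x => ?_⟩
  rw [theta_eq_thetaInf_add, h, zero_add]
  calc _ = a * cst a f * (2 / (Real.pi * (1 + x ^ 2)) * (∫ y in (0 : ℝ)..1, dec f y * y ^ 2)) := by
        field_simp
    _ ≤ _ := mul_le_mul_of_nonneg_left (hf.T_add_b_lower hi x) (by positivity)

lemma IsProfile.tendsto_theta (hf : IsProfile f) (hi : IntegrableOn (dec f) (Ioi 0)) (a : ℝ) :
    Tendsto (theta a f) atTop (𝓝 (thetaInf a f)) := by
  unfold theta thetaInf
  have := ((hf.tendsto_T hi).const_mul (a * cst a f)).const_add 1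
  rwa [mul_neg, ← sub_eq_add_neg] at this

/-- At `a = 1` a positive fixed point would decay no faster than `1 / x`. -/
lemma IsProfile.ne_one (hf : IsProfile f) (hfix : R 1 f = f) (hi : IntegrableOn (dec f) (Ioi 0))
    (h : 0 ≤ thetaInf 1 f) : False := by
  have hpos := hf.theta_pos le_rfl hi h
  have hC := hf.cst_pos (a := 1) le_rfl
  -- At `a = 1` the exponent vanishes and the outer power is `1`, so `dec f` is a multiple of the
  -- positive operator applied to itself.
  have hform : ∀ x, f x = theta 1 f x := by
    intro x
    rw [fixed_formula hfix fun y _ => hpos y, pref, if_neg one_ne_zero]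
    simp [expo]
  have hlim : Tendsto f atTop (𝓝 (thetaInf 1 f)) :=
    (hf.tendsto_theta hi 1).congr fun x => (hform x).symm
  have hinf : atInfinity f = thetaInf 1 f := tendsto_nhds_unique hf.tendsto hlim
  have hdec : ∀ x, dec f x = cst 1 f * (T f x + (b f).toReal) := by
    intro x
    rw [dec, hinf, hform, theta_eq_thetaInf_add]; ring
  have hpi := Real.pi_pos
  have hbound : ∀ x X, 0 < x → 0 ≤ X → X ≤ max x 1 →
      cst 1 f * (2 / (Real.pi * (1 + x ^ 2)) * ∫ y in (0 : ℝ)..X, dec f y * y ^ 2) ≤ dec f x := by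
    intro x X hx hX0 hX
    rw [hdec x]
    apply mul_le_mul_of_nonneg_left _ hC.le
    rw [hf.b_toReal, ← hf.T_dec]
    exact T_add_lower hf.dec_cont hf.dec_abs_le hf.dec_nonneg hi hx hX0 hX
  set I := ∫ y in (0 : ℝ)..1, dec f y * y ^ 2 with hI
  have hIpos : 0 < I := hf.integral_dec_pos one_pos
  set c₁ := cst 1 f * I / Real.pi with hc₁
  have hc₁p : 0 < c₁ := by positivity
  have hstep : ∀ x, 1 ≤ x → ∀ J, 0 ≤ J → cst 1 f * J / Real.pi / x ^ 2 ≤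
      cst 1 f * (2 / (Real.pi * (1 + x ^ 2)) * J) := by
    intro x hx J hJ
    have e1 : cst 1 f * J / Real.pi / x ^ 2 = cst 1 f * J / Real.pi * (1 / x ^ 2) := by ring
    have e2 : cst 1 f * (2 / (Real.pi * (1 + x ^ 2)) * J) =
        cst 1 f * J / Real.pi * (2 / (1 + x ^ 2)) := by field_simp
    rw [e1, e2]
    apply mul_le_mul_of_nonneg_left _ (by positivity)
    rw [div_le_div_iff₀ (by positivity) (by positivity)]
    nlinarith
  -- First pass: the mass on `[0, 1]` alone gives a lower bound of order `x⁻²`.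
  have h1 : ∀ x, 1 ≤ x → c₁ ≤ dec f x * x ^ 2 := by
    intro x hx
    have h2 := (hstep x hx I hIpos.le).trans
      (hbound x 1 (by linarith) zero_le_one (le_max_right _ _))
    rwa [div_le_iff₀ (by positivity)] at h2
  have hcI : Continuous fun y => dec f y * y ^ 2 := hf.dec_cont.mul (by fun_prop)
  -- Second pass: inserting that bound, the second moment over `[0, x]` grows linearly, which
  -- improves the lower bound to order `x⁻¹`, not integrable.
  have h2 : ∀ x, 2 ≤ x → cst 1 f * c₁ / (2 * Real.pi) * x⁻¹ ≤ dec f x := by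
    intro x hx
    have e1 : c₁ * (x - 1) ≤ ∫ y in (0 : ℝ)..x, dec f y * y ^ 2 := by
      rw [← intervalIntegral.integral_add_adjacent_intervals (hcI.intervalIntegrable 0 1)
        (hcI.intervalIntegrable 1 x)]
      have := intervalIntegral.integral_mono_on (show (1 : ℝ) ≤ x by linarith)
        (intervalIntegrable_const (μ := volume) (c := c₁)) (hcI.intervalIntegrable 1 x) fun y hy => h1 y hy.1
      rw [intervalIntegral.integral_const, smul_eq_mul] at this
      linarith
    have hx0 : 0 < x := by linarith
    have hJ0 : 0 ≤ c₁ * (x - 1) := mul_nonneg hc₁p.le (by linarith)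
    have h3 := (hstep x (by linarith) _ (hJ0.trans e1)).trans
      (hbound x x hx0 hx0.le (le_max_left _ _))
    refine le_trans ?_ h3
    have e2 : c₁ * (x / 2) ≤ ∫ y in (0 : ℝ)..x, dec f y * y ^ 2 := by
      refine le_trans ?_ e1
      apply mul_le_mul_of_nonneg_left _ hc₁p.le
      linarith
    calc cst 1 f * c₁ / (2 * Real.pi) * x⁻¹ = cst 1 f * (c₁ * (x / 2)) / Real.pi / x ^ 2 := by
          field_simp
      _ ≤ _ := by gcongr
  have h3 : IntegrableOn (fun x : ℝ => x⁻¹) (Ioi 2) := by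
    have h4 : IntegrableOn (fun x => (cst 1 f * c₁ / (2 * Real.pi))⁻¹ * dec f x) (Ioi 2) :=
      (hi.mono_set (Ioi_subset_Ioi zero_le_two)).const_mul _
    refine Integrable.mono' h4 (by fun_prop) ?_
    filter_upwards [ae_restrict_mem measurableSet_Ioi] with y hy
    have hy' : 2 < y := hy
    have hy0 : 0 < y := by linarith
    rw [Real.norm_eq_abs, abs_of_pos (inv_pos.2 hy0), ← div_eq_inv_mul,
      le_div_iff₀ (by positivity), mul_comm]
    exact h2 y hy'.le
  exact not_integrableOn_Ioi_inv h3

lemma IsProfile.lt_one (hf : IsProfile f) (ha : a ≤ 1) (hfix : R a f = f)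
    (hi : IntegrableOn (dec f) (Ioi 0)) (h : 0 ≤ thetaInf a f) : a < 1 := by
  refine lt_of_le_of_ne ha fun ha1 => ?_
  subst ha1
  exact hf.ne_one hfix hi h

lemma IsProfile.eventually_T_le_half (hf : IsProfile f) (hi : IntegrableOn (dec f) (Ioi 0)) :
    ∀ᶠ x in atTop, T f x ≤ -((b f).toReal / 2) := by
  have hb := hf.b_pos hi
  exact ((hf.tendsto_T hi).eventually (gt_mem_nhds
    (show -(b f).toReal < -((b f).toReal / 2) by linarith))).mono fun _ h => h.le

/-- Wherever `theta` is eventually at most `B`, the fixed point decays algebraically. -/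
lemma IsProfile.exists_decay (hf : IsProfile f) (ha : a ≤ 1) (hfix : R a f = f)
    (hi : IntegrableOn (dec f) (Ioi 0)) (h : 0 ≤ thetaInf a f) {B : ℝ}
    (hθ : ∀ᶠ x in atTop, theta a f x ≤ B) :
    ∃ X₀ > 0, ∃ K, ∀ x, X₀ ≤ x →
      f x ≤ K * x ^ (-((1 - a) * cst a f * ((b f).toReal / 2) / B)) := by
  have hC := hf.cst_pos ha
  have ha1 := hf.lt_one ha hfix hi h
  have hpos := hf.theta_pos ha hi h
  have hb := hf.b_pos hi
  obtain ⟨X₀, hX⟩ := ((hf.eventually_T_le_half hi).and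
    (hθ.and (eventually_gt_atTop 0))).exists_forall_of_atTop
  have hX0 : 0 < X₀ := (hX X₀ le_rfl).2.2
  refine ⟨X₀, hX0, _, fun x hx => hf.fixed_le_rpow ha hfix hpos hX0 (fun y hy => ?_) hx⟩
  obtain ⟨h1, h2, h3⟩ := hX y hy
  have hθp := hpos y
  have e : expo a f y = -((1 - a) * cst a f * -T f y / theta a f y * y⁻¹) := by
    rw [expo]; field_simp
  rw [e, neg_mul, neg_le_neg_iff]
  have h1a : 0 < 1 - a := by linarith
  have : (b f).toReal / 2 ≤ -T f y := by linarith
  have : 0 ≤ y⁻¹ := by positivity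
  have : 0 ≤ -T f y := by linarith
  have : 0 ≤ (1 - a) * cst a f * -T f y := by positivity
  gcongr

lemma IsProfile.atInfinity_eq_zero (hf : IsProfile f) (ha : a ≤ 1) (hfix : R a f = f)
    (hi : IntegrableOn (dec f) (Ioi 0)) (h : 0 ≤ thetaInf a f) : atInfinity f = 0 := by
  have hC := hf.cst_pos ha
  have ha1 := hf.lt_one ha hfix hi h
  have hb := hf.b_pos hi
  have h1a : 0 < 1 - a := by linarith
  have hlim := hf.tendsto_theta hi a
  have hB : 0 < thetaInf a f + 1 := by linarith
  obtain ⟨X₀, hX0, K, hK⟩ := hf.exists_decay ha hfix hi h (B := thetaInf a f + 1)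
    ((hlim.eventually (gt_mem_nhds (by linarith))).mono fun _ h => h.le)
  exact hf.atInfinity_of_le_rpow (by positivity) hK

/-- In the critical case a fixed point decays faster than any power. -/
lemma IsProfile.exists_decay_critical (hf : IsProfile f) (ha : a ≤ 1) (hfix : R a f = f)
    (hi : IntegrableOn (dec f) (Ioi 0)) (h : thetaInf a f = 0) {N : ℝ} (hN : 0 < N) :
    ∃ X₀ > 0, ∃ K, ∀ x, X₀ ≤ x → f x ≤ K * x ^ (-N) := by
  have hC := hf.cst_pos ha
  have ha1 := hf.lt_one ha hfix hi h.ge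
  have hb := hf.b_pos hi
  have h1a : 0 < 1 - a := by linarith
  have hlim := hf.tendsto_theta hi a
  have hB : 0 < (1 - a) * cst a f * ((b f).toReal / 2) / N := by positivity
  -- This `B` makes the exponent exactly `-N`; every positive `B` is admissible because `theta`
  -- tends to `0`.
  obtain ⟨X₀, hX0, K, hK⟩ := hf.exists_decay ha hfix hi h.ge
    (B := (1 - a) * cst a f * ((b f).toReal / 2) / N)
    ((hlim.eventually (gt_mem_nhds (by rw [h]; exact hB))).mono fun _ h => h.le)
  refine ⟨X₀, hX0, K, fun x hx => (hK x hx).trans (le_of_eq ?_)⟩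
  congr 3
  field_simp

lemma IsProfile.exists_zero (hf : IsProfile f) (ha : a ≤ 1) (hfix : R a f = f)
    (hi : IntegrableOn (dec f) (Ioi 0)) (h : thetaInf a f < 0) : ∃ x, 0 ≤ x ∧ f x = 0 := by
  have ha0 : a ≠ 0 := by
    rintro rfl
    rw [thetaInf] at h
    simp at h
    linarith
  have hlim := hf.tendsto_theta hi a
  obtain ⟨x, hx, hx0⟩ := ((hlim.eventually (gt_mem_nhds h)).and (eventually_ge_atTop 0)).exists
  exact ⟨x, hx0, fixed_zero hfix ha0 hx.le⟩

lemma IsProfile.le_of_abs_le (hf : IsProfile f) {x y : ℝ} (h : |x| ≤ |y|) : f y ≤ f x := by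
  rw [← hf.abs_arg x, ← hf.abs_arg y]
  exact hf.anti (mem_Ici.2 (abs_nonneg _)) (mem_Ici.2 (abs_nonneg _)) h

lemma theta_pos_of_pos (hfix : R a f = f) (hx : 0 < f x) :
    0 < theta a f x := by
  by_cases ha : a = 0
  · subst ha; simp [theta]
  · by_contra h
    exact hx.ne' (fixed_zero hfix ha (not_lt.1 h))

/-- Positivity is an open condition, so the supremum is not attained; evenness and monotonicity fill
the interval between. -/
lemma IsProfile.pos_set_eq (hf : IsProfile f) {x₀ : ℝ} (hx₀ : 0 ≤ x₀) (h0 : f x₀ = 0) :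
    BddAbove {x | 0 < f x} ∧ 0 < L f ∧ {x | 0 < f x} = Ioo (-L f) (L f) := by
  have hb : BddAbove {x | 0 < f x} := by
    refine ⟨x₀, fun x hx => ?_⟩
    by_contra hcon
    have hx' : 0 < f x := hx
    rw [hf.vanish_of_ge hx₀ h0 (not_le.1 hcon).le] at hx'
    exact lt_irrefl _ hx'
  have hopen : IsOpen {x | 0 < f x} := isOpen_lt continuous_const hf.cont
  have hmem : ∀ x, 0 < f x → |x| < L f := by
    intro x hx
    have h1 : |x| ∈ {x | 0 < f x} := by simpa [hf.abs_arg] using hx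
    obtain ⟨δ, hδ, hball⟩ := Metric.isOpen_iff.1 hopen _ h1
    have h2 : |x| + δ / 2 ∈ {x | 0 < f x} := by
      apply hball
      rw [Metric.mem_ball, Real.dist_eq]
      rw [add_sub_cancel_left, abs_of_pos (by positivity)]
      linarith
    have := le_csSup hb h2
    rw [L]
    linarith
  have h00 : 0 < f 0 := by rw [hf.zero]; exact one_pos
  refine ⟨hb, by simpa using hmem 0 h00, ?_⟩
  ext x
  rw [mem_Ioo, ← abs_lt]
  refine ⟨hmem x, fun hx => ?_⟩
  obtain ⟨z, hz, hxz⟩ := exists_lt_of_lt_csSup ⟨0, h00⟩ hx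
  have hz' : 0 < f z := hz
  exact hz'.trans_le (hf.le_of_abs_le (hxz.le.trans (le_abs_self z)))

lemma IsProfile.tsupport_eq (hf : IsProfile f) {x₀ : ℝ} (hx₀ : 0 ≤ x₀) (h0 : f x₀ = 0) :
    tsupport f = Icc (-L f) (L f) := by
  obtain ⟨-, hL, hS⟩ := hf.pos_set_eq hx₀ h0
  have : Function.support f = {x | 0 < f x} := by
    ext x
    exact ⟨fun h => lt_of_le_of_ne (hf.nonneg x) (Ne.symm h), fun h => ne_of_gt h⟩
  rw [tsupport, this, hS, closure_Ioo (by linarith)]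

end Cases

/-! ### Lipschitz bounds for `x f` and for the potential. -/

section Moment

variable {f : ℝ → ℝ} {x y : ℝ}

/-- The odd function `x f(x)`. -/
noncomputable def moment (f : ℝ → ℝ) (x : ℝ) : ℝ := x * f x

/-- The potential `x (T(f)(x) + b(f))`. -/
noncomputable def pot (f : ℝ → ℝ) (x : ℝ) : ℝ := x * (T f x + (b f).toReal)

/-- Adjacent slopes of the convex function `s ↦ f (√s)` at `w²`, `x²`, `y²`, cleared of
denominators. -/
lemma IsProfile.slope_sq (hf : IsProfile f) {w : ℝ} (hw : 0 ≤ w) (hwx : w < x) (hxy : x < y) :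
    (f x - f y) * (x ^ 2 - w ^ 2) ≤ (f w - f x) * (y ^ 2 - x ^ 2) := by
  have hx : 0 ≤ x := by linarith
  have hy : 0 ≤ y := by linarith
  have h1 : w ^ 2 < x ^ 2 := by nlinarith
  have h2 : x ^ 2 < y ^ 2 := by nlinarith
  have h := hf.cvx.slope_mono_adjacent (mem_Ici.2 (sq_nonneg w)) (mem_Ici.2 (sq_nonneg y)) h1 h2
  simp only [Real.sqrt_sq hw, Real.sqrt_sq hx, Real.sqrt_sq hy] at h
  rw [div_le_div_iff₀ (by linarith) (by linarith)] at h
  linarith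

/-- Take `w = 0` in `IsProfile.slope_sq`; the first slope is controlled by `f 0 - f x ≤ x²`. -/
lemma IsProfile.sub_le_sq (hf : IsProfile f) (hx : 0 ≤ x) (hxy : x ≤ y) :
    f x - f y ≤ y ^ 2 - x ^ 2 := by
  rcases hx.eq_or_lt with rfl | hx0
  · have := hf.lower y
    rw [hf.zero]; linarith
  rcases hxy.eq_or_lt with rfl | hxy
  · simp
  have h := hf.slope_sq le_rfl hx0 hxy
  have h1 := hf.lower x
  rw [hf.zero] at h
  have h2 : 0 ≤ y ^ 2 - x ^ 2 := by nlinarith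
  have h3 : (f x - f y) * x ^ 2 ≤ (y ^ 2 - x ^ 2) * x ^ 2 := by nlinarith
  exact le_of_mul_le_mul_right h3 (by positivity)

/-- Take `w = x / 2` in `IsProfile.slope_sq`: then `x² - w² = 3/4 x²`, whence the factor `4/3`. -/
lemma IsProfile.sub_le_half (hf : IsProfile f) (hx : 0 < x) (hxy : x ≤ y) :
    x ^ 2 * (f x - f y) ≤ 4 / 3 * (y ^ 2 - x ^ 2) * f (x / 2) := by
  have h0 := hf.nonneg (x / 2)
  rcases hxy.eq_or_lt with rfl | hxy
  · simp
  have h := hf.slope_sq (by positivity) (half_lt_self hx) hxy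
  have h2 : 0 ≤ y ^ 2 - x ^ 2 := by nlinarith
  have h3 := mul_nonneg (hf.nonneg x) h2
  nlinarith

lemma IsProfile.moment_neg (hf : IsProfile f) (x : ℝ) : moment f (-x) = -moment f x := by
  rw [moment, moment, hf.even]; ring

lemma IsProfile.moment_continuous (hf : IsProfile f) : Continuous (moment f) :=
  continuous_id.mul hf.cont

lemma IsProfile.mul_sub_le (hf : IsProfile f) (hx : 0 < x) (hxy : x ≤ y) (hy : y ≤ 2 * x) :
    x * (f x - f y) ≤ 4 * (y - x) * f (x / 2) := by
  have h := hf.sub_le_half hx hxy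
  have h0 := hf.nonneg (x / 2)
  have h1 : (y ^ 2 - x ^ 2) ≤ 3 * x * (y - x) := by nlinarith
  have h2 : x * (x * (f x - f y)) ≤ x * (4 * (y - x) * f (x / 2)) := by
    have := mul_le_mul_of_nonneg_right h1 h0
    nlinarith
  exact le_of_mul_le_mul_left h2 hx

/-- The hypotheses are invariant under dilation, so the bound applies at `x t`, `y t` for all `t >
0`; the factor `f (x / 2)` keeps the decay that `IsProfile.pot_sub_le` integrates. -/
lemma IsProfile.moment_sub_le (hf : IsProfile f) (hx : 0 < x) (hxy : x ≤ y) (hy : y ≤ 2 * x) :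
    |moment f y - moment f x| ≤ 5 * (y - x) * f (x / 2) := by
  have h := hf.mul_sub_le hx hxy hy
  have e : moment f y - moment f x = (y - x) * f y - x * (f x - f y) := by
    rw [moment, moment]; ring
  have h1 : f y ≤ f (x / 2) :=
    hf.anti (mem_Ici.2 (by positivity)) (mem_Ici.2 (by linarith)) (by linarith)
  have h2 : f y ≤ f x := hf.anti (mem_Ici.2 hx.le) (mem_Ici.2 (by linarith)) hxy
  have h3 := hf.nonneg y
  have h4 : 0 ≤ x * (f x - f y) := mul_nonneg hx.le (by linarith)
  have h5 : 0 ≤ (y - x) * f y := mul_nonneg (by linarith) h3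
  have h6 : (y - x) * f y ≤ (y - x) * f (x / 2) := mul_le_mul_of_nonneg_left h1 (by linarith)
  have h7 : 0 ≤ (y - x) * f (x / 2) := h5.trans h6
  rw [e, _root_.abs_le]
  constructor <;> linarith

lemma IsProfile.moment_lipschitz_aux (hf : IsProfile f) (hx : 0 ≤ x) (hxy : x ≤ y) :
    |moment f y - moment f x| ≤ 5 * (y - x) := by
  have hy1 := hf.le_one y
  have hy0 := hf.nonneg y
  have hx1 := hf.le_one x
  rcases hx.eq_or_lt with rfl | hx0
  · rw [moment, moment, zero_mul, sub_zero, abs_of_nonneg (by positivity)]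
    nlinarith
  rcases le_total y (2 * x) with h | h
  · refine (hf.moment_sub_le hx0 hxy h).trans ?_
    have := hf.le_one (x / 2)
    nlinarith
  · have h2 : f y ≤ f x := hf.anti (mem_Ici.2 hx) (mem_Ici.2 (by linarith)) hxy
    have e : moment f y - moment f x = (y - x) * f y - x * (f x - f y) := by
      rw [moment, moment]; ring
    have h4 : 0 ≤ x * (f x - f y) := mul_nonneg hx0.le (by linarith)
    have h5 : 0 ≤ (y - x) * f y := mul_nonneg (by linarith) hy0
    rw [e, _root_.abs_le]
    constructor <;> nlinarith

lemma IsProfile.moment_lipschitz (hf : IsProfile f) (x y : ℝ) :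
    |moment f x - moment f y| ≤ 5 * |x - y| := by
  have h0 : moment f 0 = 0 := by simp [moment]
  have key : ∀ x y, x ≤ y → |moment f y - moment f x| ≤ 5 * (y - x) := by
    intro x y hxy
    rcases le_total 0 x with hx | hx
    · exact hf.moment_lipschitz_aux hx hxy
    rcases le_total y 0 with hy | hy
    · have := hf.moment_lipschitz_aux (x := -y) (y := -x) (by linarith) (by linarith)
      rw [hf.moment_neg, hf.moment_neg] at this
      rw [show moment f y - moment f x = -moment f x - -moment f y by ring]
      linarith
    · have h1 := hf.moment_lipschitz_aux le_rfl hy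
      have h2 := hf.moment_lipschitz_aux (x := 0) (y := -x) le_rfl (by linarith)
      rw [hf.moment_neg, h0] at h2
      rw [h0] at h1
      have e : moment f y - moment f x = (moment f y - 0) + (-moment f x - 0) := by ring
      rw [e]
      exact (abs_add_le _ _).trans (by linarith)
  rcases le_total x y with h | h
  · rw [abs_sub_comm, abs_sub_comm x, abs_of_nonneg (sub_nonneg.2 h)]
    exact key x y h
  · rw [abs_of_nonneg (sub_nonneg.2 h)]
    exact key y x h

lemma IsProfile.locally_lipschitz (hf : IsProfile f) (x y : ℝ) (h : |x - y| ≤ 1) :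
    |f x - f y| ≤ 4 * |x - y| := by
  have key : ∀ x y, 0 ≤ x → x ≤ y → y ≤ x + 1 → |f x - f y| ≤ 4 * (y - x) := by
    intro x y hx hxy hy
    have h2 : f y ≤ f x := hf.anti (mem_Ici.2 hx) (mem_Ici.2 (by linarith)) hxy
    rw [abs_of_nonneg (by linarith)]
    rcases le_total x 1 with h1 | h1
    · have := hf.sub_le_sq hx hxy
      nlinarith
    · have h3 := hf.mul_sub_le (by linarith) hxy (by linarith)
      have h4 := hf.le_one (x / 2)
      have h5 : f x - f y ≤ x * (f x - f y) := by nlinarith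
      nlinarith
  rw [← hf.abs_arg x, ← hf.abs_arg y]
  have h1 := abs_abs_sub_abs_le_abs_sub x y
  refine le_trans ?_ (mul_le_mul_of_nonneg_left h1 (by norm_num))
  have h2 := _root_.abs_le.1 (h1.trans h)
  rcases le_total |x| |y| with h3 | h3
  · rw [abs_of_nonpos (sub_nonpos.2 h3), neg_sub]
    exact key _ _ (abs_nonneg _) h3 (by linarith)
  · rw [abs_of_nonneg (sub_nonneg.2 h3), abs_sub_comm]
    exact key _ _ (abs_nonneg _) h3 (by linarith)

lemma tameHolder_of_locally_lipschitz {U : Set ℝ} {V g : ℝ → ℝ}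
    (hg : Continuous g) {M K : ℝ} (hM : ∀ x, |g x| ≤ M) (hK : 0 ≤ K)
    (hL : ∀ x y, |x - y| ≤ 1 → |g x - g y| ≤ K * |x - y|) : TameHolder U V g := by
  refine ⟨⟨hg.continuousOn, M, 0, (abs_nonneg _).trans (hM 0), fun x _ => by simpa using hM x⟩,
    K, 0, hK, fun x _ y _ hxy => ?_⟩
  rw [pow_zero, mul_one]
  refine (hL x y hxy).trans (mul_le_mul_of_nonneg_left ?_ hK)
  exact Real.le_sqrt_of_sq_le (by nlinarith [abs_nonneg (x - y)])

lemma IsProfile.tameHolder (hf : IsProfile f) {U : Set ℝ} {V : ℝ → ℝ} :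
    TameHolder U V f :=
  tameHolder_of_locally_lipschitz hf.cont hf.abs_le (by norm_num) hf.locally_lipschitz

/-- By monotonicity `|x| f |x|` is at most the integral of `f` over `(0, |x|]`. -/
lemma IsProfile.abs_moment_le (hf : IsProfile f) (hi : IntegrableOn f (Ioi 0)) (x : ℝ) :
    |moment f x| ≤ ∫ y in Ioi (0 : ℝ), f y := by
  have e : |moment f x| = |x| * f |x| := by
    rw [moment, abs_mul, hf.abs_arg, abs_of_nonneg (hf.nonneg x)]
  have hs : Ioc 0 |x| ⊆ Ioi (0 : ℝ) := fun y hy => hy.1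
  have h1 : ∫ y in Ioc 0 |x|, f |x| ≤ ∫ y in Ioc 0 |x|, f y :=
    setIntegral_mono_on (integrableOn_const (by simp)) (hi.mono_set hs) measurableSet_Ioc
      fun y hy => hf.anti (mem_Ici.2 hy.1.le) (mem_Ici.2 (abs_nonneg _)) hy.2
  have h2 : ∫ y in Ioc 0 |x|, f y ≤ ∫ y in Ioi (0 : ℝ), f y :=
    setIntegral_mono_set hi (ae_of_all _ hf.nonneg) hs.eventuallyLE
  rw [setIntegral_const, smul_eq_mul] at h1
  simp only [Measure.real, Real.volume_Ioc, sub_zero, ENNReal.toReal_ofReal (abs_nonneg x)] at h1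
  linarith

lemma IsProfile.tameHolder_moment (hf : IsProfile f) (hi : IntegrableOn f (Ioi 0)) {U : Set ℝ}
    {V : ℝ → ℝ} : TameHolder U V (moment f) :=
  tameHolder_of_locally_lipschitz hf.moment_continuous (hf.abs_moment_le hi) (by norm_num)
    fun x y _ => hf.moment_lipschitz x y

lemma pot_neg (f : ℝ → ℝ) (x : ℝ) : pot f (-x) = -pot f x := by
  rw [pot, pot, T_neg]; ring

lemma IsProfile.b_toReal_eq (hf : IsProfile f) (h0 : atInfinity f = 0) :
    (b f).toReal = 2 / Real.pi * ∫ y in Ioi (0 : ℝ), f y := by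
  rw [hf.b_toReal]
  simp [dec, h0]

lemma IsProfile.pot_eq (hf : IsProfile f) (h0 : atInfinity f = 0) (hi : IntegrableOn f (Ioi 0))
    (hx : 0 < x) :
    pot f x = x / Real.pi * ∫ t in Ioi (0 : ℝ), moment f (x * t) * ell t := by
  rw [pot, hf.b_toReal_eq h0, T_add_eq hf.cont hf.abs_le hi hx]
  have : ∀ t, moment f (x * t) * ell t = x * (f (x * t) * (t * ell t)) := fun t => by
    rw [moment]; ring
  simp_rw [this, integral_const_mul]
  ring

lemma IsProfile.integrableOn_moment_ell (hf : IsProfile f) (hi : IntegrableOn f (Ioi 0))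
    (hx : 0 < x) : IntegrableOn (fun t => moment f (x * t) * ell t) (Ioi 0) := by
  refine ((integrableOn_mul_ell hf.cont hf.abs_le hi hx).const_mul x).congr
    (ae_of_all _ fun t => ?_)
  simp only [moment]; ring

/-- Split off `(y - x) (T f y + b)`, which is at most `b (y - x)` since `T f ≤ 0`. By
`IsProfile.moment_sub_le` the rest is at most `5 (y - x)` times the positive operator applied to `g
z = f (z / 2)`; as `T g ≤ 0`, that operator is at most `2 b`. Hence `11 = 1 + 5 · 2`. -/
lemma IsProfile.pot_sub_le (hf : IsProfile f) (h0 : atInfinity f = 0)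
    (hi : IntegrableOn f (Ioi 0)) (hx : 0 < x) (hxy : x ≤ y) (hy : y ≤ 2 * x) :
    |pot f y - pot f x| ≤ 11 * (b f).toReal * (y - x) := by
  have hpi := Real.pi_pos
  have hy0 : 0 < y := by linarith
  set g : ℝ → ℝ := fun z => f (z / 2) with hg
  have hgc : Continuous g := hf.cont.comp (by fun_prop)
  have hgb : ∀ z, |g z| ≤ 1 := fun z => hf.abs_le _
  have hga : AntitoneOn g (Ici 0) := fun s hs t ht hst =>
    hf.anti (mem_Ici.2 (by have := mem_Ici.1 hs; positivity))
      (mem_Ici.2 (by have := mem_Ici.1 ht; positivity)) (by linarith)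
  have hgi : IntegrableOn g (Ioi 0) := by
    have := integrableOn_comp_mul hi (x := 1 / 2) (by norm_num)
    refine this.congr (ae_of_all _ fun t => ?_)
    simp only [hg]; congr 1; ring
  have hgint : ∫ z in Ioi (0 : ℝ), g z = 2 * ∫ z in Ioi (0 : ℝ), f z := by
    have := integral_comp_mul_left_Ioi f 0 (b := 1 / 2) (by norm_num)
    simp only [mul_zero, smul_eq_mul] at this
    norm_num at this
    rw [← this]
    refine integral_congr_ae (ae_of_all _ fun t => ?_)
    simp only [hg]; congr 1; ring
  have hT := T_nonpos hgc hgb hga x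
  have hT2 := T_nonpos hf.cont hf.abs_le hf.anti y
  have hTg := T_add_eq hgc hgb hgi hx
  have hI1 := hf.integrableOn_moment_ell hi hx
  have hI2 := hf.integrableOn_moment_ell hi hy0
  have hb := hf.b_toReal_eq h0
  have e : pot f y - pot f x = (y - x) * (T f y + (b f).toReal) +
      x / Real.pi * ∫ t in Ioi (0 : ℝ), (moment f (y * t) - moment f (x * t)) * ell t := by
    have : ∀ t, (moment f (y * t) - moment f (x * t)) * ell t =
      moment f (y * t) * ell t - moment f (x * t) * ell t := fun t => by ring
    simp_rw [this]
    rw [integral_sub hI2 hI1, mul_sub, ← hf.pot_eq h0 hi hx]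
    have h3 : T f y + (b f).toReal =
        1 / Real.pi * ∫ t in Ioi (0 : ℝ), moment f (y * t) * ell t := by
      have h4 := hf.pot_eq h0 hi hy0
      rw [pot] at h4
      apply mul_left_cancel₀ hy0.ne'
      rw [h4]; ring
    rw [pot, h3]
    ring
  have h1 : |∫ t in Ioi (0 : ℝ), (moment f (y * t) - moment f (x * t)) * ell t| ≤
      ∫ t in Ioi (0 : ℝ), 5 * (y - x) * (g (x * t) * (t * ell t)) := by
    refine norm_integral_le_of_norm_le
      (f := fun t => (moment f (y * t) - moment f (x * t)) * ell t)
      ((integrableOn_mul_ell hgc hgb hgi hx).const_mul _) ?_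
    filter_upwards [ae_restrict_mem measurableSet_Ioi] with t ht
    have ht' : 0 < t := ht
    have h2 := hf.moment_sub_le (x := x * t) (y := y * t) (by positivity)
      (mul_le_mul_of_nonneg_right hxy ht'.le) (by nlinarith)
    rw [Real.norm_eq_abs, abs_mul, abs_of_nonneg (ell_nonneg ht'.le)]
    refine (mul_le_mul_of_nonneg_right h2 (ell_nonneg ht'.le)).trans (le_of_eq ?_)
    simp only [hg]; ring
  rw [integral_const_mul] at h1
  rw [hgint] at hTg
  have hpos : 0 ≤ T f y + (b f).toReal := by
    rw [hb, T_add_eq hf.cont hf.abs_le hi hy0]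
    refine mul_nonneg (by positivity) (setIntegral_nonneg measurableSet_Ioi fun t ht => ?_)
    have ht' : 0 < t := ht
    exact mul_nonneg (hf.nonneg _) (mul_nonneg ht'.le (ell_nonneg ht'.le))
  set J := ∫ t in Ioi (0 : ℝ), g (x * t) * (t * ell t)
  have hJ : x / Real.pi * J ≤ 2 * (b f).toReal := by rw [← hTg, hb]; linarith
  have hd : 0 ≤ y - x := by linarith
  rw [e]
  refine (abs_add_le _ _).trans ?_
  rw [abs_of_nonneg (mul_nonneg hd hpos), abs_mul, abs_of_pos (a := x / Real.pi) (by positivity)]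
  have h5 : x / Real.pi * |∫ t in Ioi (0 : ℝ), (moment f (y * t) - moment f (x * t)) * ell t| ≤
      10 * (b f).toReal * (y - x) := by
    refine (mul_le_mul_of_nonneg_left h1 (by positivity)).trans ?_
    calc x / Real.pi * (5 * (y - x) * J) = 5 * (y - x) * (x / Real.pi * J) := by ring
      _ ≤ 5 * (y - x) * (2 * (b f).toReal) := mul_le_mul_of_nonneg_left hJ (by positivity)
      _ = _ := by ring
  have h6 : (y - x) * (T f y + (b f).toReal) ≤ (y - x) * (b f).toReal :=
    mul_le_mul_of_nonneg_left (by linarith) hd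
  linarith

lemma IsProfile.hasDerivAt_pot_zero (hf : IsProfile f) : HasDerivAt (pot f) (b f).toReal 0 := by
  have hc : Continuous fun x => T f x + (b f).toReal :=
    (continuous_T hf.cont hf.abs_le).add continuous_const
  rw [hasDerivAt_iff_tendsto_slope]
  have h1 : Tendsto (fun x => T f x + (b f).toReal) (𝓝[≠] 0) (𝓝 (b f).toReal) := by
    have := hc.tendsto 0
    simp only [T, if_true, zero_add] at this
    exact (this.mono_left nhdsWithin_le_nhds)
  refine h1.congr' ?_
  filter_upwards [self_mem_nhdsWithin] with x hx
  have hx' : x ≠ 0 := hx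
  rw [slope_def_field, pot, pot]
  field_simp
  ring

/-- The derivative of the potential is bounded wherever it exists. -/
lemma IsProfile.abs_deriv_pot_le (hf : IsProfile f) (h0 : atInfinity f = 0)
    (hi : IntegrableOn f (Ioi 0)) {d : ℝ} (hd : HasDerivAt (pot f) d x) :
    |d| ≤ 11 * (b f).toReal := by
  have key : ∀ x d, 0 < x → HasDerivAt (pot f) d x → |d| ≤ 11 * (b f).toReal := by
    intro x d hx hd
    have hs : Ioi x ⊆ {x}ᶜ := fun y hy => ne_of_gt hy
    have h1 := (hasDerivAt_iff_tendsto_slope.1 hd).mono_left (nhdsWithin_mono x hs)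
    refine le_of_tendsto h1.abs ?_
    filter_upwards [Ioo_mem_nhdsGT (show x < 2 * x by linarith)] with y hy
    have h2 : 0 < y - x := sub_pos.2 hy.1
    rw [slope_def_field, abs_div, abs_of_pos h2, div_le_iff₀ h2]
    exact hf.pot_sub_le h0 hi hx hy.1.le hy.2.le
  rcases lt_trichotomy x 0 with hx | rfl | hx
  · refine key (-x) d (by linarith) ?_
    rw [← neg_neg x] at hd
    have h1 := (hd.comp (-x) (hasDerivAt_neg (-x))).neg
    have h2 : (-(pot f ∘ Neg.neg)) = pot f := by
      ext z; simp [pot_neg]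
    rw [h2] at h1
    simpa using h1
  · rw [hd.unique hf.hasDerivAt_pot_zero, abs_of_nonneg ENNReal.toReal_nonneg]
    have : 0 ≤ (b f).toReal := ENNReal.toReal_nonneg
    linarith
  · exact key x d hx hd

end Moment

/-! ### The smooth contribution of the logarithm away from its singularity. -/

section Far

variable {f φ : ℝ → ℝ} {x ε : ℝ}

/-- The logarithmic kernel away from its singularity. -/
noncomputable def farKer (φ : ℝ → ℝ) (r : ℝ) : ℝ := (1 - φ r) * Real.log r

/-- Formal derivatives of the contribution of `farKer` to the potential. -/
noncomputable def farPot (φ f : ℝ → ℝ) (j : ℕ) (x : ℝ) : ℝ :=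
  1 / Real.pi * ∫ y in Ioi (0 : ℝ), moment f y *
    (iteratedDeriv j (farKer φ) (x + y) - iteratedDeriv j (farKer φ) (x - y))

lemma IsCutoff.contDiff_farKer (hφ : IsCutoff ε φ) (hε : 0 < ε) : ContDiff ℝ ∞ (farKer φ) := by
  rw [contDiff_iff_contDiffAt]
  intro r
  by_cases hr : r = 0
  · subst hr
    have h : farKer φ =ᶠ[𝓝 0] fun _ => 0 := by
      filter_upwards [Metric.ball_mem_nhds (0 : ℝ) (half_pos hε)] with s hs
      rw [Metric.mem_ball, Real.dist_eq, sub_zero] at hs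
      rw [farKer, hφ.one s hs.le]; ring
    exact contDiffAt_const.congr_of_eventuallyEq h
  · exact (contDiffAt_const.sub hφ.smooth.contDiffAt).mul (Real.contDiffAt_log.2 hr)

lemma IsCutoff.hasDerivAt_iteratedDeriv_farKer (hφ : IsCutoff ε φ) (hε : 0 < ε) (j : ℕ) (r : ℝ) :
    HasDerivAt (iteratedDeriv j (farKer φ)) (iteratedDeriv (j + 1) (farKer φ) r) r := by
  rw [iteratedDeriv_succ]
  exact ((hφ.contDiff_farKer hε).differentiable_iteratedDeriv j
    (by exact_mod_cast WithTop.coe_lt_top j) r).hasDerivAt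

lemma IsCutoff.continuous_iteratedDeriv_farKer (hφ : IsCutoff ε φ) (hε : 0 < ε) (j : ℕ) :
    Continuous (iteratedDeriv j (farKer φ)) :=
  continuous_iff_continuousAt.2 fun r =>
    (hφ.hasDerivAt_iteratedDeriv_farKer hε j r).continuousAt

lemma iteratedDeriv_succ_log (j : ℕ) (r : ℝ) :
    iteratedDeriv (j + 1) Real.log r = (-1) ^ j * (j.factorial : ℝ) * r ^ (-1 - j : ℤ) := by
  rw [iteratedDeriv_succ', Real.deriv_log', iteratedDeriv_eq_iterate]
  exact iter_deriv_inv j r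

/-- For `|r| > 1` the kernel is the logarithm, whose derivative of order `j + 1` is a multiple of `r
^ (-1 - j)`; on `[-1, 1]` compactness suffices. -/
lemma IsCutoff.exists_farKer_bound (hφ : IsCutoff ε φ) (hε : 0 < ε) (hε' : ε ≤ 1) {i j : ℕ}
    (hij : i ≤ j + 1) : ∃ C, ∀ r, |iteratedDeriv (j + 1) (farKer φ) r| * |r| ^ i ≤ C := by
  obtain ⟨M, hM⟩ := (isCompact_Icc (a := (-1 : ℝ)) (b := 1)).exists_bound_of_continuousOn
    (hφ.continuous_iteratedDeriv_farKer hε (j + 1)).continuousOn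
  refine ⟨max M |(-1) ^ j * (j.factorial : ℝ)|, fun r => ?_⟩
  rcases le_or_gt |r| 1 with hr | hr
  · refine le_max_of_le_left ?_
    have h1 := hM r (_root_.abs_le.1 hr)
    rw [Real.norm_eq_abs] at h1
    have h2 : |r| ^ i ≤ 1 := pow_le_one₀ (abs_nonneg r) hr
    calc _ ≤ |iteratedDeriv (j + 1) (farKer φ) r| * 1 :=
          mul_le_mul_of_nonneg_left h2 (abs_nonneg _)
      _ ≤ M := by rwa [mul_one]
  · refine le_max_of_le_right ?_
    have he : farKer φ =ᶠ[𝓝 r] Real.log := by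
      filter_upwards [continuous_abs.continuousAt.eventually (lt_mem_nhds hr)] with s hs
      rw [farKer, hφ.zero s (by linarith)]; ring
    rw [he.iteratedDeriv_eq, iteratedDeriv_succ_log, abs_mul, mul_assoc]
    refine mul_le_of_le_one_right (abs_nonneg _) ?_
    have hr0 : 0 < |r| := by linarith
    rw [abs_zpow, ← zpow_natCast, ← zpow_add₀ hr0.ne']
    exact zpow_le_one_of_nonpos₀ hr.le (by lia)

lemma IsCutoff.exists_farKer_bound_one (hφ : IsCutoff ε φ) (hε : 0 < ε) (hε' : ε ≤ 1) (j : ℕ) :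
    ∃ C, 0 ≤ C ∧ ∀ r, |iteratedDeriv (j + 1) (farKer φ) r| * (1 + |r|) ≤ C := by
  obtain ⟨C, hC⟩ := hφ.exists_farKer_bound hε hε' (Nat.zero_le (j + 1))
  obtain ⟨C', hC'⟩ := hφ.exists_farKer_bound hε hε' (i := 1) (j := j) (by lia)
  have h : ∀ r, |iteratedDeriv (j + 1) (farKer φ) r| * (1 + |r|) ≤ C + C' := fun r => by
    have h1 := hC r
    have h2 := hC' r
    rw [pow_zero] at h1
    rw [pow_one] at h2
    linarith
  exact ⟨C + C', (by positivity : (0 : ℝ) ≤ _).trans (h 0), h⟩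

lemma IsCutoff.exists_farKer_bound_two (hφ : IsCutoff ε φ) (hε : 0 < ε) (hε' : ε ≤ 1) (j : ℕ) :
    ∃ C, 0 ≤ C ∧ ∀ r, |iteratedDeriv (j + 2) (farKer φ) r| ≤ C * (1 + r ^ 2)⁻¹ := by
  obtain ⟨C, hC⟩ := hφ.exists_farKer_bound hε hε' (Nat.zero_le (j + 1 + 1))
  obtain ⟨C', hC'⟩ := hφ.exists_farKer_bound hε hε' (i := 2) (j := j + 1) (by lia)
  have h : ∀ r, |iteratedDeriv (j + 2) (farKer φ) r| * (1 + r ^ 2) ≤ C + C' := fun r => by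
    have h1 := hC r
    have h2 := hC' r
    rw [pow_zero] at h1
    rw [sq_abs] at h2
    linarith
  refine ⟨C + C', (by positivity : (0 : ℝ) ≤ _).trans (h 0), fun r => ?_⟩
  rw [← div_eq_mul_inv, le_div_iff₀ (by positivity)]
  exact h r

/-- Substitute `y = x t` in `IsProfile.pot_eq`; the two terms `log x` cancel. Oddness covers `x <
0`, and at `x = 0` the logarithms agree because `Real.log` is even. -/
lemma IsProfile.pot_eq_integral_log (hf : IsProfile f) (h0 : atInfinity f = 0)
    (hi : IntegrableOn f (Ioi 0)) (x : ℝ) :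
    IntegrableOn (fun y => moment f y * (Real.log (x + y) - Real.log (x - y))) (Ioi 0) ∧
    pot f x = 1 / Real.pi *
      ∫ y in Ioi (0 : ℝ), moment f y * (Real.log (x + y) - Real.log (x - y)) := by
  have key : ∀ x, 0 < x →
      IntegrableOn (fun y => moment f y * (Real.log (x + y) - Real.log (x - y))) (Ioi 0) ∧
      pot f x = 1 / Real.pi *
        ∫ y in Ioi (0 : ℝ), moment f y * (Real.log (x + y) - Real.log (x - y)) := by
    intro x hx
    have he : ∀ᵐ t ∂(volume.restrict (Ioi (0 : ℝ))), moment f (x * t) * ell t =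
        moment f (x * t) * (Real.log (x + x * t) - Real.log (x - x * t)) := by
      filter_upwards [ae_restrict_mem measurableSet_Ioi,
        ae_restrict_of_ae (Measure.ae_ne volume (1 : ℝ))] with t ht ht1
      have ht' : 0 < t := ht
      have h1 : 1 - t ≠ 0 := sub_ne_zero.2 (Ne.symm ht1)
      have h2 : 1 + t ≠ 0 := by positivity
      rw [ell_eq_log, Real.log_div h2 h1, show x + x * t = x * (1 + t) by ring,
        show x - x * t = x * (1 - t) by ring, Real.log_mul hx.ne' h2, Real.log_mul hx.ne' h1]
      ring
    have h1 := (hf.integrableOn_moment_ell hi hx).congr he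
    constructor
    · have := (integrableOn_Ioi_comp_mul_left_iff
        (fun y => moment f y * (Real.log (x + y) - Real.log (x - y))) 0 hx).1 h1
      rwa [mul_zero] at this
    · rw [hf.pot_eq h0 hi hx, integral_congr_ae he]
      have := integral_comp_mul_left_Ioi
        (fun y => moment f y * (Real.log (x + y) - Real.log (x - y))) 0 hx
      rw [mul_zero, smul_eq_mul] at this
      rw [this]
      field_simp
  rcases lt_trichotomy x 0 with hx | rfl | hx
  · have e : ∀ y, moment f y * (Real.log (x + y) - Real.log (x - y)) =
        -(moment f y * (Real.log (-x + y) - Real.log (-x - y))) := fun y => by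
      rw [← Real.log_neg_eq_log (x + y), ← Real.log_neg_eq_log (x - y),
        show -(x + y) = -x - y by ring, show -(x - y) = -x + y by ring]
      ring
    obtain ⟨h1, h2⟩ := key (-x) (by linarith)
    simp_rw [e]
    refine ⟨h1.neg, ?_⟩
    rw [integral_neg, mul_neg, ← h2, pot_neg, neg_neg]
  · simp [pot, Real.log_neg_eq_log]
  · exact key x hx

/-- As `moment f` is odd, the two half-line integrals unfold into one convolution over the line. -/
lemma IsProfile.integral_moment_logKer (hf : IsProfile f) (hi : IntegrableOn f (Ioi 0))
    (hφ : IsCutoff ε φ) (hε : 0 < ε) (hε' : ε ≤ 1) (x : ℝ) :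
    IntegrableOn (fun y => moment f y * (logKer φ (x + y) - logKer φ (x - y))) (Ioi 0) ∧
    ∫ y in Ioi (0 : ℝ), moment f y * (logKer φ (x + y) - logKer φ (x - y)) =
      -conv (logKer φ) (moment f) x := by
  have hK := (isKernel_logKer hφ hε hε').integrable
  have h1 : Integrable fun y => moment f y * logKer φ (x - y) :=
    (hK.comp_sub_left x).bdd_mul hf.moment_continuous.aestronglyMeasurable
      (ae_of_all _ (hf.abs_moment_le hi))
  have h2 : Integrable fun y => moment f y * logKer φ (x + y) :=
    (hK.comp_add_left x).bdd_mul hf.moment_continuous.aestronglyMeasurable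
      (ae_of_all _ (hf.abs_moment_le hi))
  have e : ∀ y, moment f y * (logKer φ (x + y) - logKer φ (x - y)) =
      moment f y * logKer φ (x + y) - moment f y * logKer φ (x - y) := fun y => by ring
  simp_rw [e]
  refine ⟨(h2.sub h1).integrableOn, ?_⟩
  rw [integral_sub h2.integrableOn h1.integrableOn, conv_eq_integral_sub]
  simp_rw [mul_comm (logKer φ _)]
  rw [← intervalIntegral.integral_Iic_add_Ioi (b := 0) h1.integrableOn h1.integrableOn]
  have h3 := integral_comp_neg_Ioi (0 : ℝ) (fun y => moment f y * logKer φ (x - y))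
  rw [neg_zero] at h3
  rw [← h3]
  simp_rw [hf.moment_neg, sub_neg_eq_add, neg_mul, integral_neg]
  ring

lemma IsProfile.pot_decomp (hf : IsProfile f) (h0 : atInfinity f = 0)
    (hi : IntegrableOn f (Ioi 0)) (hφ : IsCutoff ε φ) (hε : 0 < ε) (hε' : ε ≤ 1) (x : ℝ) :
    IntegrableOn (fun y => moment f y * (farKer φ (x + y) - farKer φ (x - y))) (Ioi 0) ∧
    pot f x = -(1 / Real.pi) * conv (logKer φ) (moment f) x + farPot φ f 0 x := by
  obtain ⟨h1, h2⟩ := hf.pot_eq_integral_log h0 hi x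
  obtain ⟨h3, h4⟩ := hf.integral_moment_logKer hi hφ hε hε' x
  have e : ∀ y, moment f y * (farKer φ (x + y) - farKer φ (x - y)) =
      moment f y * (Real.log (x + y) - Real.log (x - y)) -
      moment f y * (logKer φ (x + y) - logKer φ (x - y)) := fun y => by
    simp only [farKer, logKer]; ring
  simp only [farPot, iteratedDeriv_zero]
  simp_rw [e]
  refine ⟨h1.sub h3, ?_⟩
  rw [integral_sub h1 h3, h4, h2]
  ring

/-- The growth of `y` in the moment is absorbed by the decay `1 / (1 + |r|)` of the kernel
derivative at `r = x ± y`, since `y ≤ (1 + |r|) (1 + |x|)`. What is left is the integrable `f y`. -/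
lemma IsProfile.exists_farPot_integrand_bound (hf : IsProfile f) (hφ : IsCutoff ε φ) (hε : 0 < ε)
    (hε' : ε ≤ 1) (j : ℕ) : ∃ C, 0 ≤ C ∧ ∀ x y, 0 ≤ y → |moment f y *
      (iteratedDeriv (j + 1) (farKer φ) (x + y) - iteratedDeriv (j + 1) (farKer φ) (x - y))| ≤
      C * (1 + |x|) * f y := by
  obtain ⟨C, hC0, hC⟩ := hφ.exists_farKer_bound_one hε hε' j
  refine ⟨2 * C, by positivity, fun x y hy => ?_⟩
  have key : ∀ r, y ≤ |r| + |x| →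
      y * |iteratedDeriv (j + 1) (farKer φ) r| ≤ C * (1 + |x|) := fun r hr => by
    have h1 : y ≤ (1 + |r|) * (1 + |x|) := by
      nlinarith [mul_nonneg (abs_nonneg r) (abs_nonneg x)]
    calc y * |iteratedDeriv (j + 1) (farKer φ) r|
        ≤ (1 + |r|) * (1 + |x|) * |iteratedDeriv (j + 1) (farKer φ) r| :=
          mul_le_mul_of_nonneg_right h1 (abs_nonneg _)
      _ = |iteratedDeriv (j + 1) (farKer φ) r| * (1 + |r|) * (1 + |x|) := by ring
      _ ≤ _ := mul_le_mul_of_nonneg_right (hC r) (by positivity)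
  have h1 := key (x + y) (by
    calc y ≤ |y| := le_abs_self y
      _ = |(x + y) - x| := by ring_nf
      _ ≤ _ := abs_sub _ _)
  have h2 := key (x - y) (by
    calc y ≤ |y| := le_abs_self y
      _ = |x - (x - y)| := by ring_nf
      _ ≤ |x| + |x - y| := abs_sub _ _
      _ = _ := add_comm _ _)
  rw [moment, abs_mul, abs_mul, abs_of_nonneg hy, abs_of_nonneg (hf.nonneg y)]
  calc _ ≤ y * f y * (|iteratedDeriv (j + 1) (farKer φ) (x + y)| +
        |iteratedDeriv (j + 1) (farKer φ) (x - y)|) :=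
        mul_le_mul_of_nonneg_left (abs_sub _ _) (mul_nonneg hy (hf.nonneg y))
    _ = (y * |iteratedDeriv (j + 1) (farKer φ) (x + y)| +
        y * |iteratedDeriv (j + 1) (farKer φ) (x - y)|) * f y := by ring
    _ ≤ _ := mul_le_mul_of_nonneg_right (by linarith) (hf.nonneg y)

lemma IsProfile.integrableOn_farPot (hf : IsProfile f) (h0 : atInfinity f = 0)
    (hi : IntegrableOn f (Ioi 0)) (hφ : IsCutoff ε φ) (hε : 0 < ε) (hε' : ε ≤ 1) (j : ℕ) (x : ℝ) :
    IntegrableOn (fun y => moment f y * (iteratedDeriv j (farKer φ) (x + y) -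
      iteratedDeriv j (farKer φ) (x - y))) (Ioi 0) := by
  cases j with
  | zero => simpa using (hf.pot_decomp h0 hi hφ hε hε' x).1
  | succ j =>
    obtain ⟨C, -, hC⟩ := hf.exists_farPot_integrand_bound hφ hε hε' j
    have := hφ.continuous_iteratedDeriv_farKer hε (j + 1)
    have := hf.moment_continuous
    refine Integrable.mono' (hi.const_mul (C * (1 + |x|)))
      (by fun_prop : Continuous _).aestronglyMeasurable ?_
    filter_upwards [ae_restrict_mem measurableSet_Ioi] with y hy
    exact hC x y (le_of_lt hy)

lemma IsProfile.hasDerivAt_farPot (hf : IsProfile f) (h0 : atInfinity f = 0)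
    (hi : IntegrableOn f (Ioi 0)) (hφ : IsCutoff ε φ) (hε : 0 < ε) (hε' : ε ≤ 1) (j : ℕ) (x : ℝ) :
    HasDerivAt (farPot φ f j) (farPot φ f (j + 1) x) x := by
  obtain ⟨C, hC0, hC⟩ := hf.exists_farPot_integrand_bound hφ hε hε' j
  have h1 := hφ.continuous_iteratedDeriv_farKer hε j
  have h2 := hφ.continuous_iteratedDeriv_farKer hε (j + 1)
  have h3 := hf.moment_continuous
  refine HasDerivAt.const_mul (1 / Real.pi) ?_
  refine (hasDerivAt_integral_of_dominated_loc_of_deriv_le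
    (F := fun x y => moment f y * (iteratedDeriv j (farKer φ) (x + y) -
      iteratedDeriv j (farKer φ) (x - y)))
    (F' := fun x y => moment f y * (iteratedDeriv (j + 1) (farKer φ) (x + y) -
      iteratedDeriv (j + 1) (farKer φ) (x - y)))
    (bound := fun y => C * (1 + (|x| + 1)) * f y) (Metric.ball_mem_nhds x one_pos)
    (Eventually.of_forall fun z => (by fun_prop : Continuous _).aestronglyMeasurable)
    (hf.integrableOn_farPot h0 hi hφ hε hε' j x)
    (by fun_prop : Continuous _).aestronglyMeasurable ?_ (hi.const_mul _) ?_).2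
  · filter_upwards [ae_restrict_mem measurableSet_Ioi] with y hy z hz
    refine (hC z y (le_of_lt hy)).trans (mul_le_mul_of_nonneg_right ?_ (hf.nonneg y))
    refine mul_le_mul_of_nonneg_left ?_ hC0
    rw [Metric.mem_ball, Real.dist_eq] at hz
    have := abs_sub_abs_le_abs_sub z x
    linarith
  · refine ae_of_all _ fun y z _ => HasDerivAt.const_mul _ ?_
    exact ((hφ.hasDerivAt_iteratedDeriv_farKer hε j (z + y)).comp_add_const z y).sub
      ((hφ.hasDerivAt_iteratedDeriv_farKer hε j (z - y)).comp_sub_const z y)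

/-- From the second derivative on, the kernel is bounded by a multiple of `1 / (1 + r²)`, which is
integrable, while `moment f` is bounded. The first derivative decays only like `1 / r` and is
handled through `pot` instead. -/
lemma IsProfile.exists_farPot_bound (hf : IsProfile f) (hi : IntegrableOn f (Ioi 0))
    (hφ : IsCutoff ε φ) (hε : 0 < ε) (hε' : ε ≤ 1) (j : ℕ) :
    ∃ M, ∀ x, |farPot φ f (j + 2) x| ≤ M := by
  obtain ⟨C, hC0, hC⟩ := hφ.exists_farKer_bound_two hε hε' j
  set I := ∫ y in Ioi (0 : ℝ), f y with hI
  have hI0 : 0 ≤ I := (abs_nonneg _).trans (hf.abs_moment_le hi 0)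
  have hJ := integrable_inv_one_add_sq
  set J := ∫ r : ℝ, (1 + r ^ 2)⁻¹
  refine ⟨1 / Real.pi * (I * C * (J + J)), fun x => ?_⟩
  have h1 : Integrable fun y : ℝ => (1 + (x + y) ^ 2)⁻¹ := hJ.comp_add_left x
  have h2 : Integrable fun y : ℝ => (1 + (x - y) ^ 2)⁻¹ := hJ.comp_sub_left x
  have e1 : ∫ y : ℝ, (1 + (x + y) ^ 2)⁻¹ = J :=
    integral_add_left_eq_self (fun r : ℝ => (1 + r ^ 2)⁻¹) x
  have e2 : ∫ y : ℝ, (1 + (x - y) ^ 2)⁻¹ = J :=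
    integral_sub_left_eq_self (fun r : ℝ => (1 + r ^ 2)⁻¹) volume x
  have h3 : Integrable fun y : ℝ => I * C * ((1 + (x + y) ^ 2)⁻¹ + (1 + (x - y) ^ 2)⁻¹) :=
    (h1.add h2).const_mul _
  have hpi := Real.pi_pos
  rw [farPot, abs_mul, abs_of_pos (by positivity : 0 < 1 / Real.pi)]
  refine mul_le_mul_of_nonneg_left ?_ (by positivity)
  calc _ ≤ ∫ y in Ioi (0 : ℝ), I * C * ((1 + (x + y) ^ 2)⁻¹ + (1 + (x - y) ^ 2)⁻¹) := by
        refine norm_integral_le_of_norm_le (f := fun y => moment f y *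
          (iteratedDeriv (j + 2) (farKer φ) (x + y) - iteratedDeriv (j + 2) (farKer φ) (x - y)))
          h3.integrableOn (ae_of_all _ fun y => ?_)
        rw [Real.norm_eq_abs, abs_mul, mul_assoc, mul_add]
        exact mul_le_mul (hf.abs_moment_le hi y)
          ((abs_sub _ _).trans (add_le_add (hC _) (hC _))) (abs_nonneg _) hI0
    _ ≤ ∫ y : ℝ, I * C * ((1 + (x + y) ^ 2)⁻¹ + (1 + (x - y) ^ 2)⁻¹) :=
        setIntegral_le_integral h3 (ae_of_all _ fun y => by positivity)
    _ = _ := by rw [integral_const_mul, integral_add h1 h2, e1, e2]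

end Far

/-! ### The differential equation of a fixed point and the bootstrap. -/

section Euler

variable {f : ℝ → ℝ} {a x : ℝ}

/-- The factor `E` in the differential equation `x f' = f (E - 1)` satisfied by fixed points. -/
noncomputable def euler (a : ℝ) (f : ℝ → ℝ) (x : ℝ) : ℝ :=
  (1 + cst a f * (deriv (pot f) x - (b f).toReal)) * (theta a f x)⁻¹

lemma IsProfile.euler_zero (hf : IsProfile f) : euler a f 0 = 1 := by
  rw [euler, hf.hasDerivAt_pot_zero.deriv, theta_at_zero]
  simp

lemma hasDerivAt_T {d : ℝ} (hx : x ≠ 0) (hd : HasDerivAt (pot f) d x) :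
    HasDerivAt (T f) ((d - (T f x + (b f).toReal)) / x) x := by
  have h1 := (hd.div (hasDerivAt_id x) hx).sub_const (b f).toReal
  refine (h1.congr_of_eventuallyEq ?_).congr_deriv ?_
  · filter_upwards [isOpen_ne.mem_nhds hx] with y hy
    have hy' : y ≠ 0 := hy
    simp only [Pi.div_apply, id, pot]
    field_simp
    ring
  · simp only [id, pot]
    field_simp

lemma hasDerivAt_pref {t : ℝ} (hθ : 0 < theta a f x) (ht : HasDerivAt (T f) t x) :
    HasDerivAt (pref a f) (pref a f x * (cst a f * t / theta a f x)) x := by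
  by_cases ha : a = 0
  · subst ha
    have e : pref 0 f = fun x => Real.exp (cst 0 f * T f x) := by
      ext x; simp [pref]
    rw [e]
    refine ((ht.const_mul (cst 0 f)).exp).congr_deriv ?_
    simp [theta]
  · have e : pref a f = fun x => theta a f x ^ (1 / a) := by
      ext x; simp [pref, ha]
    have h1 : HasDerivAt (theta a f) (a * cst a f * t) x := by
      unfold theta
      exact (ht.const_mul (a * cst a f)).const_add 1
    rw [e]
    refine (h1.rpow_const (Or.inl hθ.ne')).congr_deriv ?_
    rw [Real.rpow_sub_one hθ.ne']
    field_simp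

lemma IsProfile.hasDerivAt_integral_expo (hf : IsProfile f) (hx : x ≠ 0)
    (hpos : ∀ y ∈ uIcc 0 x, 0 < theta a f y) :
    HasDerivAt (fun x => ∫ y in (0 : ℝ)..x, expo a f y) (expo a f x) x := by
  have hT : Continuous (T f) := continuous_T hf.cont hf.abs_le
  have hθ : Continuous (theta a f) := hf.continuous_theta
  have hm : Measurable (expo a f) := by
    have := hT.measurable
    have := hθ.measurable
    unfold expo
    fun_prop
  refine intervalIntegral.integral_hasDerivAt_right (hf.expo_intervalIntegrable hpos)
    hm.stronglyMeasurable.stronglyMeasurableAtFilter ?_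
  exact (continuousAt_const.mul (hT.continuousAt.div continuousAt_id hx)).div hθ.continuousAt
    (hpos x right_mem_uIcc).ne'

/-- Logarithmic differentiation of `fixed_formula`, valid on `[0, x]` because `U` is star-shaped.
With `x T' = pot' - (T + b)`, the terms `-C T` and `(1 - a) C T` combine to `-a C T = 1 - theta`. -/
lemma IsProfile.hasDerivAt_fixed (hf : IsProfile f) (hfix : R a f = f) {U : Set ℝ}
    (hU : IsStarOpen U) (hpos : ∀ y ∈ U, 0 < theta a f y) (hx : x ∈ U) (hx0 : x ≠ 0)
    (hd : HasDerivAt (pot f) (deriv (pot f) x) x) :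
    HasDerivAt f (f x * (euler a f x - 1) / x) x := by
  have hsub : ∀ z ∈ U, ∀ y ∈ uIcc 0 z, 0 < theta a f y := by
    intro z hz y hy
    by_cases hz0 : z = 0
    · subst hz0
      rw [uIcc_self, mem_singleton_iff] at hy
      exact hy ▸ hpos _ hz
    · have h1 : y / z ∈ Icc (0 : ℝ) 1 := by
        rcases mem_uIcc.1 hy with h | h
        · have hz' : 0 < z := lt_of_le_of_ne (h.1.trans h.2) (Ne.symm hz0)
          exact ⟨div_nonneg h.1 hz'.le, (div_le_one hz').2 h.2⟩
        · have hz' : z < 0 := lt_of_le_of_ne (h.1.trans h.2) hz0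
          exact ⟨div_nonneg_of_nonpos h.2 hz'.le, (div_le_one_of_neg hz').2 h.1⟩
      have h2 := hU.star z hz _ h1
      rw [div_mul_cancel₀ _ hz0] at h2
      exact hpos y h2
  have hθ := hpos x hx
  have h1 := (hasDerivAt_pref hθ (hasDerivAt_T hx0 hd)).mul
    (hf.hasDerivAt_integral_expo hx0 (hsub x hx)).exp
  have he : f =ᶠ[𝓝 x] (pref a f * fun x => Real.exp (∫ y in (0 : ℝ)..x, expo a f y)) := by
    filter_upwards [hU.isOpen.mem_nhds hx] with z hz
    exact fixed_formula hfix (hsub z hz)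
  refine (h1.congr_of_eventuallyEq he).congr_deriv ?_
  rw [fixed_formula hfix (hsub x hx), euler, expo]
  field_simp
  rw [theta]
  ring

/-- Families of sets on which the regularity of a fixed point can be bootstrapped. -/
structure IsRegFamily (a : ℝ) (f V : ℝ → ℝ) (S : Set (Set ℝ)) : Prop where
  weight : IsWeight V
  star : ∀ U ∈ S, IsStarOpen U
  convex : ∀ U ∈ S, Convex ℝ U
  inset : ∀ U ∈ S, ∃ U' ∈ S, ∃ ε, IsInset ε U U'
  pos : ∀ U ∈ S, ∀ x ∈ U, 0 < theta a f x
  inv : ∀ U ∈ S, Tame U V fun x => (theta a f x)⁻¹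

section Bootstrap

variable {V : ℝ → ℝ} {S : Set (Set ℝ)} {U : Set ℝ} {B : (ℝ → ℝ) → Prop} {n : ℕ}

/-- Differentiability comes from the Hölder bound on `moment f` in the local part; the uniform bound
comes from the Lipschitz estimate for `pot f`, as no direct bound on `farPot φ f 1` is at hand. -/
lemma IsProfile.hasDerivAt_pot (hf : IsProfile f) (h0 : atInfinity f = 0)
    (hi : IntegrableOn f (Ioi 0)) (hS : IsRegFamily a f V S) (hU : U ∈ S) :
    Tame U V (deriv (pot f)) ∧ ∀ x ∈ U, HasDerivAt (pot f) (deriv (pot f) x) x := by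
  obtain ⟨U', -, ε, hε⟩ := hS.inset U hU
  obtain ⟨φ, hφ⟩ := exists_isCutoff hε.pos
  have hε1 : ε ≤ 1 := by linarith [hε.le]
  obtain ⟨Q, hQ, hQt⟩ := TameHolder.exists_deriv_conv_logKer hS.weight hε hφ
    (hf.tameHolder_moment hi (U := U') (V := V))
  have hd : ∀ x ∈ U, HasDerivAt (pot f) (-(1 / Real.pi) * Q x + farPot φ f 1 x) x := by
    intro x hx
    rw [show pot f = fun x => -(1 / Real.pi) * conv (logKer φ) (moment f) x + farPot φ f 0 x from
      funext fun x => (hf.pot_decomp h0 hi hφ hε.pos hε1 x).2]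
    exact ((hQ x hx).const_mul _).add (hf.hasDerivAt_farPot h0 hi hφ hε.pos hε1 0 x)
  have hd' : ∀ x ∈ U, HasDerivAt (pot f) (deriv (pot f) x) x := fun x hx =>
    (hd x hx).differentiableAt.hasDerivAt
  refine ⟨⟨?_, 11 * (b f).toReal, 0, by positivity, fun x hx => ?_⟩, hd'⟩
  · have hc : Continuous (farPot φ f 1) := continuous_iff_continuousAt.2 fun x =>
      (hf.hasDerivAt_farPot h0 hi hφ hε.pos hε1 1 x).continuousAt
    exact ((continuousOn_const.mul hQt.1).add hc.continuousOn).congr fun x hx => (hd x hx).deriv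
  · rw [pow_zero, mul_one]
    exact hf.abs_deriv_pot_le h0 hi (hd' x hx)

/-- Since `pot f = x (T f + b)` vanishes at `0`, `T f + b` is the ray average of `(pot f)'`; thus
`theta` and `E` are as regular as `(pot f)'`. -/
lemma IsProfile.reg_euler (hf : IsProfile f) (hU : IsStarOpen U) (hB : IsAlgebraClass U V B)
    (hd : ∀ x ∈ U, HasDerivAt (pot f) (deriv (pot f) x) x) (hr : Reg U B n (deriv (pot f)))
    (hpos : ∀ x ∈ U, 0 < theta a f x) (hinv : Tame U V fun x => (theta a f x)⁻¹) :
    Reg U B n (euler a f) := by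
  have hA : Reg U B n (theta a f) := by
    have h1 := ((hr.rayAvg hB hU 0).add hB (Reg.const hB (-(b f).toReal))).const_mul hB
      (a * cst a f)
    refine ((Reg.const hB 1).add hB h1).congr hB hU.isOpen fun x hx => ?_
    have h2 := sub_eq_mul_rayAvg hU hd (hB.tame _ hr.base).1 hx
    by_cases hx0 : x = 0
    · subst hx0
      simp [theta, T, rayAvg, hf.hasDerivAt_pot_zero.deriv]
    · have h3 : GCLM.rayAvg 0 (deriv (pot f)) x = T f x + (b f).toReal := by
        apply mul_left_cancel₀ hx0
        rw [← h2]; simp [pot]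
      rw [theta, h3]; ring
  have h1 := ((hr.add hB (Reg.const hB (-(b f).toReal))).const_mul hB (cst a f))
  refine (((Reg.const hB 1).add hB h1).mul hB
    (hA.inv hB (fun x hx => (hpos x hx).ne') hinv)).congr hB hU.isOpen fun x _ => ?_
  rw [euler]; ring

lemma IsProfile.reg_of_pot (hf : IsProfile f) (hfix : R a f = f) (hU : IsStarOpen U)
    (hB : IsAlgebraClass U V B) (hfB : B f)
    (hd : ∀ x ∈ U, HasDerivAt (pot f) (deriv (pot f) x) x) (hr : Reg U B n (deriv (pot f)))
    (hpos : ∀ x ∈ U, 0 < theta a f x) (hinv : Tame U V fun x => (theta a f x)⁻¹) :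
    Reg U B n f ∧ Reg U B n fun x => f x * euler a f x := by
  have hE := hf.reg_euler hU hB hd hr hpos hinv
  have h1 := hE.of_euler_ode hB hU hfB hf.euler_zero fun x hx hx0 =>
    hf.hasDerivAt_fixed hfix hU hpos hx hx0 (hd x hx)
  exact ⟨h1, h1.mul hB hE⟩

/-- `(x f)' = f + x f' = f E` away from `0`, and the continuity of `f E` extends this to the origin.
-/
lemma IsProfile.hasDerivAt_moment (hf : IsProfile f) (h0 : atInfinity f = 0)
    (hi : IntegrableOn f (Ioi 0)) (hfix : R a f = f) (hS : IsRegFamily a f V S) (hU : U ∈ S)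
    (hx : x ∈ U) : HasDerivAt (moment f) (f x * euler a f x) x := by
  obtain ⟨ht, hd⟩ := hf.hasDerivAt_pot h0 hi hS hU
  have hB := isAlgebraClass_tame hS.weight (hS.star U hU)
  have hEc : ContinuousOn (euler a f) U :=
    (hf.reg_euler (n := 0) (hS.star U hU) hB hd ht (hS.pos U hU) (hS.inv U hU)).1
  have hd' : ∀ x ∈ U, x ≠ 0 → HasDerivAt (moment f) (f x * euler a f x) x := by
    intro x hx hx0
    refine ((hasDerivAt_id x).mul (hf.hasDerivAt_fixed hfix (hS.star U hU) (hS.pos U hU) hx hx0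
      (hd x hx))).congr_deriv ?_
    simp only [id]
    field_simp
    ring
  by_cases hx0 : x = 0
  · subst hx0
    have hn : U ∈ 𝓝 (0 : ℝ) := (hS.star U hU).isOpen.mem_nhds hx
    exact hasDerivAt_of_eventually_ne (g := fun x => f x * euler a f x)
      (Filter.eventually_of_mem hn hd') hf.moment_continuous.continuousAt
      (hf.cont.continuousAt.mul (hEc.continuousAt hn))
  · exact hd' x hx hx0

lemma IsProfile.reg_farPot_add_two (hf : IsProfile f) (h0 : atInfinity f = 0)
    (hi : IntegrableOn f (Ioi 0)) {φ : ℝ → ℝ} {ε : ℝ} (hφ : IsCutoff ε φ) (hε : 0 < ε)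
    (hε' : ε ≤ 1) (U : Set ℝ) (V : ℝ → ℝ) (n j : ℕ) : Reg U (Tame U V) n (farPot φ f (j + 2)) := by
  have hd := hf.hasDerivAt_farPot h0 hi hφ hε hε'
  have ht : ∀ j, Tame U V (farPot φ f (j + 2)) := by
    intro j
    obtain ⟨M, hM⟩ := hf.exists_farPot_bound hi hφ hε hε' j
    refine ⟨fun x _ => (hd _ x).continuousAt.continuousWithinAt, M, 0,
      (abs_nonneg _).trans (hM 0), fun x _ => ?_⟩
    rw [pow_zero, mul_one]
    exact hM x
  induction n generalizing j with
  | zero => exact ht j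
  | succ n ih => exact ⟨ht j, _, fun x _ => hd _ x, ih (j + 1)⟩

/-- Bootstrapping: the derivative of the potential is smooth with tame derivatives. -/
theorem IsProfile.reg_deriv_pot (hf : IsProfile f) (h0 : atInfinity f = 0)
    (hi : IntegrableOn f (Ioi 0)) (hfix : R a f = f) (hS : IsRegFamily a f V S) (n : ℕ) :
    ∀ U ∈ S, Reg U (Tame U V) n (deriv (pot f)) := by
  have hV := hS.weight
  have hpot := fun U hU => hf.hasDerivAt_pot h0 hi hS (U := U) hU
  have hdecomp : ∀ U ∈ S, ∃ U' ∈ S, ∃ ε φ, IsInset ε U U' ∧ IsCutoff ε φ ∧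
      (∀ n, Reg U (Tame U V) n (farPot φ f 1)) ∧
      ∀ x ∈ U, -(1 / Real.pi) * conv (logKer φ) (fun x => f x * euler a f x) x + farPot φ f 1 x =
        deriv (pot f) x := by
    intro U hU
    obtain ⟨U', hU', ε, hε⟩ := hS.inset U hU
    obtain ⟨φ, hφ⟩ := exists_isCutoff hε.pos
    have hε1 : ε ≤ 1 := by linarith [hε.le]
    have hB := isAlgebraClass_tame hV (hS.star U hU)
    have hK := isKernel_logKer hφ hε.pos hε1
    have hB' := isAlgebraClass_tame hV (hS.star U' hU')
    have hg : Tame U' V fun x => f x * euler a f x :=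
      (hf.reg_of_pot (n := 0) hfix (hS.star U' hU') hB' hf.tameHolder.1 (hpot U' hU').2
        (hpot U' hU').1 (hS.pos U' hU') (hS.inv U' hU')).2
    have he : ∀ x ∈ U, -(1 / Real.pi) * conv (logKer φ) (fun x => f x * euler a f x) x +
        farPot φ f 1 x = deriv (pot f) x := by
      intro x hx
      have h1 := hasDerivAt_conv hV hε hK hf.moment_continuous.continuousOn
        (fun z hz => hf.hasDerivAt_moment h0 hi hfix hS hU' hz) hg hx
      rw [show pot f = fun x => -(1 / Real.pi) * conv (logKer φ) (moment f) x + farPot φ f 0 x from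
        funext fun x => (hf.pot_decomp h0 hi hφ hε.pos hε1 x).2]
      exact ((h1.const_mul _).add (hf.hasDerivAt_farPot h0 hi hφ hε.pos hε1 0 x)).deriv.symm
    -- The far part is the difference of two quantities already known to be tame.
    have ht : Tame U V (farPot φ f 1) := by
      have h1 : Reg U (Tame U V) 0 (conv (logKer φ) fun x => f x * euler a f x) :=
        hg.conv hV hε hK
      have h2 : Reg U (Tame U V) 0 (deriv (pot f)) := (hpot U hU).1
      refine (h2.add hB (h1.const_mul hB (1 / Real.pi))).congr hB (hS.star U hU).isOpen
        fun x hx => ?_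
      have h3 := he x hx
      simp only
      linarith
    refine ⟨U', hU', ε, φ, hε, hφ, fun n => ?_, he⟩
    cases n with
    | zero => exact ht
    | succ n => exact ⟨ht, _, fun x _ => hf.hasDerivAt_farPot h0 hi hφ hε.pos hε1 1 x,
        hf.reg_farPot_add_two h0 hi hφ hε.pos hε1 U V n 0⟩
  induction n with
  | zero => exact fun U hU => (hpot U hU).1
  | succ n ih =>
    -- First turn: the same number of derivatives, now Hölder. The second turn, on a set with an
    -- inset again, converts this into one more derivative.
    have hH : ∀ U ∈ S, Reg U (TameHolder U V) n (deriv (pot f)) := by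
      intro U hU
      obtain ⟨U', hU', ε, φ, hε, hφ, hfar, he⟩ := hdecomp U hU
      have hB := isAlgebraClass_tameHolder hV (hS.star U hU)
      have hg := (hf.reg_of_pot hfix (hS.star U' hU') (isAlgebraClass_tame hV (hS.star U' hU'))
        hf.tameHolder.1 (hpot U' hU').2 (ih U' hU') (hS.pos U' hU') (hS.inv U' hU')).2
      exact (((hg.conv_logKer hV hε hφ).const_mul hB (-(1 / Real.pi))).add hB
        ((hfar (n + 1)).tameHolder_of_succ hV (hS.convex U hU))).congr hB (hS.star U hU).isOpen he
    intro U hU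
    obtain ⟨U', hU', ε, φ, hε, hφ, hfar, he⟩ := hdecomp U hU
    have hB := isAlgebraClass_tame hV (hS.star U hU)
    have hg := (hf.reg_of_pot hfix (hS.star U' hU')
      (isAlgebraClass_tameHolder hV (hS.star U' hU')) hf.tameHolder (hpot U' hU').2 (hH U' hU')
      (hS.pos U' hU') (hS.inv U' hU')).2
    exact (((hg.conv_logKer_succ hV hε hφ).const_mul hB (-(1 / Real.pi))).add hB
      (hfar (n + 1))).congr hB (hS.star U hU).isOpen he

theorem IsProfile.contDiffOn_of_family (hf : IsProfile f) (h0 : atInfinity f = 0)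
    (hi : IntegrableOn f (Ioi 0)) (hfix : R a f = f) (hS : IsRegFamily a f V S) (hU : U ∈ S) :
    ContDiffOn ℝ ∞ f U := by
  rw [contDiffOn_infty]
  intro n
  have hB := isAlgebraClass_tame hS.weight (hS.star U hU)
  have hr := hf.reg_deriv_pot h0 hi hfix hS n U hU
  exact (hf.reg_of_pot hfix (hS.star U hU) hB hf.tameHolder.1 (hf.hasDerivAt_pot h0 hi hS hU).2 hr
    (hS.pos U hU) (hS.inv U hU)).1.contDiffOn (hS.star U hU).isOpen

end Bootstrap

end Euler

/-! ### Domains for the bootstrap: the line and nested intervals. -/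

section Domains

variable {f : ℝ → ℝ} {a : ℝ}

lemma isWeight_one : IsWeight fun _ => 1 :=
  ⟨fun _ => le_rfl, ⟨1, le_rfl, fun _ _ _ => by norm_num⟩, fun _ _ _ => le_rfl⟩

lemma isWeight_one_add_sq : IsWeight fun x => 1 + x ^ 2 where
  one_le x := by nlinarith [sq_nonneg x]
  slow := by
    refine ⟨3, by norm_num, fun x y h => ?_⟩
    have h1 : (x - y) ^ 2 ≤ 1 := by rw [← sq_abs]; nlinarith [abs_nonneg (x - y)]
    nlinarith [sq_nonneg (2 * x - y)]
  ray x t ht := by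
    have : t ^ 2 ≤ 1 := by nlinarith [ht.1, ht.2]
    rw [mul_pow]
    nlinarith [sq_nonneg x]

lemma IsProfile.isRegFamily_univ (hf : IsProfile f) {V : ℝ → ℝ} (hV : IsWeight V) {δ : ℝ}
    {m : ℕ} (hδ : 0 < δ) (h : ∀ x, δ / V x ^ m ≤ theta a f x) : IsRegFamily a f V {univ} := by
  have hpos : ∀ x, 0 < theta a f x := fun x =>
    lt_of_lt_of_le (div_pos hδ (pow_pos (hV.pos x) m)) (h x)
  refine ⟨hV, ?_, ?_, ?_, ?_, ?_⟩ <;> rintro U rfl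
  · exact ⟨isOpen_univ, fun _ _ _ _ => mem_univ _⟩
  · exact convex_univ
  · exact ⟨univ, rfl, 1 / 4, by norm_num, le_rfl, isOpen_univ, isOpen_univ,
      fun _ _ _ _ => mem_univ _⟩
  · exact fun x _ => hpos x
  · refine ⟨(hf.continuous_theta.inv₀ fun x => (hpos x).ne').continuousOn, δ⁻¹, m, by positivity,
      fun x _ => ?_⟩
    rw [abs_of_pos (inv_pos.2 (hpos x))]
    have hp := pow_pos (hV.pos x) m
    refine (inv_anti₀ (div_pos hδ hp) (h x)).trans (le_of_eq ?_)
    rw [inv_div]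
    field_simp

/-- Each turn of the bootstrap needs a slightly larger interval, so all `M < l` are taken together.
Compactness of `[-M, M]` bounds `1 / theta`, so the weight can be constant. -/
lemma IsProfile.isRegFamily_Ioo (hf : IsProfile f) {l : ℝ}
    (hpos : ∀ x, |x| < l → 0 < theta a f x) :
    IsRegFamily a f (fun _ => 1) {U | ∃ M, 0 < M ∧ M < l ∧ U = Ioo (-M) M} := by
  refine ⟨isWeight_one, ?_, ?_, ?_, ?_, ?_⟩ <;> rintro U ⟨M, hM, hMl, rfl⟩
  · refine ⟨isOpen_Ioo, fun x hx t ht => ?_⟩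
    rw [mem_Ioo, ← abs_lt] at hx ⊢
    rw [abs_mul, abs_of_nonneg ht.1]
    exact lt_of_le_of_lt (mul_le_of_le_one_left (abs_nonneg x) ht.2) hx
  · exact convex_Ioo _ _
  · refine ⟨Ioo (-((M + l) / 2)) ((M + l) / 2), ⟨_, by linarith, by linarith, rfl⟩,
      min (1 / 4) ((l - M) / 4), lt_min (by norm_num) (by linarith), min_le_left _ _, isOpen_Ioo,
      isOpen_Ioo, fun x hx r hr => ?_⟩
    rw [mem_Ioo, ← abs_lt] at hx ⊢
    have := min_le_right (1 / 4) ((l - M) / 4)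
    exact lt_of_le_of_lt (abs_sub _ _) (by linarith)
  · intro x hx
    rw [mem_Ioo, ← abs_lt] at hx
    exact hpos x (hx.trans hMl)
  · have hc : ContinuousOn (fun x => (theta a f x)⁻¹) (Icc (-M) M) :=
      hf.continuous_theta.continuousOn.inv₀ fun x hx =>
        (hpos x (lt_of_le_of_lt (_root_.abs_le.2 hx) hMl)).ne'
    obtain ⟨C, hC⟩ := isCompact_Icc.exists_bound_of_continuousOn hc
    refine ⟨hc.mono Ioo_subset_Icc_self, C, 0,
      (norm_nonneg _).trans (hC 0 ⟨by linarith, hM.le⟩), fun x hx => ?_⟩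
    rw [pow_zero, mul_one]
    exact hC x (Ioo_subset_Icc_self hx)

lemma IsProfile.contDiffOn_of_zero (hf : IsProfile f) (h0 : atInfinity f = 0)
    (hi : IntegrableOn f (Ioi 0)) (hfix : R a f = f) {x₀ : ℝ} (hx₀ : 0 ≤ x₀) (hz : f x₀ = 0) :
    ContDiffOn ℝ ∞ f (Ioo (-L f) (L f)) := by
  obtain ⟨-, -, hS⟩ := hf.pos_set_eq hx₀ hz
  have hpos : ∀ x, |x| < L f → 0 < theta a f x := fun x hx => by
    apply theta_pos_of_pos hfix
    have : x ∈ Ioo (-L f) (L f) := by rwa [mem_Ioo, ← abs_lt]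
    rwa [← hS] at this
  intro x hx
  rw [mem_Ioo, ← abs_lt] at hx
  have h1 := abs_nonneg x
  have h2 := hf.contDiffOn_of_family h0 hi hfix (hf.isRegFamily_Ioo hpos)
    (U := Ioo (-((|x| + L f) / 2)) ((|x| + L f) / 2)) ⟨_, by linarith, by linarith, rfl⟩
  refine (h2.contDiffAt (isOpen_Ioo.mem_nhds ?_)).contDiffWithinAt
  rw [mem_Ioo, ← abs_lt]
  linarith

end Domains

/-! ### Sobolev regularity on the whole line. -/

section Global

variable {f A h V : ℝ → ℝ} {a p : ℝ}

lemma Reg.deriv_of_forall (hh : ∀ n, Reg univ (Tame univ V) n h) :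
    (∀ x, HasDerivAt h (deriv h x) x) ∧ ∀ n, Reg univ (Tame univ V) n (deriv h) := by
  have key : ∀ n, (∀ x, HasDerivAt h (deriv h x) x) ∧ Reg univ (Tame univ V) n (deriv h) := by
    intro n
    obtain ⟨-, g, hg, hr⟩ := hh (n + 1)
    have : deriv h = g := funext fun x => (hg x (mem_univ x)).deriv
    rw [this]
    exact ⟨fun x => hg x (mem_univ x), hr⟩
  exact ⟨(key 0).1, fun n => (key n).2⟩

/-- Products of `f` with smooth tame functions lie in all Sobolev spaces if `f` absorbs powers of
the weight and its logarithmic derivative is smooth and tame. -/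
lemma memH_mul (hV : IsWeight V) (hd : ∀ x, HasDerivAt f (f x * A x) x)
    (hA : ∀ n, Reg univ (Tame univ V) n A) (hh : ∀ n, Reg univ (Tame univ V) n h)
    (hL : ∀ m : ℕ, MemLp (fun x => f x * V x ^ m) 2 volume) (p : ℝ) :
    MemH p fun x => f x * h x := by
  have hB := isAlgebraClass_tame hV (U := univ) ⟨isOpen_univ, fun _ _ _ _ => mem_univ _⟩
  have hfc : Continuous f := continuous_iff_continuousAt.2 fun x => (hd x).continuousAt
  -- From `f' = f A`, `(f g)' = f (A g + g')`: every derivative of `f h` is `f` times a tame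
  -- function.
  let H : ℕ → ℝ → ℝ := fun n => Nat.rec h (fun _ g x => A x * g x + deriv g x) n
  have hH : ∀ j n, Reg univ (Tame univ V) n (H j) := by
    intro j
    induction j with
    | zero => exact hh
    | succ j ih => exact fun n => ((hA n).mul hB (ih n)).add hB ((Reg.deriv_of_forall ih).2 n)
  refine memH_of_hasDerivAt (g := fun n x => f x * H n x) (fun n x => ?_) (fun n => ?_) p
  · refine ((hd x).mul ((Reg.deriv_of_forall (hH n)).1 x)).congr_deriv ?_
    change _ = f x * (A x * H n x + deriv (H n) x)
    ring
  · obtain ⟨hc, C, m, hC, hb⟩ := hH n 0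
    rw [continuousOn_univ] at hc
    refine (hL m).of_le_mul (c := C) (hfc.mul hc).aestronglyMeasurable (ae_of_all _ fun x => ?_)
    have := pow_pos (hV.pos x) m
    rw [Real.norm_eq_abs, Real.norm_eq_abs, abs_mul, abs_mul, abs_of_pos this]
    calc |f x| * |H n x| ≤ |f x| * (C * V x ^ m) :=
          mul_le_mul_of_nonneg_left (hb x (mem_univ x)) (abs_nonneg _)
      _ = _ := by ring

lemma IsProfile.memH_fixed (hf : IsProfile f) (h0 : atInfinity f = 0)
    (hi : IntegrableOn f (Ioi 0)) (hfix : R a f = f) (hS : IsRegFamily a f V {univ})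
    (hpos : ∀ x, 0 < f x) (hL : ∀ m : ℕ, MemLp (fun x => f x * V x ^ m) 2 volume) :
    Differentiable ℝ f ∧ ∀ p, MemH p f ∧ MemH p (deriv fun x => x * f x) := by
  have hU := hS.star univ rfl
  have hB := isAlgebraClass_tame hS.weight hU
  have hd := (hf.hasDerivAt_pot h0 hi hS rfl).2
  have hE : ∀ n, Reg univ (Tame univ V) n (euler a f) := fun n =>
    hf.reg_euler hU hB hd (hf.reg_deriv_pot h0 hi hfix hS n univ rfl) (hS.pos _ rfl) (hS.inv _ rfl)
  -- The witness of `Reg.exists_logDeriv` depends on `n`; positivity of `f` identifies it with `f' /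
  -- f`, one function for all orders.
  have hA : ∀ n, Reg univ (Tame univ V) n (fun x => deriv f x / f x) ∧
      ∀ x, HasDerivAt f (f x * (deriv f x / f x)) x := by
    intro n
    obtain ⟨A, hA, hdA⟩ := (hE (n + 1)).exists_logDeriv hB hU hf.cont.continuousOn hf.euler_zero
      fun x hx hx0 => hf.hasDerivAt_fixed hfix hU (hS.pos _ rfl) hx hx0 (hd x hx)
    have e : (fun x => deriv f x / f x) = A := funext fun x => by
      rw [(hdA x (mem_univ x)).deriv, mul_div_cancel_left₀ _ (hpos x).ne']
    refine ⟨e ▸ hA, fun x => ?_⟩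
    rw [mul_div_cancel₀ _ (hpos x).ne']
    exact (hdA x (mem_univ x)).differentiableAt.hasDerivAt
  refine ⟨fun x => ((hA 0).2 x).differentiableAt, fun p => ⟨?_, ?_⟩⟩
  · have := memH_mul hS.weight (hA 0).2 (fun n => (hA n).1) (fun n => Reg.const hB 1) hL p
    simpa using this
  · have e : (deriv fun x => x * f x) = fun x => f x * euler a f x := funext fun x =>
      (hf.hasDerivAt_moment h0 hi hfix hS rfl (mem_univ x)).deriv
    rw [e]
    exact memH_mul hS.weight (hA 0).2 (fun n => (hA n).1) hE hL p

lemma IsProfile.memLp_two (hf : IsProfile f) (hi : IntegrableOn f (Ioi 0)) :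
    MemLp f 2 volume := by
  rw [memLp_two_iff_integrable_sq hf.cont.aestronglyMeasurable]
  have h1 : Integrable f := by
    rw [← integrableOn_univ, ← Iic_union_Ioi (a := (0 : ℝ))]
    refine IntegrableOn.union ?_ hi
    have h2 : IntegrableOn (fun x => f (-x)) (Iic 0) := by
      rw [integrableOn_Iic_iff_integrableOn_Iio]
      have := (Measure.measurePreserving_neg (volume : Measure ℝ)).integrableOn_comp_preimage
        (Homeomorph.neg ℝ).measurableEmbedding (f := f) (s := Ioi 0)
      simpa [Function.comp_def] using this.2 hi
    exact h2.congr (ae_of_all _ hf.even)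
  refine h1.mono' (by have := hf.cont; fun_prop : Continuous _).aestronglyMeasurable
    (ae_of_all _ fun x => ?_)
  have h2 := hf.nonneg x
  have h3 := hf.le_one x
  rw [Real.norm_eq_abs, abs_of_nonneg (by positivity)]
  nlinarith

lemma IsProfile.memLp_mul_pow (hf : IsProfile f)
    (hdec : ∀ N : ℝ, 0 < N → ∃ X₀ > 0, ∃ K, ∀ x, X₀ ≤ x → f x ≤ K * x ^ (-N)) (m : ℕ) :
    MemLp (fun x => f x * (1 + x ^ 2) ^ m) 2 volume := by
  -- Two powers of `x` beyond those in `(1 + x²)^m` bound the product by a multiple of the square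
  -- integrable `1 / (1 + x²)`.
  obtain ⟨X₀, hX₀, K, hK⟩ := hdec ((2 * (m + 1) : ℕ) : ℝ) (by positivity)
  have hb : ∃ C, 0 ≤ C ∧ ∀ x, f x * (1 + x ^ 2) ^ (m + 1) ≤ C := by
    set X := max X₀ 1
    refine ⟨max ((1 + X ^ 2) ^ (m + 1)) (K * 2 ^ (m + 1)), le_max_of_le_left (by positivity),
      fun x => ?_⟩
    rw [← hf.abs_arg, ← sq_abs]
    have hx0 := abs_nonneg x
    rcases le_total |x| X with hx | hx
    · refine le_max_of_le_left ?_
      have h1 : (1 + |x| ^ 2) ^ (m + 1) ≤ (1 + X ^ 2) ^ (m + 1) := by gcongr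
      exact (mul_le_of_le_one_left (by positivity) (hf.le_one _)).trans h1
    · refine le_max_of_le_right ?_
      have hx1 : 1 ≤ |x| := (le_max_right _ _).trans hx
      have hxp : 0 < |x| := by linarith
      have h1 := hK _ ((le_max_left _ _).trans hx)
      rw [Real.rpow_neg hx0, Real.rpow_natCast, ← div_eq_mul_inv, le_div_iff₀ (by positivity),
        pow_mul] at h1
      have h2 : (1 + |x| ^ 2) ^ (m + 1) ≤ (2 * |x| ^ 2) ^ (m + 1) := by
        gcongr
        nlinarith
      calc f |x| * (1 + |x| ^ 2) ^ (m + 1) ≤ f |x| * (2 * |x| ^ 2) ^ (m + 1) :=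
            mul_le_mul_of_nonneg_left h2 (hf.nonneg _)
        _ = f |x| * (|x| ^ 2) ^ (m + 1) * 2 ^ (m + 1) := by rw [mul_pow]; ring
        _ ≤ _ := mul_le_mul_of_nonneg_right h1 (by positivity)
  obtain ⟨C, hC0, hC⟩ := hb
  have hc : Continuous fun x => f x * (1 + x ^ 2) ^ m := by
    have := hf.cont
    fun_prop
  rw [memLp_two_iff_integrable_sq hc.aestronglyMeasurable]
  refine (integrable_inv_one_add_sq.const_mul (C ^ 2)).mono' (hc.pow 2).aestronglyMeasurable
    (ae_of_all _ fun x => ?_)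
  have h0 := hf.nonneg x
  have h1 : f x * (1 + x ^ 2) ^ m ≤ C * (1 + x ^ 2)⁻¹ := by
    rw [← div_eq_mul_inv, le_div_iff₀ (by positivity), mul_assoc, ← pow_succ]
    exact hC x
  have h2 : (1 + x ^ 2)⁻¹ ≤ 1 := inv_le_one_of_one_le₀ (by nlinarith [sq_nonneg x])
  have h3 : 0 < (1 + x ^ 2)⁻¹ := by positivity
  rw [Real.norm_eq_abs, abs_of_nonneg (by positivity)]
  calc (f x * (1 + x ^ 2) ^ m) ^ 2 ≤ (C * (1 + x ^ 2)⁻¹) ^ 2 := by gcongr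
    _ = C ^ 2 * ((1 + x ^ 2)⁻¹ * (1 + x ^ 2)⁻¹) := by ring
    _ ≤ C ^ 2 * ((1 + x ^ 2)⁻¹ * 1) := by gcongr
    _ = _ := by rw [mul_one]

end Global

end GCLM

theorem mainTheorem6 (a : ℝ) (ha : a ≤ 1) (f : ℝ → ℝ) (hfD : f ∈ GCLM.setD)
    (hfix : GCLM.R a f = f) :
    GCLM.b f ≠ ⊤ ∧
    (2 * a * GCLM.k f > 1 - a / 3 →
      BddAbove {x | 0 < f x} ∧
      HasCompactSupport f ∧
      tsupport f = Icc (-GCLM.L f) (GCLM.L f) ∧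
      ContDiffOn ℝ ∞ f (Ioo (-GCLM.L f) (GCLM.L f))) ∧
    (2 * a * GCLM.k f ≤ 1 - a / 3 →
      (∀ x, 0 < f x) ∧
      Differentiable ℝ f ∧
      ∀ p : ℝ, 0 ≤ p → GCLM.MemH p f ∧ GCLM.MemH p (deriv fun x => x * f x)) := by
  have hf := GCLM.isProfile_of_mem hfD
  have hi := hf.fixed_integrable ha hfix
  have hfi : GCLM.atInfinity f = 0 → IntegrableOn f (Ioi 0) := fun h0 =>
    hi.congr (ae_of_all _ fun x => by simp [GCLM.dec, h0])
  refine ⟨hf.b_ne_top hi, fun h => ?_, fun h => ?_⟩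
  · have hneg : GCLM.thetaInf a f < 0 := by
      by_contra hcon
      exact absurd ((hf.k_le_iff ha).2 (not_lt.1 hcon)) (not_le.2 h)
    obtain ⟨x₀, hx₀, hz⟩ := hf.exists_zero ha hfix hi hneg
    have h0 := (hf.integrable_of_vanish hx₀ hz).1
    have hs := hf.tsupport_eq hx₀ hz
    refine ⟨(hf.pos_set_eq hx₀ hz).1, ?_, hs, hf.contDiffOn_of_zero h0 (hfi h0) hfix hx₀ hz⟩
    rw [HasCompactSupport, hs]
    exact isCompact_Icc
  · have hθ := (hf.k_le_iff ha).1 h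
    have hpos := hf.theta_pos ha hi hθ
    have hfpos : ∀ x, 0 < f x := fun x => GCLM.fixed_pos hfix fun y _ => hpos y
    have h0 := hf.atInfinity_eq_zero ha hfix hi hθ
    have key : Differentiable ℝ f ∧
        ∀ p, GCLM.MemH p f ∧ GCLM.MemH p (deriv fun x => x * f x) := by
      -- In the critical case `1 / theta` may grow quadratically, so the weight is `1 + x²` and
      -- rapid decay of `f` compensates. Otherwise `theta` is bounded below, the weight is `1`, and
      -- square integrability of `f` is enough.
      rcases hθ.eq_or_lt with hθ | hθ
      · obtain ⟨δ, hδ, hb⟩ := hf.theta_lower_critical ha hi hθ.symm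
        exact hf.memH_fixed h0 (hfi h0) hfix
          (hf.isRegFamily_univ GCLM.isWeight_one_add_sq (m := 1) hδ (by simpa using hb)) hfpos
          (hf.memLp_mul_pow fun N hN => hf.exists_decay_critical ha hfix hi hθ.symm hN)
      · obtain ⟨δ, hδ, hb⟩ := hf.theta_lower ha hi hθ
        exact hf.memH_fixed h0 (hfi h0) hfix
          (hf.isRegFamily_univ GCLM.isWeight_one (m := 0) hδ (by simpa using hb)) hfpos
          fun m => by simpa using hf.memLp_two (hfi h0)
    exact ⟨hfpos, key.1, fun p _ => key.2 p⟩
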